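/- Let $G=(A,B,E)$ denote a finite simple bipartite graph given with its bipartition. For $t,\Delta\in\mathbb{N}$, a $(t,\Delta)$-tree is a tree of maximum degree at most $\Delta$ with at most $t$ vertices of degree at least $3$, and $G$ is $(t,\Delta)$-tree convex if there is a $(t,\Delta)$-tree $T$ with $V(T)=A$ such that for every $b\in B$ the neighbourhood of $b$ in $G$ induces a connected subgraph of $T$ (the empty subgraph counts as connected). An ordering $v_1,\dots,v_n$ of $V(G)=A\cup B$ and a partition of $V(G)$ into at most $k$ classes are consistent if for all $q<r<s$ such that $v_q,v_r$ lie in the same class and $v_qv_s\in E$, also $v_rv_s\in E$. The thinness of $G$ is the least $k$ for which a consistent ordering and partition into $k$ classes exist. Theorem. For every $t,\Delta\in\mathbb{N}$ with $t\ge 1$ and $\Delta\ge 3$, every $(t,\Delta)$-tree convex graph has thinness at most $2+t(\Delta-2)$. Moreover, for every such fixed $t$ and $\Delta$, there is an algorithm that, given a $(t,\Delta)$-tree convex graph $G=(A,B,E)$ (without a tree $T$), computes a consistent ordering and partition of $V(G)$ into at most $2+t(\Delta-2)$ classes in time polynomial in $|V(G)|$. -/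

import Mathlib

/-! ### Thinness -/

section Thinness

variable {V : Type*}

/-- The ordering `v 0, v 1, …` of the vertices of `G` and the partition of the vertices into the
classes `{x | c x = j}`, `j < k`, are consistent. -/
def IsConsistent (G : SimpleGraph V) {n k : ℕ} (v : Fin n ≃ V) (c : V → Fin k) : Prop :=
  ∀ q r s : Fin n, q < r → r < s → c (v q) = c (v r) → G.Adj (v q) (v s) → G.Adj (v r) (v s)

/-- `G` is `k`-thin. Some of the `k` classes may be empty, which does not affect the minimum. -/
def IsThin (G : SimpleGraph V) (k : ℕ) : Prop :=
  ∃ (v : Fin (Nat.card V) ≃ V) (c : V → Fin k), IsConsistent G v c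

/-- The thinness of a finite graph: the minimum `k` such that the graph is `k`-thin. -/
noncomputable def thinness (G : SimpleGraph V) : ℕ := sInf {k | IsThin G k}

/-- The minimum in the definition of thinness is over a nonempty set. -/
theorem isThin_natCard [Finite V] (G : SimpleGraph V) : IsThin G (Nat.card V) := by
  refine ⟨(Finite.equivFin V).symm, Finite.equivFin V, ?_⟩
  intro q r s hqr _ hc
  simp only [Equiv.apply_symm_apply] at hc
  exact absurd hc hqr.ne

/-- The minimum in the definition of thinness is attained. -/
theorem isThin_thinness [Finite V] (G : SimpleGraph V) : IsThin G (thinness G) :=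
  Nat.sInf_mem (s := {k | IsThin G k}) ⟨_, isThin_natCard G⟩

end Thinness

/-! ### Tree convex graphs -/

section Convex

universe u

variable {V : Type u}

/-- A `(t, Δ)`-tree: a tree of maximum degree at most `Δ` with at most `t` vertices of degree at
least `3`. -/
structure IsTDeltaTree (t Δ : ℕ) (T : SimpleGraph V) : Prop where
  isTree : T.IsTree
  degree_le : ∀ x, (T.neighborSet x).encard ≤ Δ
  branching_le : {x | 3 ≤ (T.neighborSet x).encard}.encard ≤ t

/-- The bipartite graph `G = (A, B, E)` is `ℋ`-convex: some member of `ℋ` with vertex set `A` is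
such that the neighbourhood of each `b ∈ B` induces a connected subgraph of it. (The subgraph with
no vertices counts as connected, so `b ∈ B` may be isolated in `G`.) -/
structure IsHConvex (ℋ : {W : Type u} → SimpleGraph W → Prop)
    (G : SimpleGraph V) (A B : Set V) : Prop where
  bipartite : G.IsBipartiteWith A B
  cover : A ∪ B = Set.univ
  support : ∃ H : SimpleGraph A, ℋ H ∧ ∀ b ∈ B, (H.induce {a : A | G.Adj b a}).Preconnected

/-- The bipartite graph `G = (A, B, E)` is `(t, Δ)`-tree convex. -/
def IsTDeltaTreeConvex (t Δ : ℕ) (G : SimpleGraph V) (A B : Set V) : Prop :=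
  IsHConvex (fun H => IsTDeltaTree t Δ H) G A B

end Convex

/-! ### Random access machines with a step count -/

namespace RAM

/-- Memory: registers and arrays, both named by natural numbers, all holding natural numbers.
A program mentions only finitely many registers and arrays. -/
structure State where
  reg : ℕ → ℕ
  arr : ℕ → ℕ → ℕ

/-- `x := c`. -/
def State.setReg (σ : State) (x c : ℕ) : State :=
  { σ with reg := Function.update σ.reg x c }

/-- `a[i] := c`. -/
def State.setArr (σ : State) (a i c : ℕ) : State :=
  { σ with arr := Function.update σ.arr a (Function.update (σ.arr a) i c) }

/-- Programs. The only arithmetic is addition and (truncated) subtraction, so that in `T` steps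
numbers grow by at most `T` bits, and unit cost agrees with Turing machine time up to a
polynomial. -/
inductive Prog where
  | skip : Prog
  | const (x c : ℕ) : Prog
  | add (x y z : ℕ) : Prog
  | sub (x y z : ℕ) : Prog
  | load (x a i : ℕ) : Prog
  | store (a i x : ℕ) : Prog
  | seq (P Q : Prog) : Prog
  | branch (x : ℕ) (P Q : Prog) : Prog
  | loop (x : ℕ) (P : Prog) : Prog

/-- `Runs P σ τ T`: started in the state `σ`, the program `P` halts in the state `τ` after exactly
`T` steps. Every elementary instruction and every test takes one step. -/
inductive Runs : Prog → State → State → ℕ → Prop where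
  | skip (σ : State) : Runs .skip σ σ 1
  /-- `x := c` -/
  | const (σ : State) (x c : ℕ) : Runs (.const x c) σ (σ.setReg x c) 1
  /-- `x := y + z` -/
  | add (σ : State) (x y z : ℕ) : Runs (.add x y z) σ (σ.setReg x (σ.reg y + σ.reg z)) 1
  /-- `x := y - z` -/
  | sub (σ : State) (x y z : ℕ) : Runs (.sub x y z) σ (σ.setReg x (σ.reg y - σ.reg z)) 1
  /-- `x := a[i]` -/
  | load (σ : State) (x a i : ℕ) : Runs (.load x a i) σ (σ.setReg x (σ.arr a (σ.reg i))) 1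
  /-- `a[i] := x` -/
  | store (σ : State) (a i x : ℕ) : Runs (.store a i x) σ (σ.setArr a (σ.reg i) (σ.reg x)) 1
  /-- `P; Q` -/
  | seq {P Q : Prog} {σ τ υ : State} {m n : ℕ} :
      Runs P σ τ m → Runs Q τ υ n → Runs (.seq P Q) σ υ (m + n)
  /-- `if x ≠ 0 then P else Q` -/
  | branch_pos {x : ℕ} {P : Prog} (Q : Prog) {σ τ : State} {m : ℕ} :
      σ.reg x ≠ 0 → Runs P σ τ m → Runs (.branch x P Q) σ τ (m + 1)
  | branch_zero {x : ℕ} (P : Prog) {Q : Prog} {σ τ : State} {m : ℕ} :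
      σ.reg x = 0 → Runs Q σ τ m → Runs (.branch x P Q) σ τ (m + 1)
  /-- `while x ≠ 0 do P` -/
  | loop_pos {x : ℕ} {P : Prog} {σ τ υ : State} {m n : ℕ} :
      σ.reg x ≠ 0 → Runs P σ τ m → Runs (.loop x P) τ υ n → Runs (.loop x P) σ υ (m + n + 1)
  | loop_zero {x : ℕ} (P : Prog) {σ : State} :
      σ.reg x = 0 → Runs (.loop x P) σ σ 1

open Classical in
/-- The input `G = (A, B, E)` with vertices `0, …, n - 1`: register `0` holds `n`, array `0` holds
the `n × n` adjacency matrix row by row, array `1` holds the indicator vector of `A` (its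
complement is `B`), and everything else is `0`. -/
noncomputable def inputState {n : ℕ} (G : SimpleGraph (Fin n)) (A : Set (Fin n)) : State where
  reg x := if x = 0 then n else 0
  arr a k :=
    if (a = 0 ∧ ∃ i j : Fin n, G.Adj i j ∧ k = (i : ℕ) * n + j) ∨
        (a = 1 ∧ ∃ i : Fin n, i ∈ A ∧ k = i) then 1 else 0

/-- The output: array `2` lists the vertices in the order `v`, and array `3` lists the classes of
the vertices `0, …, n - 1` under `c`. -/
def IsOutput {n k : ℕ} (τ : State) (v : Fin n ≃ Fin n) (c : Fin n → Fin k) : Prop :=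
  (∀ i : Fin n, τ.arr 2 i = v i) ∧ ∀ x : Fin n, τ.arr 3 x = c x

end RAM

/-! ### A small language compiled to random access machines -/

/-! The bound. Root the tree `T` at a vertex of degree at most 1. Order `A` bottom-up, by number of
descendants, and put every other vertex after its last neighbour. One class consists of the vertices
outside `A`; a vertex of `A` is classed by the first leaf below it, so each class in `A` is a chain
of ancestors. Suppose `q < p < s`, with `q` and `p` in one class and `q` adjacent to `s`. If `q` is
in `A`, then `p` is an ancestor of `q`, and the last neighbour `m` of `s`, which is the top of its
neighbourhood, is an ancestor of `p`. The neighbourhood is connected and contains `m` and `q`, so it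
contains `p` (`adj_of_position_lt`). If `q` is outside `A`, it comes after all its neighbours, so
this case is void. By the handshake lemma the number of leaves below the root is at most 1 plus the
excess, the sum of the truncated `degree - 2` (`card_isBottom_le`), and the excess of a (t, Δ)-tree
is at most `t * (Δ - 2)`.

The algorithm. Only the excess entered the bound, so it is enough to find any tree that supports the
hypergraph of neighbourhoods and whose excess is no larger than that of the unknown `T`. Let `N a`
be the set of hyperedges through `a`. For a set `S`, call two vertices equivalent if they are linked
by a chain in which consecutive vertices share strictly more than `S`. Let `k ≥ 2` be the number of
classes of `{a | S ⊆ N a}`. In a supporting tree at least `k - 1` edges have separator `S`; they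
have `2k - 2 = k + (k - 2)` ends. Represent these by tokens: one bound to each class, and `k - 2`
free ones that may lie anywhere in `{a | S ⊆ N a}`. Every supporting tree yields a placement with at
most `degree a` tokens on `a` (`exists_placement`). Conversely, every allowed placement yields a
supporting tree whose degree at `a` is at most the number of tokens on `a` (`joinGraph_isTree`,
`joinGraph_preconnected`, `degree_joinGraph_le`).

It remains to minimise the excess of a placement. Give every vertex two places; then the excess is
at most the number of tokens left without a place. This is a bipartite matching problem, solved by
an auction whose final prices exhibit a Hall-type obstruction (`Auction.card_unplaced_le`).

Polynomial time is obtained from a language whose only loops and sums have a number of rounds linear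
in the input size, so that each command has a polynomial cost by structural recursion
(`Cmd.runsIn_compile`). -/

namespace RAM

/-- `P` takes `σ` to `τ` in at most `b` steps. -/
def RunsIn (P : Prog) (σ τ : State) (b : ℕ) : Prop := ∃ T ≤ b, Runs P σ τ T

theorem RunsIn.mono {P : Prog} {σ τ : State} {a b : ℕ} (h : RunsIn P σ τ a) (hab : a ≤ b) :
    RunsIn P σ τ b := by
  obtain ⟨T, hT, h⟩ := h
  exact ⟨T, hT.trans hab, h⟩

theorem RunsIn.seq {P Q : Prog} {σ τ υ : State} {a b : ℕ} (h : RunsIn P σ τ a)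
    (h' : RunsIn Q τ υ b) : RunsIn (.seq P Q) σ υ (a + b) := by
  obtain ⟨T, hT, h⟩ := h
  obtain ⟨T', hT', h'⟩ := h'
  exact ⟨T + T', by omega, .seq h h'⟩

theorem runsIn_skip (σ : State) : RunsIn .skip σ σ 1 := ⟨1, le_rfl, .skip σ⟩

theorem runsIn_const (σ : State) (x c : ℕ) : RunsIn (.const x c) σ (σ.setReg x c) 1 :=
  ⟨1, le_rfl, .const σ x c⟩

theorem runsIn_add (σ : State) (x y z : ℕ) :
    RunsIn (.add x y z) σ (σ.setReg x (σ.reg y + σ.reg z)) 1 := ⟨1, le_rfl, .add σ x y z⟩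

theorem runsIn_sub (σ : State) (x y z : ℕ) :
    RunsIn (.sub x y z) σ (σ.setReg x (σ.reg y - σ.reg z)) 1 := ⟨1, le_rfl, .sub σ x y z⟩

theorem runsIn_load (σ : State) (x a i : ℕ) :
    RunsIn (.load x a i) σ (σ.setReg x (σ.arr a (σ.reg i))) 1 := ⟨1, le_rfl, .load σ x a i⟩

theorem runsIn_store (σ : State) (a i x : ℕ) :
    RunsIn (.store a i x) σ (σ.setArr a (σ.reg i) (σ.reg x)) 1 := ⟨1, le_rfl, .store σ a i x⟩

theorem RunsIn.branch_pos {x : ℕ} {P : Prog} (Q : Prog) {σ τ : State} {b : ℕ}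
    (hx : σ.reg x ≠ 0) (h : RunsIn P σ τ b) : RunsIn (.branch x P Q) σ τ (b + 1) := by
  obtain ⟨T, hT, h⟩ := h
  exact ⟨T + 1, by omega, .branch_pos Q hx h⟩

theorem RunsIn.branch_zero {x : ℕ} (P : Prog) {Q : Prog} {σ τ : State} {b : ℕ}
    (hx : σ.reg x = 0) (h : RunsIn Q σ τ b) : RunsIn (.branch x P Q) σ τ (b + 1) := by
  obtain ⟨T, hT, h⟩ := h
  exact ⟨T + 1, by omega, .branch_zero P hx h⟩

@[simp] theorem State.setReg_reg (σ : State) (x c y : ℕ) :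
    (σ.setReg x c).reg y = if y = x then c else σ.reg y := by
  simp [State.setReg, Function.update_apply]

@[simp] theorem State.setReg_arr (σ : State) (x c : ℕ) : (σ.setReg x c).arr = σ.arr := rfl

@[simp] theorem State.setArr_reg (σ : State) (a i c : ℕ) : (σ.setArr a i c).reg = σ.reg := rfl

/-- `while m ≠ 0 do (P; x := x + o; m := m - o)`. -/
def countLoop (x m o : ℕ) (P : Prog) : Prog :=
  .loop m (.seq P (.seq (.add x x o) (.sub m m o)))

/-- The body may use scratch registers but has to return the three loop registers unchanged. The
invariant must tolerate arbitrary new values in `x` and `m`, which the loop itself overwrites. -/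
theorem runsIn_countLoop {x m o : ℕ} (hxm : x ≠ m) (hxo : x ≠ o) (hmo : m ≠ o) {P : Prog}
    {B b : ℕ} (J : ℕ → State → Prop)
    (step : ∀ i σ, i < b → J i σ → σ.reg x = i → ∃ τ, RunsIn P σ τ B ∧ τ.reg x = i ∧
      τ.reg m = σ.reg m ∧ τ.reg o = σ.reg o ∧ ∀ c d, J (i + 1) ((τ.setReg x c).setReg m d))
    {σ : State} (h0 : J 0 σ) (hx : σ.reg x = 0) (hm : σ.reg m = b) (ho : σ.reg o = 1) :
    ∃ τ, RunsIn (countLoop x m o P) σ τ (b * (B + 3) + 1) ∧ J b τ := by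
  -- Induction on the rounds `k` still to come, since `m` counts down while `x` counts up.
  suffices H : ∀ k i σ, i + k = b → J i σ → σ.reg x = i → σ.reg m = k → σ.reg o = 1 →
      ∃ τ, RunsIn (countLoop x m o P) σ τ (k * (B + 3) + 1) ∧ J b τ from
    H b 0 σ (by omega) h0 hx hm ho
  intro k
  induction k with
  | zero =>
    intro i σ hi hJ _ hm _
    refine ⟨σ, ⟨1, by omega, .loop_zero _ hm⟩, ?_⟩
    obtain rfl : i = b := by omega
    exact hJ
  | succ k ih =>
    intro i σ hi hJ hx hm ho
    obtain ⟨τ, hP, hτx, hτm, hτo, hJ'⟩ := step i σ (by omega) hJ hx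
    have hbody := hP.seq ((runsIn_add τ x x o).seq (runsIn_sub _ m m o))
    have hreg : ((τ.setReg x (τ.reg x + τ.reg o)).reg m
        - (τ.setReg x (τ.reg x + τ.reg o)).reg o) = k := by
      simp [hxm.symm, hxo.symm, hτm, hτo, hm, ho]
    rw [hreg] at hbody
    obtain ⟨υ, hυ, hJb⟩ := ih (i + 1) ((τ.setReg x (τ.reg x + τ.reg o)).setReg m k) (by omega)
      (hJ' _ _) (by simp [hxm, hτx, hτo, ho]) (by simp) (by simp [hmo.symm, hxo.symm, hτo, ho])
    obtain ⟨T, hT, hb⟩ := hbody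
    obtain ⟨T', hT', hl⟩ := hυ
    refine ⟨υ, ⟨T + T' + 1, ?_, .loop_pos (by omega) hb hl⟩, hJb⟩
    ring_nf at hT hT' ⊢
    omega

/-- The contents of the arrays. -/
abbrev Mem := ℕ → ℕ → ℕ

/-- Expressions. Variables are numbered from the outermost binder inwards. -/
inductive Exp where
  | const (c : ℕ)
  | var (i : ℕ)
  | size
  | add (e f : Exp)
  | sub (e f : Exp)
  | read (a : ℕ) (e : Exp)
  | ite (c e f : Exp)
  | sum (k c : ℕ) (e : Exp)
  | call (k : ℕ) (args : Fin k → Exp) (f : Exp)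

/-- The value of an expression, in an instance of size `n`. -/
def Exp.eval (n : ℕ) (M : Mem) : Exp → List ℕ → ℕ
  | .const c, _ => c
  | .var i, env => env.getD i 0
  | .size, _ => n
  | .add e f, env => e.eval n M env + f.eval n M env
  | .sub e f, env => e.eval n M env - f.eval n M env
  | .read a e, env => M a (e.eval n M env)
  | .ite c e f, env => if c.eval n M env ≠ 0 then e.eval n M env else f.eval n M env
  | .sum k c e, env => ∑ i ∈ Finset.range (k * n + c), e.eval n M (env ++ [i])
  | .call _ args f, env => f.eval n M (List.ofFn fun i => (args i).eval n M env)

/-- Run `P 0`, …, `P (k - 1)` one after the other. -/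
def seqFin : (k : ℕ) → (Fin k → Prog) → Prog
  | 0, _ => .skip
  | k + 1, P => .seq (seqFin k fun i => P i.castSucc) (P (Fin.last k))

/-- `x := y`. -/
def move (x y z : ℕ) : Prog := .seq (.const z 0) (.add x y z)

/-- `x := k * n + c`. -/
def bound (x c : ℕ) : ℕ → Prog
  | 0 => .const x c
  | k + 1 => .seq (bound x c k) (.add x x 0)

/-- The value of the expression, with the variables in the registers `ρ`, ends up in register `q`;
the registers below `q` are untouched. -/
def Exp.compile : Exp → List ℕ → ℕ → Prog
  | .const c, _, q => .const q c
  | .var i, ρ, q => if h : i < ρ.length then move q ρ[i] (q + 1) else .const q 0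
  | .size, _, q => move q 0 (q + 1)
  | .add e f, ρ, q => .seq (e.compile ρ q) (.seq (f.compile ρ (q + 1)) (.add q q (q + 1)))
  | .sub e f, ρ, q => .seq (e.compile ρ q) (.seq (f.compile ρ (q + 1)) (.sub q q (q + 1)))
  | .read a e, ρ, q => .seq (e.compile ρ q) (.load q a q)
  | .ite c e f, ρ, q => .seq (c.compile ρ q) (.branch q (e.compile ρ q) (f.compile ρ q))
  | .sum k c e, ρ, q =>
    .seq (.const q 0) <| .seq (.const (q + 1) 0) <| .seq (bound (q + 2) c k) <|
    .seq (.const (q + 3) 1) <| countLoop (q + 1) (q + 2) (q + 3)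
      (.seq (e.compile (ρ ++ [q + 1]) (q + 4)) (.add q q (q + 4)))
  | .call k args f, ρ, q =>
    .seq (seqFin k fun i => (args i).compile ρ (q + i)) <|
    .seq (f.compile (List.ofFn fun i : Fin k => q + i) (q + k)) (move q (q + k) (q + k + 1))

open Polynomial in
/-- A bound for the running time. -/
noncomputable def Exp.cost : Exp → ℕ[X]
  | .const _ => 1
  | .var _ => 2
  | .size => 2
  | .add e f => e.cost + (f.cost + 1)
  | .sub e f => e.cost + (f.cost + 1)
  | .read _ e => e.cost + 1
  | .ite c e f => c.cost + (e.cost + f.cost + 1)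
  | .sum k c e => 1 + (1 + ((C k + 1) + (1 + ((C k * X + C c) * (e.cost + 1 + 3) + 1))))
  | .call _ args f => (1 + ∑ i, (args i).cost) + (f.cost + 2)

/-! ### Correctness and cost of compiled expressions -/

theorem runsIn_move (σ : State) {x y z : ℕ} (hzy : z ≠ y) :
    ∃ τ, RunsIn (move x y z) σ τ 2 ∧ τ.arr = σ.arr ∧ (∀ r, r ≠ x → r ≠ z → τ.reg r = σ.reg r) ∧
      τ.reg x = σ.reg y := by
  refine ⟨_, (runsIn_const σ z 0).seq (runsIn_add _ x y z), rfl, ?_, ?_⟩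
  · intro r hx hz
    simp [hx, hz]
  · simp [hzy.symm]

theorem runsIn_bound (σ : State) {x c : ℕ} (hx : x ≠ 0) (k : ℕ) :
    ∃ τ, RunsIn (bound x c k) σ τ (k + 1) ∧ τ.arr = σ.arr ∧ (∀ r, r ≠ x → τ.reg r = σ.reg r) ∧
      τ.reg x = k * σ.reg 0 + c := by
  induction k with
  | zero => exact ⟨_, runsIn_const σ x c, rfl, fun r hr => by simp [hr], by simp⟩
  | succ k ih =>
    obtain ⟨τ, h, ha, hr, hv⟩ := ih
    refine ⟨_, h.seq (runsIn_add τ x x 0), by simpa using ha, fun r hrx => ?_, ?_⟩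
    · simp [hrx, hr r hrx]
    · simp [hv, hr 0 hx.symm]
      ring

/-- Registers are used as a stack: those below `q`, including the variables `ρ` and the size in
register `0`, survive, and those from `q` on are scratch. Hence the variables keep their values
while later subexpressions are evaluated. -/
theorem Exp.runsIn_compile (e : Exp) : ∀ (ρ : List ℕ) (q : ℕ) (σ : State), 0 < q →
    (∀ r ∈ ρ, r < q) → ∃ τ, RunsIn (e.compile ρ q) σ τ (e.cost.eval (σ.reg 0)) ∧ τ.arr = σ.arr ∧
      (∀ r < q, τ.reg r = σ.reg r) ∧ τ.reg q = e.eval (σ.reg 0) σ.arr (ρ.map σ.reg) := by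
  induction e with
  | const c =>
    intro ρ q σ hq hρ
    exact ⟨σ.setReg q c, by simpa [cost, compile] using runsIn_const σ q c, rfl,
      fun r hr => by simp [hr.ne], by simp [eval]⟩
  | var i =>
    intro ρ q σ hq hρ
    by_cases h : i < ρ.length
    · have hi : ρ[i] < q := hρ _ (List.getElem_mem h)
      obtain ⟨τ, h1, h2, h3, h4⟩ :=
        runsIn_move σ (x := q) (y := ρ[i]) (z := q + 1) (by omega)
      refine ⟨τ, ?_, h2, fun r hr => h3 r (by omega) (by omega), ?_⟩
      · simpa [cost, compile, h] using h1
      · simp [h4, eval, h]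
    · refine ⟨σ.setReg q 0, ?_, rfl, ?_, ?_⟩
      · simpa [compile, h] using (runsIn_const σ q 0).mono (b := (cost (.var i)).eval (σ.reg 0))
          (by simp [cost])
      · intro r hr
        simp [hr.ne]
      · simp [eval, not_lt.1 h]
  | size =>
    intro ρ q σ hq hρ
    obtain ⟨τ, h1, h2, h3, h4⟩ := runsIn_move σ (x := q) (y := 0) (z := q + 1) (by omega)
    exact ⟨τ, by simpa [cost, compile] using h1, h2, fun r hr => h3 r (by omega) (by omega),
      by simp [h4, eval]⟩
  | add e f he hf =>
    intro ρ q σ hq hρ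
    obtain ⟨τ, h1, h2, h3, h4⟩ := he ρ q σ hq hρ
    obtain ⟨υ, g1, g2, g3, g4⟩ := hf ρ (q + 1) τ (by omega) fun r hr => (hρ r hr).trans (by omega)
    refine ⟨υ.setReg q (υ.reg q + υ.reg (q + 1)), ?_, ?_, ?_, ?_⟩
    · simp only [compile, cost, Polynomial.eval_add, Polynomial.eval_one]
      rw [h3 0 hq] at g1
      exact h1.seq (g1.seq (runsIn_add υ q q (q + 1)))
    · simp [g2, h2]
    · intro r hr
      simp [hr.ne, g3 r (by omega), h3 r hr]
    · have : ρ.map τ.reg = ρ.map σ.reg := List.map_congr_left fun r hr => h3 r (hρ r hr)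
      simp [g4, g3 q (by omega), h4, eval, h3 0 hq, h2, this]
  | sub e f he hf =>
    intro ρ q σ hq hρ
    obtain ⟨τ, h1, h2, h3, h4⟩ := he ρ q σ hq hρ
    obtain ⟨υ, g1, g2, g3, g4⟩ := hf ρ (q + 1) τ (by omega) fun r hr => (hρ r hr).trans (by omega)
    refine ⟨υ.setReg q (υ.reg q - υ.reg (q + 1)), ?_, ?_, ?_, ?_⟩
    · simp only [compile, cost, Polynomial.eval_add, Polynomial.eval_one]
      rw [h3 0 hq] at g1
      exact h1.seq (g1.seq (runsIn_sub υ q q (q + 1)))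
    · simp [g2, h2]
    · intro r hr
      simp [hr.ne, g3 r (by omega), h3 r hr]
    · have : ρ.map τ.reg = ρ.map σ.reg := List.map_congr_left fun r hr => h3 r (hρ r hr)
      simp [g4, g3 q (by omega), h4, eval, h3 0 hq, h2, this]
  | read a e he =>
    intro ρ q σ hq hρ
    obtain ⟨τ, h1, h2, h3, h4⟩ := he ρ q σ hq hρ
    refine ⟨τ.setReg q (τ.arr a (τ.reg q)), ?_, ?_, ?_, ?_⟩
    · simp only [compile, cost, Polynomial.eval_add, Polynomial.eval_one]
      exact h1.seq (runsIn_load τ q a q)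
    · simp [h2]
    · intro r hr
      simp [hr.ne, h3 r hr]
    · simp [h4, eval, h2]
  | ite c e f hc he hf =>
    intro ρ q σ hq hρ
    obtain ⟨τ, h1, h2, h3, h4⟩ := hc ρ q σ hq hρ
    have hm : ρ.map τ.reg = ρ.map σ.reg := List.map_congr_left fun r hr => h3 r (hρ r hr)
    by_cases h0 : c.eval (σ.reg 0) σ.arr (ρ.map σ.reg) = 0
    · obtain ⟨υ, g1, g2, g3, g4⟩ := hf ρ q τ hq hρ
      refine ⟨υ, ?_, g2.trans h2, fun r hr => (g3 r hr).trans (h3 r hr), ?_⟩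
      · simp only [compile, cost, Polynomial.eval_add, Polynomial.eval_one]
        rw [h3 0 hq] at g1
        exact (h1.seq (g1.branch_zero _ (by rw [h4, h0]))).mono (by omega)
      · simp [g4, eval, h0, h3 0 hq, h2, hm]
    · obtain ⟨υ, g1, g2, g3, g4⟩ := he ρ q τ hq hρ
      refine ⟨υ, ?_, g2.trans h2, fun r hr => (g3 r hr).trans (h3 r hr), ?_⟩
      · simp only [compile, cost, Polynomial.eval_add, Polynomial.eval_one]
        rw [h3 0 hq] at g1
        exact (h1.seq (g1.branch_pos _ (by rw [h4]; exact h0))).mono (by omega)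
      · simp [g4, eval, h0, h3 0 hq, h2, hm]
  | sum k c e he =>
    intro ρ q σ hq hρ
    obtain ⟨τ, h1, h2, h3, h4⟩ := runsIn_bound ((σ.setReg q 0).setReg (q + 1) 0)
      (x := q + 2) (c := c) (by omega) k
    have hτ0 : τ.reg 0 = σ.reg 0 := by
      rw [h3 0 (by omega)]
      simp [hq.ne]
    set n := σ.reg 0 with hn
    -- The partial sum is kept in register `q` and the loop registers are the next three; the
    -- summand is computed from `q + 4` on.
    let J : ℕ → State → Prop := fun i υ => υ.arr = σ.arr ∧ (∀ r < q, υ.reg r = σ.reg r) ∧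
      υ.reg q = ∑ j ∈ Finset.range i, e.eval n σ.arr (ρ.map σ.reg ++ [j])
    obtain ⟨υ, g1, g2, g3, g4⟩ := runsIn_countLoop (x := q + 1) (m := q + 2) (o := q + 3)
      (P := .seq (e.compile (ρ ++ [q + 1]) (q + 4)) (.add q q (q + 4)))
      (B := e.cost.eval n + 1) (b := k * n + c) (σ := τ.setReg (q + 3) 1)
      (by omega) (by omega) (by omega) J
      (by
        rintro i υ hi ⟨ha, hr, hs⟩ hx
        obtain ⟨φ, f1, f2, f3, f4⟩ := he (ρ ++ [q + 1]) (q + 4) υ (by omega) (by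
          intro r hr
          rcases List.mem_append.1 hr with h | h
          · exact (hρ r h).trans (by omega)
          · simp at h
            omega)
        have hm : ρ.map υ.reg = ρ.map σ.reg := List.map_congr_left fun r h => hr r (hρ r h)
        rw [hr 0 hq] at f1
        refine ⟨_, f1.seq (runsIn_add φ q q (q + 4)), ?_, ?_, ?_, fun c d => ⟨?_, ?_, ?_⟩⟩
        · simp [f3 (q + 1) (by omega), hx]
        · simp [f3 (q + 2) (by omega)]
        · simp [f3 (q + 3) (by omega)]
        · simp [f2, ha]
        · intro r hrq
          simp [hrq.ne, (show r ≠ q + 1 by omega), (show r ≠ q + 2 by omega),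
            f3 r (by omega), hr r hrq]
        · simp [f3 q (by omega), f4, hs, Finset.sum_range_succ, hm, hx, ha, hr 0 hq, hn])
      ⟨by simp [h2], fun r hr => by
        simp [h3 r (by omega), (show r ≠ q + 3 by omega), (show r ≠ q by omega),
          (show r ≠ q + 1 by omega)], by simp [h3 q (by omega)]⟩
      (by simp [h3 (q + 1) (by omega)]) (by simp [h4, hq.ne, hn]) (by simp)
    refine ⟨υ, ?_, g2, g3, by rw [g4]; rfl⟩
    have := (runsIn_const σ q 0).seq ((runsIn_const _ (q + 1) 0).seq
      (h1.seq ((runsIn_const τ (q + 3) 1).seq g1)))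
    simpa [compile, cost] using this
  | call k args f ha hf =>
    intro ρ q σ hq hρ
    -- The arguments are evaluated one by one into `q, q + 1, …`, all in the caller's variables;
    -- each evaluation leaves the earlier results alone.
    have hargs : ∀ (j : ℕ) (hj : j ≤ k), ∃ τ,
        RunsIn (seqFin j fun i => (args (i.castLE hj)).compile ρ (q + i)) σ τ
          (1 + ∑ i : Fin j, ((args (i.castLE hj)).cost).eval (σ.reg 0)) ∧ τ.arr = σ.arr ∧
        (∀ r < q, τ.reg r = σ.reg r) ∧
        ∀ i : Fin j, τ.reg (q + i) =
          (args (i.castLE hj)).eval (σ.reg 0) σ.arr (ρ.map σ.reg) := by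
      intro j
      induction j with
      | zero => exact fun hj => ⟨σ, runsIn_skip σ, rfl, fun r _ => rfl, fun i => i.elim0⟩
      | succ j ih =>
        intro hj
        obtain ⟨τ, h1, h2, h3, h4⟩ := ih (by omega)
        obtain ⟨υ, g1, g2, g3, g4⟩ := ha ((Fin.last j).castLE hj) ρ (q + j) τ (by omega)
          fun r hr => (hρ r hr).trans_le (by omega)
        rw [h3 0 hq] at g1
        have hm : ρ.map τ.reg = ρ.map σ.reg := List.map_congr_left fun r h => h3 r (hρ r h)
        refine ⟨υ, (h1.seq g1).mono ?_, g2.trans h2, fun r hr => ?_, fun i => ?_⟩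
        · rw [Fin.sum_univ_castSucc]
          exact (add_assoc _ _ _).le
        · rw [g3 r (by omega), h3 r hr]
        · induction i using Fin.lastCases with
          | last => simpa [h3 0 hq, h2, hm] using g4
          | cast i =>
            have := h4 i
            rw [Fin.val_castSucc, g3 _ (by omega), this]
            rfl
    obtain ⟨τ, h1, h2, h3, h4⟩ := hargs k le_rfl
    obtain ⟨υ, g1, g2, g3, g4⟩ := hf (List.ofFn fun i : Fin k => q + i) (q + k) τ (by omega) (by
      intro r hr
      obtain ⟨i, rfl⟩ := (List.mem_ofFn' _ _).1 hr
      exact Nat.add_lt_add_left i.2 q)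
    obtain ⟨φ, f1, f2, f3, f4⟩ := runsIn_move υ (x := q) (y := q + k) (z := q + k + 1)
      (by omega)
    rw [h3 0 hq] at g1 g4
    refine ⟨φ, ?_, f2.trans (g2.trans h2), fun r hr => ?_, ?_⟩
    · have := h1.seq (g1.seq f1)
      simpa [compile, cost, Polynomial.eval_finsetSum] using this
    · rw [f3 r (by omega) (by omega), g3 r (by omega), h3 r hr]
    · rw [f4, g4, h2, List.map_ofFn, eval]
      congr 2
      funext i
      exact h4 i

/-- Commands. The number of rounds of a loop is `k * n + c`. -/
inductive Cmd where
  | skip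
  | store (a : ℕ) (e f : Exp)
  | seq (C D : Cmd)
  | ite (e : Exp) (C D : Cmd)
  | loop (k c : ℕ) (C : Cmd)

/-- The effect of a command on the arrays. -/
def Cmd.exec (n : ℕ) : Cmd → Mem → List ℕ → Mem
  | .skip, M, _ => M
  | .store a e f, M, env =>
    Function.update M a (Function.update (M a) (e.eval n M env) (f.eval n M env))
  | .seq C D, M, env => D.exec n (C.exec n M env) env
  | .ite e C D, M, env => if e.eval n M env ≠ 0 then C.exec n M env else D.exec n M env
  | .loop k c C, M, env => (List.range (k * n + c)).foldl (fun M i => C.exec n M (env ++ [i])) M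

/-- The program of a command, with the variables in the registers `ρ`; the registers below `q` are
untouched. -/
def Cmd.compile : Cmd → List ℕ → ℕ → Prog
  | .skip, _, _ => .skip
  | .store a e f, ρ, q => .seq (e.compile ρ q) (.seq (f.compile ρ (q + 1)) (.store a q (q + 1)))
  | .seq C D, ρ, q => .seq (C.compile ρ q) (D.compile ρ q)
  | .ite e C D, ρ, q => .seq (e.compile ρ q) (.branch q (C.compile ρ q) (D.compile ρ q))
  | .loop k c C, ρ, q =>
    .seq (.const q 0) <| .seq (bound (q + 1) c k) <| .seq (.const (q + 2) 1) <|
    countLoop q (q + 1) (q + 2) (C.compile (ρ ++ [q]) (q + 3))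

open Polynomial in
/-- A bound for the running time. -/
noncomputable def Cmd.cost : Cmd → ℕ[X]
  | .skip => 1
  | .store _ e f => e.cost + (f.cost + 1)
  | .seq C D => C.cost + D.cost
  | .ite e C D => e.cost + (C.cost + D.cost + 1)
  | .loop k c C => 1 + ((Polynomial.C k + 1) +
      (1 + ((Polynomial.C k * X + Polynomial.C c) * (C.cost + 3) + 1)))

/-- The number of rounds of a loop is computed from the size before the loop starts, and the size
register is never changed, so costs multiply as polynomials in the size. -/
theorem Cmd.runsIn_compile (C : Cmd) : ∀ (ρ : List ℕ) (q : ℕ) (σ : State), 0 < q →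
    (∀ r ∈ ρ, r < q) → ∃ τ, RunsIn (C.compile ρ q) σ τ (C.cost.eval (σ.reg 0)) ∧
      τ.arr = C.exec (σ.reg 0) σ.arr (ρ.map σ.reg) ∧ ∀ r < q, τ.reg r = σ.reg r := by
  induction C with
  | skip =>
    intro ρ q σ hq hρ
    exact ⟨σ, by simpa [compile, cost] using runsIn_skip σ, rfl, fun _ _ => rfl⟩
  | store a e f =>
    intro ρ q σ hq hρ
    obtain ⟨τ, h1, h2, h3, h4⟩ := e.runsIn_compile ρ q σ hq hρ
    obtain ⟨υ, g1, g2, g3, g4⟩ := f.runsIn_compile ρ (q + 1) τ (by omega)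
      fun r hr => (hρ r hr).trans (by omega)
    have hm : ρ.map τ.reg = ρ.map σ.reg := List.map_congr_left fun r hr => h3 r (hρ r hr)
    refine ⟨υ.setArr a (υ.reg q) (υ.reg (q + 1)), ?_, ?_, ?_⟩
    · simp only [compile, cost, Polynomial.eval_add, Polynomial.eval_one]
      rw [h3 0 hq] at g1
      exact h1.seq (g1.seq (runsIn_store υ a q (q + 1)))
    · simp [State.setArr, exec, g2, h2, g4, g3 q (by omega), h4, hm, h3 0 hq]
    · intro r hr
      simp [g3 r (by omega), h3 r hr]
  | seq C D hC hD =>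
    intro ρ q σ hq hρ
    obtain ⟨τ, h1, h2, h3⟩ := hC ρ q σ hq hρ
    obtain ⟨υ, g1, g2, g3⟩ := hD ρ q τ hq hρ
    have hm : ρ.map τ.reg = ρ.map σ.reg := List.map_congr_left fun r hr => h3 r (hρ r hr)
    rw [h3 0 hq] at g1 g2
    refine ⟨υ, ?_, ?_, fun r hr => (g3 r hr).trans (h3 r hr)⟩
    · simpa [compile, cost] using h1.seq g1
    · rw [g2, h2, hm, exec]
  | ite e C D hC hD =>
    intro ρ q σ hq hρ
    obtain ⟨τ, h1, h2, h3, h4⟩ := e.runsIn_compile ρ q σ hq hρ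
    have hm : ρ.map τ.reg = ρ.map σ.reg := List.map_congr_left fun r hr => h3 r (hρ r hr)
    by_cases h0 : e.eval (σ.reg 0) σ.arr (ρ.map σ.reg) = 0
    · obtain ⟨υ, g1, g2, g3⟩ := hD ρ q τ hq hρ
      refine ⟨υ, ?_, ?_, fun r hr => (g3 r hr).trans (h3 r hr)⟩
      · simp only [compile, cost, Polynomial.eval_add, Polynomial.eval_one]
        rw [h3 0 hq] at g1
        exact (h1.seq (g1.branch_zero _ (by rw [h4, h0]))).mono (by omega)
      · simp [g2, exec, h0, h3 0 hq, h2, hm]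
    · obtain ⟨υ, g1, g2, g3⟩ := hC ρ q τ hq hρ
      refine ⟨υ, ?_, ?_, fun r hr => (g3 r hr).trans (h3 r hr)⟩
      · simp only [compile, cost, Polynomial.eval_add, Polynomial.eval_one]
        rw [h3 0 hq] at g1
        exact (h1.seq (g1.branch_pos _ (by rw [h4]; exact h0))).mono (by omega)
      · simp [g2, exec, h0, h3 0 hq, h2, hm]
  | loop k c C hC =>
    intro ρ q σ hq hρ
    obtain ⟨τ, h1, h2, h3, h4⟩ := runsIn_bound (σ.setReg q 0) (x := q + 1) (c := c) (by omega) k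
    set n := σ.reg 0 with hn
    let J : ℕ → State → Prop := fun i υ => (∀ r < q, υ.reg r = σ.reg r) ∧
      υ.arr = (List.range i).foldl (fun M i => C.exec n M (ρ.map σ.reg ++ [i])) σ.arr
    obtain ⟨υ, g1, g2, g3⟩ := runsIn_countLoop (x := q) (m := q + 1) (o := q + 2)
      (P := C.compile (ρ ++ [q]) (q + 3))
      (B := C.cost.eval n) (b := k * n + c) (σ := τ.setReg (q + 2) 1)
      (by omega) (by omega) (by omega) J
      (by
        rintro i υ hi ⟨hr, ha⟩ hx
        obtain ⟨φ, f1, f2, f3⟩ := hC (ρ ++ [q]) (q + 3) υ (by omega) (by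
          intro r hr
          rcases List.mem_append.1 hr with h | h
          · exact (hρ r h).trans (by omega)
          · simp at h
            omega)
        have hm : ρ.map υ.reg = ρ.map σ.reg := List.map_congr_left fun r h => hr r (hρ r h)
        rw [hr 0 hq] at f1
        refine ⟨φ, f1, ?_, ?_, ?_, fun c d => ⟨?_, ?_⟩⟩
        · rw [f3 q (by omega), hx]
        · rw [f3 (q + 1) (by omega)]
        · rw [f3 (q + 2) (by omega)]
        · intro r hrq
          simp [hrq.ne, (show r ≠ q + 1 by omega), f3 r (by omega), hr r hrq]
        · simp [List.range_succ, f2, ha, hm, hx, hr 0 hq, hn])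
      ⟨fun r hr => by
        simp [h3 r (by omega), (show r ≠ q + 2 by omega), (show r ≠ q by omega)],
        by simp [h2]⟩
      (by simp [h3 q (by omega)]) (by simp [h4, hq.ne, hn]) (by simp)
    refine ⟨υ, ?_, by rw [g3, exec], g2⟩
    have := (runsIn_const σ q 0).seq (h1.seq ((runsIn_const τ (q + 2) 1).seq g1))
    simpa [compile, cost] using this

/-- A command as a program that runs in polynomial time. -/
theorem Cmd.exists_runs (C : Cmd) : ∃ (P : Prog) (p : Polynomial ℕ), ∀ σ : State,
    ∃ τ T, Runs P σ τ T ∧ T ≤ p.eval (σ.reg 0) ∧ τ.arr = C.exec (σ.reg 0) σ.arr [] := by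
  refine ⟨C.compile [] 1, C.cost, fun σ => ?_⟩
  obtain ⟨τ, ⟨T, hT, h⟩, ha, -⟩ := C.runsIn_compile [] 1 σ one_pos (by simp)
  exact ⟨τ, T, h, hT, ha⟩

end RAM

/-! ### Ranks in linear orders -/

section Rank

variable {ι L : Type*} [LinearOrder L]

/-- The number of elements of `s` before `v`. -/
def rankIn (s : Finset ι) (f : ι → L) (v : ι) : ℕ := (s.filter fun u => f u < f v).card

theorem rankIn_le_rankIn {s : Finset ι} {f : ι → L} {u v : ι} (h : f u ≤ f v) :
    rankIn s f u ≤ rankIn s f v :=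
  Finset.card_le_card fun w hw => by
    simp only [Finset.mem_filter] at hw ⊢
    exact ⟨hw.1, hw.2.trans_le h⟩

theorem rankIn_lt_rankIn {s : Finset ι} {f : ι → L} {u v : ι} (hu : u ∈ s) (h : f u < f v) :
    rankIn s f u < rankIn s f v := by
  refine Finset.card_lt_card ((Finset.ssubset_iff_of_subset fun w hw => ?_).2 ⟨u, ?_, ?_⟩)
  · simp only [Finset.mem_filter] at hw ⊢
    exact ⟨hw.1, hw.2.trans h⟩
  · simp [hu, h]
  · simp

theorem rankIn_lt_card {s : Finset ι} {f : ι → L} {v : ι} (hv : v ∈ s) :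
    rankIn s f v < s.card := by
  refine Finset.card_lt_card (Finset.ssubset_iff_of_subset (Finset.filter_subset _ _) |>.2
    ⟨v, hv, ?_⟩)
  simp

theorem lt_of_rankIn_lt {s : Finset ι} {f : ι → L} {u v : ι}
    (h : rankIn s f u < rankIn s f v) : f u < f v := by
  by_contra h'
  exact absurd (rankIn_le_rankIn (s := s) (not_lt.1 h')) (not_le.2 h)

theorem rankIn_injOn {s : Finset ι} {f : ι → L} (hf : Set.InjOn f s) :
    Set.InjOn (rankIn s f) s := by
  intro u hu v hv h
  rcases lt_trichotomy (f u) (f v) with h' | h' | h'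
  · exact absurd h (rankIn_lt_rankIn hu h').ne
  · exact hf hu hv h'
  · exact absurd h (rankIn_lt_rankIn hv h').ne'

/-- Ranks are distinct and smaller than the size of `s`, so by counting they take every such value.
-/
theorem exists_rankIn_eq {s : Finset ι} {f : ι → L} (hf : Set.InjOn f s) {i : ℕ}
    (hi : i < s.card) : ∃ v ∈ s, rankIn s f v = i := by
  have h : s.image (rankIn s f) = Finset.range s.card := by
    refine Finset.eq_of_subset_of_card_le (fun j hj => ?_) ?_
    · obtain ⟨v, hv, rfl⟩ := Finset.mem_image.1 hj
      exact Finset.mem_range.2 (rankIn_lt_card hv)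
    · rw [Finset.card_image_of_injOn (rankIn_injOn hf), Finset.card_range]
  have : i ∈ s.image (rankIn s f) := by simpa [h] using hi
  simpa using this

end Rank

/-! ### Dominators in rooted trees -/

section Dominator

variable {α : Type*} {T : SimpleGraph α} {r : α}

/-- Every walk from the root `r` to `x` passes through `a`. -/
def Dom (T : SimpleGraph α) (r a x : α) : Prop := ∀ p : T.Walk r x, a ∈ p.support

theorem Dom.refl (a : α) : Dom T r a a := fun p => p.end_mem_support

theorem dom_root (x : α) : Dom T r r x := fun p => p.start_mem_support

theorem Dom.trans {a x y : α} (h : Dom T r a x) (h' : Dom T r x y) : Dom T r a y := by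
  classical
  exact fun p => p.support_takeUntil_subset_support (h' p) (h (p.takeUntil x (h' p)))

/-- A walk that misses `a` can be prolonged by an edge to any vertex other than `a`. Most facts
about domination propagate in this form along walks. -/
theorem not_dom_of_adj {a x y : α} (h : ¬ Dom T r a x) (hxy : T.Adj x y) (hy : a ≠ y) :
    ¬ Dom T r a y := by
  simp only [Dom, not_forall] at h ⊢
  obtain ⟨p, hp⟩ := h
  refine ⟨p.concat hxy, ?_⟩
  simp [SimpleGraph.Walk.support_concat, hp, hy]

/-- `T` without the edges at `a`. -/
def avoid (T : SimpleGraph α) (a : α) : SimpleGraph α where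
  Adj x y := T.Adj x y ∧ x ≠ a ∧ y ≠ a
  symm := ⟨fun _ _ h => ⟨h.1.symm, h.2.2, h.2.1⟩⟩
  loopless := ⟨fun _ h => h.1.ne rfl⟩

/-- This reduces domination to reachability, which the algorithm can tabulate. The alternative `a =
x` is needed only for `a = x = r`, because reachability is reflexive. -/
theorem dom_iff_avoid {a x : α} : Dom T r a x ↔ a = x ∨ ¬ (avoid T a).Reachable r x := by
  constructor
  · rintro h
    by_contra! hc
    obtain ⟨hax, ⟨p⟩⟩ := hc
    have hle : avoid T a ≤ T := fun _ _ h => h.1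
    have := h (p.mapLe hle)
    rw [SimpleGraph.Walk.support_mapLe_eq_support] at this
    clear h
    induction p with
    | nil => simp at this; exact hax this
    | cons h p ih =>
      rcases List.mem_cons.1 this with h' | h'
      · exact h.2.1 h'.symm
      · exact ih hax h'
  · rintro (rfl | h) p
    · exact p.end_mem_support
    · by_contra hp
      refine h ?_
      clear h
      induction p with
      | nil => rfl
      | cons h p ih =>
        simp only [SimpleGraph.Walk.support_cons, List.mem_cons, not_or] at hp
        refine SimpleGraph.Reachable.trans (SimpleGraph.Adj.reachable ?_) (ih hp.2)
        exact ⟨h, Ne.symm hp.1, fun h' => hp.2 (h' ▸ p.start_mem_support)⟩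

theorem Dom.dist_lt (hT : T.Connected) {a x : α} (h : Dom T r a x) (hne : a ≠ x) :
    T.dist r a < T.dist r x := by
  classical
  obtain ⟨p, hp⟩ := hT.exists_walk_length_eq_dist r x
  rw [← hp]
  exact (SimpleGraph.dist_le _).trans_lt (p.length_takeUntil_lt_length (h p) hne)

theorem Dom.antisymm (hT : T.Connected) {a x : α} (h : Dom T r a x) (h' : Dom T r x a) :
    a = x := by
  by_contra hne
  exact (h.dist_lt hT hne).asymm (h'.dist_lt hT (Ne.symm hne))

/-- If neither of `a`, `b` dominated the other, then no vertex on a walk from `r` would be dominated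
by both: the property passes along edges, and when the walk steps on one of the two, the other does
not dominate it. -/
theorem Dom.total (hT : T.Connected) {a b x : α} (ha : Dom T r a x) (hb : Dom T r b x) :
    Dom T r a b ∨ Dom T r b a := by
  by_contra! hc
  obtain ⟨hab, hba⟩ := hc
  have key : ∀ y, T.Reachable r y → ¬ Dom T r a y ∨ ¬ Dom T r b y := by
    rintro y ⟨p⟩
    induction p using SimpleGraph.Walk.concatRec with
    | Hnil =>
      rename_i r
      by_cases h : a = r
      · exact Or.inr (h ▸ hba)
      · left
        intro h'
        simpa [h] using h' .nil
    | Hconcat p h ih =>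
      rename_i r y z
      rcases ih ha hb hab hba with h' | h'
      · by_cases hz : a = z
        · exact Or.inr (hz ▸ hba)
        · exact Or.inl (not_dom_of_adj h' h hz)
      · by_cases hz : b = z
        · exact Or.inl (hz ▸ hab)
        · exact Or.inr (not_dom_of_adj h' h hz)
  rcases key x (hT.preconnected r x) with h | h
  · exact h ha
  · exact h hb

/-- Otherwise a walk from `r` to `y` missing `x` and one from `r` to `x` missing `y` would together
join `x` to `y` without the edge `xy`, which is a bridge. -/
theorem dom_or_dom_of_adj (hT : T.IsAcyclic) {x y : α} (h : T.Adj x y) :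
    Dom T r x y ∨ Dom T r y x := by
  by_contra! hc
  simp only [Dom, not_forall] at hc
  obtain ⟨⟨p, hp⟩, q, hq⟩ := hc
  have hb := SimpleGraph.isAcyclic_iff_forall_adj_isBridge.1 hT h
  have := SimpleGraph.isBridge_iff_forall_walk_mem_edges.1 hb (q.reverse.append p)
  rw [SimpleGraph.Walk.edges_append, List.mem_append, SimpleGraph.Walk.edges_reverse,
    List.mem_reverse] at this
  rcases this with h' | h'
  · exact hq (q.snd_mem_support_of_mem_edges h')
  · exact hp (p.fst_mem_support_of_mem_edges h')

theorem preconnected_induction {S : Set α} (hS : (T.induce S).Preconnected) {P : α → Prop}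
    {a : α} (ha : a ∈ S) (hP : P a) (step : ∀ x ∈ S, ∀ y ∈ S, T.Adj x y → P x → P y) :
    ∀ x ∈ S, P x := by
  intro x hx
  obtain ⟨p⟩ := hS ⟨a, ha⟩ ⟨x, hx⟩
  suffices ∀ (u v : S), (T.induce S).Walk u v → P u → P v from this _ _ p hP
  intro u v p
  induction p with
  | nil => exact id
  | cons h p ih => exact fun hu => ih (step _ (Subtype.coe_prop _) _ (Subtype.coe_prop _) h hu)

/-- If `b` were missing from `S`, a walk inside `S` from `a`, which `b` does not dominate, to `x`
would never meet `b`, so `b` would not dominate `x`. -/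
theorem mem_of_dom_of_dom (hT : T.Connected) {S : Set α} (hS : (T.induce S).Preconnected)
    {a b x : α} (ha : a ∈ S) (hx : x ∈ S) (hab : Dom T r a b) (hbx : Dom T r b x) : b ∈ S := by
  by_contra hb
  have hba : ¬ Dom T r b a := fun h => hb (h.antisymm hT hab ▸ ha)
  refine preconnected_induction (P := fun y => ¬ Dom T r b y) hS ha hba
    (fun y _ z hz hyz h => ?_) x hx hbx
  exact not_dom_of_adj h hyz fun h' => hb (h' ▸ hz)

open Classical in
/-- The number of vertices that `a` dominates. -/
noncomputable def domSize [Fintype α] (T : SimpleGraph α) (r a : α) : ℕ :=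
  (Finset.univ.filter fun x => Dom T r a x).card

/-- `a` dominates itself only. -/
def IsBottom (T : SimpleGraph α) (r a : α) : Prop := ∀ x, Dom T r a x → x = a

theorem Dom.domSize_lt [Fintype α] (hT : T.Connected) {a x : α} (h : Dom T r a x) (hne : a ≠ x) :
    domSize T r x < domSize T r a := by
  classical
  refine Finset.card_lt_card ((Finset.ssubset_iff_of_subset fun y hy => ?_).2 ⟨a, ?_, ?_⟩)
  · simp only [Finset.mem_filter, Finset.mem_univ, true_and] at hy ⊢
    exact h.trans hy
  · simp [Dom.refl]
  · simpa using fun h' => hne (h.antisymm hT h')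

theorem exists_isBottom [Fintype α] (hT : T.Connected) (a : α) :
    ∃ x, IsBottom T r x ∧ Dom T r a x := by
  classical
  obtain ⟨x, hx, hmin⟩ := Finset.exists_min_image (Finset.univ.filter fun x => Dom T r a x)
    (domSize T r) ⟨a, by simp [Dom.refl]⟩
  simp only [Finset.mem_filter, Finset.mem_univ, true_and] at hx hmin
  refine ⟨x, fun y hy => ?_, hx⟩
  by_contra hne
  exact absurd (hmin y (hx.trans hy)) (not_le.2 (hy.domSize_lt hT (Ne.symm hne)))

/-- All neighbours of a bottom vertex dominate it, so two of them are comparable. The lower one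
cannot dominate `x`, since `x` is also reached through the upper one. Thus bottom vertices have
degree at most 1. -/
theorem IsBottom.eq_of_adj (hT : T.IsTree) {x y z : α} (hx : IsBottom T r x) (hy : T.Adj x y)
    (hz : T.Adj x z) : y = z := by
  have hy' : Dom T r y x :=
    (dom_or_dom_of_adj hT.isAcyclic hy).resolve_left fun h => hy.ne (hx y h).symm
  have hz' : Dom T r z x :=
    (dom_or_dom_of_adj hT.isAcyclic hz).resolve_left fun h => hz.ne (hx z h).symm
  have key : ∀ {u v}, T.Adj x u → T.Adj x v → Dom T r v x → Dom T r u v → u = v := by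
    intro u v hu hv hvx huv
    by_contra hne
    exact not_dom_of_adj (fun h => hne (huv.antisymm hT.connected h)) hu.symm hv.ne' hvx
  rcases hy'.total hT.connected hz' with h | h
  · exact key hy hz hz' h
  · exact (key hz hy hy' h).symm

open Classical in
theorem card_isBottom_le [Fintype α] (hT : T.IsTree) (hr : T.degree r ≤ 1) :
    (Finset.univ.filter (IsBottom T r)).card ≤ 1 + ∑ a, (T.degree a - 2) := by
  have hsub : Finset.univ.filter (IsBottom T r) ⊆ Finset.univ.filter fun a => T.degree a ≤ 1 := by
    intro x hx
    simp only [Finset.mem_filter, Finset.mem_univ, true_and] at hx ⊢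
    rw [← T.card_neighborFinset_eq_degree, Finset.card_le_one]
    intro y hy z hz
    exact hx.eq_of_adj hT (by simpa using hy) (by simpa using hz)
  have hleaf : (Finset.univ.filter fun a => T.degree a ≤ 1).card ≤ 2 + ∑ a, (T.degree a - 2) := by
    have h1 := T.sum_degrees_eq_twice_card_edges
    have h2 := hT.card_edgeFinset
    -- The inequality holds at each vertex; since the degrees sum to `2 (|A| - 1)`, it leaves at
    -- most two vertices of degree at most 1 beyond the excess.
    have h3 : ∑ a, (T.degree a + if T.degree a ≤ 1 then 1 else 0)
        ≤ ∑ a, (2 + (T.degree a - 2)) := Finset.sum_le_sum fun a _ => by split_ifs <;> omega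
    rw [Finset.sum_add_distrib, Finset.sum_add_distrib, Finset.sum_const, smul_eq_mul,
      Finset.card_univ, ← Finset.card_filter] at h3
    omega
  -- The root is itself a vertex of degree at most 1 that is not a bottom vertex, which saves one,
  -- unless it is the only vertex.
  by_cases h : IsBottom T r r
  · have : Finset.univ.filter (IsBottom T r) ⊆ {r} := fun x _ => by
      simpa using h x (dom_root x)
    exact (Finset.card_le_card this).trans (by simp)
  · have : (Finset.univ.filter (IsBottom T r)).card
        < (Finset.univ.filter fun a => T.degree a ≤ 1).card :=
      Finset.card_lt_card (Finset.ssubset_iff_of_subset hsub |>.2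
        ⟨r, by simpa using hr, by simpa using h⟩)
    omega

end Dominator

/-! ### The ordering and the classes defined by a rooted tree -/

section Ordering

open scoped Classical

variable {V : Type*} [Fintype V] [LinearOrder V] (G : SimpleGraph V) (A : Set V)
  (T : SimpleGraph A) (r : A)

/-- Bottom-up order. -/
noncomputable def height (a : A) : ℕ ×ₗ A := toLex (domSize T r a, a)

/-- The vertices of `A` in question for the position of `v`. -/
def anchors (v : V) : Set A := {a | v = a ∨ v ∉ A ∧ G.Adj v a}

/-- Vertices of `A` come in bottom-up order; each further vertex comes after its last neighbour. -/
noncomputable def orderKey (v : V) : ℕ :=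
  2 * (Finset.univ.filter fun a : A => ∃ b ∈ anchors G A v, height A T r a ≤ height A T r b).card +
    if v ∈ A then 0 else 1

/-- The position in the ordering. -/
noncomputable def position (v : V) : ℕ :=
  rankIn Finset.univ (fun u => toLex (orderKey G A T r u, u)) v

/-- The class of a vertex of `A` is given by the first leaf below it. -/
noncomputable def classOf (v : V) : ℕ :=
  if h : v ∈ A then 1 + (Finset.univ.filter fun l => IsBottom T r l ∧
    ∀ l', IsBottom T r l' → Dom T r ⟨v, h⟩ l' → l < l').card else 0

variable {G A T r}

theorem position_injective : Function.Injective (position G A T r) := by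
  intro u v h
  refine rankIn_injOn (f := fun u => toLex (orderKey G A T r u, u)) ?_
    (Finset.mem_coe.2 (Finset.mem_univ u)) (Finset.mem_coe.2 (Finset.mem_univ v)) h
  intro a _ b _ h
  exact (Prod.mk.inj h).2

theorem position_lt (v : V) : position G A T r v < Fintype.card V :=
  rankIn_lt_card (Finset.mem_univ v)

theorem orderKey_le_of_position_lt {u v : V} (h : position G A T r u < position G A T r v) :
    orderKey G A T r u ≤ orderKey G A T r v := by
  have := lt_of_rankIn_lt h
  rw [Prod.Lex.toLex_lt_toLex] at this
  rcases this with h | h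
  · exact h.le
  · exact h.1.le

/-- The count ranges over the leaves strictly before the first leaf below `v`, so it misses that
leaf; this makes up for the shift by 1 that keeps class `0` for the vertices outside `A`. -/
theorem classOf_le (hT : T.Connected) (v : V) :
    classOf A T r v ≤ (Finset.univ.filter (IsBottom T r)).card := by
  unfold classOf
  split_ifs with h
  · obtain ⟨l, hl, hvl⟩ := exists_isBottom hT (r := r) ⟨v, h⟩
    rw [add_comm, Nat.add_one_le_iff]
    refine Finset.card_lt_card ((Finset.ssubset_iff_of_subset fun x hx => ?_).2 ⟨l, ?_, ?_⟩)
    · simp only [Finset.mem_filter, Finset.mem_univ, true_and] at hx ⊢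
      exact hx.1
    · simpa using hl
    · exact fun hm => lt_irrefl _ ((Finset.mem_filter.1 hm).2.2 l hl hvl)
  · exact Nat.zero_le _

/-- The class number is one plus the rank of the first leaf below, so equal classes share that leaf
and both vertices are its ancestors. -/
theorem exists_dom_of_classOf_eq (hT : T.Connected) {u v : V} (hu : u ∈ A) (hv : v ∈ A)
    (h : classOf A T r u = classOf A T r v) : ∃ l, Dom T r ⟨u, hu⟩ l ∧ Dom T r ⟨v, hv⟩ l := by
  have hmin : ∀ a : A, ∃ l, IsBottom T r l ∧ Dom T r a l ∧
      ∀ l', IsBottom T r l' → Dom T r a l' → l ≤ l' := by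
    intro a
    obtain ⟨l, hl, hal⟩ := exists_isBottom hT (r := r) a
    obtain ⟨m, hm, hm'⟩ := Finset.exists_min_image
      (Finset.univ.filter fun l => IsBottom T r l ∧ Dom T r a l) id ⟨l, by simp [hl, hal]⟩
    simp only [Finset.mem_filter, Finset.mem_univ, true_and, id] at hm hm'
    exact ⟨m, hm.1, hm.2, fun l' h h' => hm' l' ⟨h, h'⟩⟩
  obtain ⟨l, hl, hul, hlmin⟩ := hmin ⟨u, hu⟩
  obtain ⟨m, hm, hvm, hmmin⟩ := hmin ⟨v, hv⟩
  have hcard : ∀ (w : V) (hw : w ∈ A) (l : A), IsBottom T r l → Dom T r ⟨w, hw⟩ l →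
      (∀ l', IsBottom T r l' → Dom T r ⟨w, hw⟩ l' → l ≤ l') →
      classOf A T r w = 1 + rankIn (Finset.univ.filter (IsBottom T r)) id l := by
    intro w hw l hl hwl hmin
    rw [classOf, dif_pos hw, rankIn, Finset.filter_filter]
    congr 2
    ext x
    simp only [Finset.mem_filter, Finset.mem_univ, true_and, id]
    exact and_congr_right fun _ => ⟨fun h => h l hl hwl,
      fun h l' h1 h2 => h.trans_le (hmin l' h1 h2)⟩
  rw [hcard u hu l hl hul hlmin, hcard v hv m hm hvm hmmin] at h
  have : l = m := rankIn_injOn (Function.injective_id.injOn) (by simpa using hl) (by simpa using hm)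
    (by omega : rankIn (Finset.univ.filter (IsBottom T r)) id l = _)
  exact ⟨l, hul, this ▸ hvm⟩

theorem Dom.of_height_le (hT : T.Connected) {a b x : A} (ha : Dom T r a x) (hb : Dom T r b x)
    (h : height A T r a ≤ height A T r b) : Dom T r b a := by
  rcases ha.total hT hb with h' | h'
  · by_cases hne : a = b
    · exact hne ▸ Dom.refl a
    · have := h'.domSize_lt hT hne
      rw [height, height, Prod.Lex.toLex_le_toLex] at h
      simp only at h
      omega
  · exact h'

/-- Spread domination by `a` along an edge `xy` of `S`. If `y` is above `x`, then `a` and `y` are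
both ancestors of `x`, hence comparable, and by maximality `a` is the upper one. -/
theorem dom_of_forall_height_le (hT : T.IsTree) {S : Set A} (hS : (T.induce S).Preconnected)
    {a : A} (ha : a ∈ S) (hmax : ∀ x ∈ S, height A T r x ≤ height A T r a) :
    ∀ x ∈ S, Dom T r a x := by
  refine preconnected_induction hS ha (Dom.refl a) fun x _ y hy hxy hax => ?_
  rcases dom_or_dom_of_adj (r := r) hT.isAcyclic hxy with h | h
  · exact hax.trans h
  · exact h.of_height_le hT.connected hax (hmax y hy)

/-- For `q` in `A`, the order of positions turns three ancestors of a common leaf or neighbour into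
a chain `m` above `p` above `q`, where `m` is the last neighbour of `s`; connectedness of the
neighbourhood of `s` then forces `p` into it. -/
theorem adj_of_position_lt {B : Set V} (hG : G.IsBipartiteWith A B) (hcover : A ∪ B = Set.univ)
    (hT : T.IsTree) (hsupp : ∀ b ∈ B, (T.induce {a : A | G.Adj b a}).Preconnected)
    {q p s : V} (hqp : position G A T r q < position G A T r p)
    (hps : position G A T r p < position G A T r s)
    (hc : classOf A T r q = classOf A T r p) (hqs : G.Adj q s) : G.Adj p s := by
  have hmono : ∀ a b : A, (Finset.univ.filter fun c : A => height A T r c ≤ height A T r a).card ≤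
      (Finset.univ.filter fun c : A => height A T r c ≤ height A T r b).card →
      height A T r a ≤ height A T r b := by
    intro a b h
    by_contra! hlt
    refine absurd h (not_le.2 (Finset.card_lt_card
      ((Finset.ssubset_iff_of_subset fun x hx => ?_).2 ⟨a, ?_, ?_⟩)))
    · simp only [Finset.mem_filter, Finset.mem_univ, true_and] at hx ⊢
      exact hx.trans hlt.le
    · simp
    · simpa using hlt
  have hkeyA : ∀ v (hv : v ∈ A), orderKey G A T r v =
      2 * (Finset.univ.filter fun c : A => height A T r c ≤ height A T r ⟨v, hv⟩).card := by
    intro v hv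
    have : anchors G A v = {⟨v, hv⟩} := by
      ext a
      simp [anchors, hv, Subtype.ext_iff, eq_comm]
    simp [orderKey, this, hv]
  have hkeyB : ∀ v, v ∉ A → ∀ a : A, G.Adj v a →
      (∀ b : A, G.Adj v b → height A T r b ≤ height A T r a) → orderKey G A T r v =
      2 * (Finset.univ.filter fun c : A => height A T r c ≤ height A T r a).card + 1 := by
    intro v hv a ha hmax
    have : ∀ c : A, (∃ b ∈ anchors G A v, height A T r c ≤ height A T r b) ↔
        height A T r c ≤ height A T r a := by
      intro c
      constructor
      · rintro ⟨b, hb | hb, h⟩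
        · exact absurd (hb ▸ b.2) hv
        · exact h.trans (hmax b hb.2)
      · exact fun h => ⟨a, Or.inr ⟨hv, ha⟩, h⟩
    simp [orderKey, this, hv]
  have hmax : ∀ v, ∀ a : A, G.Adj v a → ∃ a : A, G.Adj v a ∧
      ∀ b : A, G.Adj v b → height A T r b ≤ height A T r a := by
    intro v a ha
    obtain ⟨m, hm, hm'⟩ := Finset.exists_max_image (Finset.univ.filter fun a : A => G.Adj v a)
      (height A T r) ⟨a, by simpa using ha⟩
    simp only [Finset.mem_filter, Finset.mem_univ, true_and] at hm hm'
    exact ⟨m, hm, hm'⟩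
  have hdisj : ∀ v ∈ B, v ∉ A := fun v hv h => Set.disjoint_left.1 hG.disjoint h hv
  by_cases hq : q ∈ A
  · have hs : s ∈ B := hG.mem_of_mem_adj hq hqs
    have hp : p ∈ A := by
      by_contra hp
      simp [classOf, hq, hp] at hc
    obtain ⟨l, hql, hpl⟩ := exists_dom_of_classOf_eq hT.connected hq hp hc
    have h1 := orderKey_le_of_position_lt hqp
    have h2 := orderKey_le_of_position_lt hps
    obtain ⟨m, hm, hm'⟩ := hmax s ⟨q, hq⟩ hqs.symm
    rw [hkeyA q hq, hkeyA p hp] at h1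
    rw [hkeyA p hp, hkeyB s (hdisj s hs) m hm hm'] at h2
    have h1' := hmono ⟨q, hq⟩ ⟨p, hp⟩ (by omega)
    have h2' := hmono ⟨p, hp⟩ m (by omega)
    have hmq : Dom T r m ⟨q, hq⟩ :=
      dom_of_forall_height_le hT (hsupp s hs) hm hm' _ hqs.symm
    have hpq : Dom T r ⟨p, hp⟩ ⟨q, hq⟩ := hql.of_height_le hT.connected hpl h1'
    have hmp : Dom T r m ⟨p, hp⟩ := hpq.of_height_le hT.connected hmq h2'
    have : (⟨p, hp⟩ : A) ∈ {a : A | G.Adj s a} :=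
      mem_of_dom_of_dom hT.connected (hsupp s hs) hm hqs.symm hmp hpq
    exact SimpleGraph.Adj.symm this
  -- Here `s` is a neighbour of `q`, so the odd key of `q` exceeds the even key of `s`, and `q`
  -- cannot precede `s`.
  · have hqB : q ∈ B := by
      have : q ∈ A ∪ B := hcover ▸ Set.mem_univ q
      exact this.resolve_left hq
    have hs : s ∈ A := hG.symm.mem_of_mem_adj hqB hqs
    have h := (orderKey_le_of_position_lt hqp).trans (orderKey_le_of_position_lt hps)
    obtain ⟨m, hm, hm'⟩ := hmax q ⟨s, hs⟩ hqs
    rw [hkeyB q hq m hm hm', hkeyA s hs] at h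
    have : (Finset.univ.filter fun c : A => height A T r c ≤ height A T r ⟨s, hs⟩).card ≤
        (Finset.univ.filter fun c : A => height A T r c ≤ height A T r m).card :=
      Finset.card_le_card fun c hc => by
        simp only [Finset.mem_filter, Finset.mem_univ, true_and] at hc ⊢
        exact hc.trans (hm' _ hqs)
    omega

/-- The ordering and the classes are consistent. -/
theorem exists_isConsistent {B : Set V} (hG : G.IsBipartiteWith A B) (hcover : A ∪ B = Set.univ)
    (hT : T.IsTree) (hsupp : ∀ b ∈ B, (T.induce {a : A | G.Adj b a}).Preconnected)
    {n k : ℕ} (hn : Fintype.card V = n) (hk : ∀ v, classOf A T r v < k) :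
    ∃ (v : Fin n ≃ V) (c : V → Fin k), IsConsistent G v c ∧
      (∀ x, ((v.symm x : Fin n) : ℕ) = position G A T r x) ∧
      ∀ x, (c x : ℕ) = classOf A T r x := by
  let f : V → Fin n := fun x => ⟨position G A T r x, hn ▸ position_lt x⟩
  have hf : Function.Bijective f := by
    refine (Fintype.bijective_iff_injective_and_card f).2 ⟨fun x y h => ?_, by simpa using hn⟩
    exact position_injective (Fin.mk.inj_iff.1 h)
  refine ⟨(Equiv.ofBijective f hf).symm, fun x => ⟨classOf A T r x, hk x⟩, ?_, fun x => rfl,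
    fun x => rfl⟩
  have hpos : ∀ i, position G A T r ((Equiv.ofBijective f hf).symm i) = i := fun i =>
    congrArg Fin.val ((Equiv.ofBijective f hf).apply_symm_apply i)
  intro q p s hqp hps hc hqs
  refine adj_of_position_lt hG hcover hT hsupp ?_ ?_ (congrArg Fin.val hc) hqs
  · rw [hpos, hpos]
    exact hqp
  · rw [hpos, hpos]
    exact hps

end Ordering

/-! ### Separators, classes and tokens

Let `N a` be the set of hyperedges through `a`. In a tree in which all hyperedges are connected, the
edges `pq` with `N p ∩ N q = S` join the classes of `{a | S ⊆ N a}`, whatever the tree. A token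
stands for an end of such an edge. -/

section Separators

open scoped Classical

variable {α β : Type*}

/-- The path between two vertices of a tree is unique, so it stays inside every hyperedge that
contains both. -/
theorem induce_iInter_preconnected {T : SimpleGraph α} (hT : T.IsTree) (N : α → Set β)
    (h : ∀ b, (T.induce {a | b ∈ N a}).Preconnected) (S : Set β) :
    (T.induce {a | S ⊆ N a}).Preconnected := by
  rintro ⟨a, ha⟩ ⟨b, hb⟩
  obtain ⟨p, hp⟩ := (hT.connected.preconnected a b).exists_isPath
  have hsub : ∀ x ∈ p.support, x ∈ {a | S ⊆ N a} := by
    intro x hx s hs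
    obtain ⟨w⟩ := h s ⟨a, ha hs⟩ ⟨b, hb hs⟩
    have hw : ∀ x ∈ (w.map (SimpleGraph.Embedding.induce _).toHom).support, s ∈ N x := by
      intro x hx
      rw [SimpleGraph.Walk.support_map, List.mem_map] at hx
      obtain ⟨y, -, rfl⟩ := hx
      exact y.2
    set w' : T.Walk a b := w.map (SimpleGraph.Embedding.induce _).toHom
    have : p = w'.bypass := congrArg Subtype.val
      ((hT.isAcyclic.subsingleton_path a b).elim ⟨p, hp⟩ ⟨w'.bypass, w'.bypass_isPath⟩)
    rw [this] at hx
    exact hw x (w'.support_bypass_subset_support hx)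
  exact ⟨p.induce _ hsub⟩

variable (N : α → Set β)

/-- Vertices with more than `S` in common are adjacent. -/
def clsGraph (S : Set β) : SimpleGraph α where
  Adj a b := a ≠ b ∧ S ⊂ N a ∩ N b
  symm := ⟨fun a b h => ⟨h.1.symm, by rw [Set.inter_comm]; exact h.2⟩⟩
  loopless := ⟨fun _ h => h.1 rfl⟩

/-- `a` and `b` are in the same class of `S`. -/
def Same (S : Set β) (a b : α) : Prop := (clsGraph N S).Reachable a b

variable {N}

theorem Same.refl {S : Set β} (a : α) : Same N S a a := SimpleGraph.Reachable.refl a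

theorem Same.symm {S : Set β} {a b : α} (h : Same N S a b) : Same N S b a :=
  SimpleGraph.Reachable.symm h

theorem Same.trans {S : Set β} {a b c : α} (h : Same N S a b) (h' : Same N S b c) :
    Same N S a c := SimpleGraph.Reachable.trans h h'

theorem Same.subset {S : Set β} {a b : α} (h : Same N S a b) (ha : S ⊆ N a) : S ⊆ N b := by
  obtain ⟨p⟩ := h
  induction p with
  | nil => exact ha
  | cons h p ih => exact ih (h.2.subset.trans Set.inter_subset_right)

/-- Vertices sharing more than `S` would be adjacent in `clsGraph`. In particular every tree edge
between different classes of `S` has separator exactly `S`. -/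
theorem inter_eq_of_not_same {S : Set β} {a b : α} (h : ¬ Same N S a b) (ha : S ⊆ N a)
    (hb : S ⊆ N b) : N a ∩ N b = S := by
  by_contra hne
  refine h (SimpleGraph.Adj.reachable ⟨?_, (Set.subset_inter ha hb).ssubset_of_ne (Ne.symm hne)⟩)
  rintro rfl
  exact h (Same.refl a)

variable [LinearOrder α]

variable (N)

/-- The pair `x, y` is the first one to separate two classes of `N x ∩ N y`. -/
def Canon (x y : α) : Prop :=
  ¬ Same N (N x ∩ N y) x y ∧ ∀ x' y', toLex (x', y') < toLex (x, y) →
    ¬ Same N (N x' ∩ N y') x' y' → N x' ∩ N y' ≠ N x ∩ N y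

/-- `z` is the first member of a class of `S`. -/
def IsRep (S : Set β) (z : α) : Prop := S ⊆ N z ∧ ∀ w, Same N S z w → z ≤ w

/-- The tokens of `N x ∩ N y`: one for each class, and another one for each class but two. -/
def IsToken (x y z : α) (k : Bool) : Prop :=
  Canon N x y ∧ IsRep N (N x ∩ N y) z ∧
    (k = true → ¬ Same N (N x ∩ N y) x z ∧ ¬ Same N (N x ∩ N y) y z)

/-- The vertices a token can be placed on. -/
def Allowed (x y z : α) (k : Bool) (a : α) : Prop :=
  if k = true then N x ∩ N y ⊆ N a else Same N (N x ∩ N y) z a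

variable {N}

/-- A canonical pair therefore serves as a unique name of its separator. -/
theorem Canon.ext {x y x' y' : α} (h : Canon N x y) (h' : Canon N x' y')
    (he : N x ∩ N y = N x' ∩ N y') : x = x' ∧ y = y' := by
  rcases lt_trichotomy (toLex (x, y)) (toLex (x', y')) with hl | hl | hl
  · exact absurd he (h'.2 x y hl h.1)
  · exact Prod.mk.inj hl
  · exact absurd he.symm (h.2 x' y' hl h'.1)

variable [Fintype α]

variable (N)

/-- The first member of the class of `a`. -/
noncomputable def repOf (S : Set β) (a : α) : α :=
  (Finset.univ.filter (Same N S a)).min' ⟨a, by simp [Same.refl]⟩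

/-- The first members of the classes of `S`. -/
noncomputable def reps (S : Set β) : Finset α := Finset.univ.filter (IsRep N S)

/-- The tokens of the second kind. -/
noncomputable def frees (x y : α) : Finset α := Finset.univ.filter fun z => IsToken N x y z true

variable {N}

theorem same_repOf (S : Set β) (a : α) : Same N S a (repOf N S a) := by
  have := Finset.min'_mem (Finset.univ.filter (Same N S a)) ⟨a, by simp [Same.refl]⟩
  exact (Finset.mem_filter.1 this).2

theorem isRep_repOf {S : Set β} {a : α} (ha : S ⊆ N a) : IsRep N S (repOf N S a) :=
  ⟨(same_repOf S a).subset ha, fun w hw => Finset.min'_le _ _ (by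
    simpa using (same_repOf S a).trans hw)⟩

theorem repOf_eq {S : Set β} {z a : α} (hz : IsRep N S z) (h : Same N S z a) :
    repOf N S a = z :=
  le_antisymm (Finset.min'_le _ _ (by simpa using h.symm)) (hz.2 _ (h.trans (same_repOf S a)))

theorem repOf_mem {S : Set β} {a : α} (ha : S ⊆ N a) : repOf N S a ∈ reps N S := by
  simpa [reps] using isRep_repOf ha

theorem exists_canon {x y : α} (h : ¬ Same N (N x ∩ N y) x y) :
    ∃ x' y', Canon N x' y' ∧ N x' ∩ N y' = N x ∩ N y := by
  obtain ⟨⟨x', y'⟩, hm, hmin⟩ := Finset.exists_min_image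
    (Finset.univ.filter fun p : α × α => ¬ Same N (N p.1 ∩ N p.2) p.1 p.2 ∧
      N p.1 ∩ N p.2 = N x ∩ N y) toLex ⟨(x, y), by simp [h]⟩
  simp only [Finset.mem_filter, Finset.mem_univ, true_and] at hm hmin
  refine ⟨x', y', ⟨hm.1, fun a b hlt hab he => ?_⟩, hm.2⟩
  exact absurd (hmin (a, b) ⟨hab, he.trans hm.2⟩) (not_le.2 hlt)

/-- The vertices `x` and `y` lie in different classes, and exactly these two classes are left out.
The total number of tokens of a separator with `k` classes is thus `2 (k - 1)`, the number of edge
ends of a tree on the classes. -/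
theorem card_frees {x y : α} (h : Canon N x y) :
    (frees N x y).card + 2 = (reps N (N x ∩ N y)).card := by
  set S := N x ∩ N y with hS
  have hx : S ⊆ N x := Set.inter_subset_left
  have hy : S ⊆ N y := Set.inter_subset_right
  have hne : repOf N S x ≠ repOf N S y := fun he =>
    h.1 ((same_repOf S x).trans (he ▸ (same_repOf S y).symm))
  have : frees N x y = reps N S \ {repOf N S x, repOf N S y} := by
    ext z
    simp only [frees, reps, IsToken, Finset.mem_filter, Finset.mem_univ, true_and,
      Finset.mem_sdiff, Finset.mem_insert, Finset.mem_singleton, not_or, ← hS, h]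
    refine and_congr_right fun hz => ?_
    have aux : ∀ w, Same N S w z ↔ z = repOf N S w := fun w =>
      ⟨fun hw => (repOf_eq hz hw.symm).symm, fun hw => hw ▸ same_repOf S w⟩
    simp [aux]
  rw [this, Finset.card_sdiff_of_subset, Finset.card_pair hne]
  · have : ({repOf N S x, repOf N S y} : Finset α).card ≤ (reps N S).card :=
      Finset.card_le_card (by
        simp [Finset.insert_subset_iff, repOf_mem hx, repOf_mem hy])
    rw [Finset.card_pair hne] at this
    omega
  · simp [Finset.insert_subset_iff, repOf_mem hx, repOf_mem hy]

/-! ### Tokens and the edges of a tree -/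

/-- The darts of `T` with separator `S`. -/
noncomputable def sepDarts (N : α → Set β) (T : SimpleGraph α) (S : Set β) : Finset (α × α) :=
  Finset.univ.filter fun p => T.Adj p.1 p.2 ∧ N p.1 ∩ N p.2 = S

/-- The classes of `S`, two of them adjacent if they are joined by an edge with separator `S`. -/
def quotGraph (N : α → Set β) (T : SimpleGraph α) (S : Set β) : SimpleGraph (reps N S) where
  Adj z w := z ≠ w ∧ ∃ p ∈ sepDarts N T S, Same N S z p.1 ∧ Same N S w p.2
  symm := ⟨by
    rintro z w ⟨hne, p, hp, h1, h2⟩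
    refine ⟨hne.symm, p.swap, ?_, h2, h1⟩
    simp only [sepDarts, Finset.mem_filter, Finset.mem_univ, true_and] at hp ⊢
    exact ⟨hp.1.symm, by rw [← hp.2]; exact Set.inter_comm _ _⟩⟩
  loopless := ⟨fun _ h => h.1 rfl⟩

/-- Follow a walk in `{a | S ⊆ N a}`: a step either stays in a class or crosses along an edge with
separator exactly `S`. -/
theorem quotGraph_preconnected {T : SimpleGraph α} {S : Set β}
    (hT : (T.induce {a | S ⊆ N a}).Preconnected) : (quotGraph N T S).Preconnected := by
  rintro ⟨z, hz⟩ ⟨w, hw⟩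
  have hz' : IsRep N S z := by simpa [reps] using hz
  have hw' : IsRep N S w := by simpa [reps] using hw
  have key : ∀ a ∈ {a | S ⊆ N a}, ∀ h : repOf N S a ∈ reps N S,
      (quotGraph N T S).Reachable ⟨z, hz⟩ ⟨repOf N S a, h⟩ := by
    refine preconnected_induction hT (a := z) hz'.1 ?_ ?_
    · intro h
      have := repOf_eq hz' (Same.refl z)
      simp only [this]
      rfl
    · intro a ha b hb hab ih h
      refine (ih (repOf_mem ha)).trans ?_
      by_cases hs : Same N S a b
      · have : repOf N S a = repOf N S b :=
          (repOf_eq (isRep_repOf ha) ((same_repOf S a).symm.trans hs)).symm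
        simp only [this]
        rfl
      · refine SimpleGraph.Adj.reachable ⟨fun he => ?_, (a, b), ?_, (same_repOf S a).symm,
          (same_repOf S b).symm⟩
        · have he' : repOf N S a = repOf N S b := congrArg Subtype.val he
          exact hs ((same_repOf S a).trans (he' ▸ (same_repOf S b).symm))
        · simpa [sepDarts, hab] using inter_eq_of_not_same hs ha hb
  have hww := repOf_eq hw' (Same.refl w)
  have := key w hw'.1 (by rw [hww]; exact hw)
  simpa only [hww] using this

/-- A connected graph on the classes has at least one edge fewer than there are classes, and its
darts lift injectively to darts of `T`, since a dart of `T` determines the classes of its ends. -/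
theorem card_reps_le {T : SimpleGraph α} {S : Set β}
    (hT : (T.induce {a | S ⊆ N a}).Preconnected) :
    2 * (reps N S).card ≤ (sepDarts N T S).card + 2 := by
  by_cases hne : (reps N S).Nonempty
  · have : Nonempty (reps N S) := hne.coe_sort
    have hc : (quotGraph N T S).Connected := ⟨quotGraph_preconnected hT⟩
    have h1 := hc.card_vert_le_card_edgeSet_add_one
    rw [Nat.card_eq_fintype_card, Fintype.card_coe, Nat.card_eq_fintype_card,
      ← SimpleGraph.edgeFinset_card] at h1
    have h2 := (quotGraph N T S).dart_card_eq_twice_card_edges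
    have hex : ∀ d : (quotGraph N T S).Dart, ∃ p : α × α, p ∈ sepDarts N T S ∧
        Same N S d.fst p.1 ∧ Same N S d.snd p.2 := fun d => d.adj.2
    choose f hf using hex
    have hrep : ∀ z : reps N S, IsRep N S z := fun z => by simpa [reps] using z.2
    have h3 : Fintype.card (quotGraph N T S).Dart ≤ (sepDarts N T S).card := by
      rw [← Finset.card_univ]
      refine Finset.card_le_card_of_injOn f (fun d _ => (hf d).1) fun d _ e _ hde => ?_
      ext
      · rw [← repOf_eq (hrep d.fst) (hf d).2.1, ← repOf_eq (hrep e.fst) (hf e).2.1, hde]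
      · rw [← repOf_eq (hrep d.snd) (hf d).2.2, ← repOf_eq (hrep e.snd) (hf e).2.2, hde]
    omega
  · rw [Finset.not_nonempty_iff_eq_empty.1 hne]
    simp

theorem exists_sepDart {T : SimpleGraph α} {S : Set β}
    (hT : (T.induce {a | S ⊆ N a}).Preconnected) (h2 : 2 ≤ (reps N S).card) {z : α}
    (hz : z ∈ reps N S) : ∃ p ∈ sepDarts N T S, Same N S z p.1 := by
  have hnt : Nontrivial (reps N S) := Fintype.one_lt_card_iff_nontrivial.1 (by
    rw [Fintype.card_coe]
    omega)
  obtain ⟨w, hw⟩ := (quotGraph_preconnected hT).exists_adj_of_nontrivial ⟨z, hz⟩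
  obtain ⟨-, p, hp, h, -⟩ := hw
  exact ⟨p, hp, h⟩

/-- The token of a class takes a dart that starts in this class. Enough darts remain for the free
tokens, and these may start anywhere. -/
theorem exists_tokenDarts {T : SimpleGraph α} {x y : α} (hxy : Canon N x y)
    (hT : (T.induce {a | N x ∩ N y ⊆ N a}).Preconnected) :
    ∃ g : α × Bool → α × α, Set.InjOn g {u | IsToken N x y u.1 u.2} ∧
      ∀ u, IsToken N x y u.1 u.2 → g u ∈ sepDarts N T (N x ∩ N y) ∧
        Allowed N x y u.1 u.2 (g u).1 := by
  set S := N x ∩ N y with hS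
  have hcard := card_frees hxy
  rw [← hS] at hcard
  have hex : ∀ z : α, ∃ p : α × α, z ∈ reps N S → p ∈ sepDarts N T S ∧ Same N S z p.1 := by
    intro z
    by_cases hz : z ∈ reps N S
    · obtain ⟨p, hp, h⟩ := exists_sepDart hT (by omega) hz
      exact ⟨p, fun _ => ⟨hp, h⟩⟩
    · exact ⟨(x, y), fun h => absurd h hz⟩
  choose d hd using hex
  have hdinj : Set.InjOn d (reps N S) := by
    intro z hz w hw he
    have hz' : IsRep N S z := by simpa [reps] using hz
    have hw' : IsRep N S w := by simpa [reps] using hw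
    rw [← repOf_eq hz' (hd z hz).2, ← repOf_eq hw' (hd w hw).2, he]
  have himg : (reps N S).image d ⊆ sepDarts N T S := by
    intro p hp
    obtain ⟨z, hz, rfl⟩ := Finset.mem_image.1 hp
    exact (hd z hz).1
  -- With `k` classes there are at least `2k - 2` darts, `k` of which are taken, so `k - 2` are
  -- left.
  have hle : (frees N x y).card ≤ (sepDarts N T S \ (reps N S).image d).card := by
    rw [Finset.card_sdiff_of_subset himg, Finset.card_image_of_injOn hdinj]
    have := card_reps_le hT
    omega
  obtain ⟨e⟩ : Nonempty (frees N x y ↪ ↥(sepDarts N T S \ (reps N S).image d)) :=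
    Function.Embedding.nonempty_of_card_le (by rw [Fintype.card_coe, Fintype.card_coe]; exact hle)
  let g : α × Bool → α × α := fun u =>
    if u.2 = true then if h : u.1 ∈ frees N x y then e ⟨u.1, h⟩ else d u.1 else d u.1
  have hgfalse : ∀ z, g (z, false) = d z := fun z => by simp [g]
  have hgtrue : ∀ z (h : z ∈ frees N x y), g (z, true) = e ⟨z, h⟩ := fun z h => by simp [g, h]
  have hrep : ∀ {z k}, IsToken N x y z k → z ∈ reps N S := fun h => by simpa [reps] using h.2.1
  have hfree : ∀ {z}, IsToken N x y z true → z ∈ frees N x y := fun h => by simpa [frees] using h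
  have hnot : ∀ z (h : z ∈ frees N x y), ∀ w ∈ reps N S, (e ⟨z, h⟩ : α × α) ≠ d w := by
    intro z h w hw he
    exact (Finset.mem_sdiff.1 (e ⟨z, h⟩).2).2 (he ▸ Finset.mem_image_of_mem d hw)
  refine ⟨g, ?_, ?_⟩
  · rintro ⟨z, k⟩ hz ⟨w, l⟩ hw he
    cases k <;> cases l
    · rw [hgfalse, hgfalse] at he
      exact Prod.ext (hdinj (hrep hz) (hrep hw) he) rfl
    · rw [hgfalse, hgtrue w (hfree hw)] at he
      exact absurd he.symm (hnot w (hfree hw) z (hrep hz))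
    · rw [hgfalse, hgtrue z (hfree hz)] at he
      exact absurd he (hnot z (hfree hz) w (hrep hw))
    · rw [hgtrue z (hfree hz), hgtrue w (hfree hw)] at he
      have := e.injective (Subtype.ext he)
      exact Prod.ext (Subtype.mk.inj this) rfl
  · rintro ⟨z, k⟩ hz
    cases k
    · rw [hgfalse]
      exact ⟨(hd z (hrep hz)).1, by simpa [Allowed] using (hd z (hrep hz)).2⟩
    · rw [hgtrue z (hfree hz)]
      have hm := (Finset.mem_sdiff.1 (e ⟨z, hfree hz⟩).2).1
      refine ⟨hm, ?_⟩
      simp only [sepDarts, Finset.mem_filter, Finset.mem_univ, true_and] at hm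
      simp only [Allowed, if_true, ← hS, ← hm.2]
      exact Set.inter_subset_left

/-- All tokens. -/
noncomputable def tokens (N : α → Set β) : Finset (α × α × α × Bool) :=
  Finset.univ.filter fun u => IsToken N u.1 u.2.1 u.2.2.1 u.2.2.2

/-- Tokens of different separators cannot collide: a dart determines its separator, and the
separator its canonical pair. -/
theorem exists_darts {T : SimpleGraph α} (hT : ∀ S, (T.induce {a | S ⊆ N a}).Preconnected) :
    ∃ g : α × α × α × Bool → α × α, Set.InjOn g (tokens N) ∧ ∀ u ∈ tokens N,
      T.Adj (g u).1 (g u).2 ∧ Allowed N u.1 u.2.1 u.2.2.1 u.2.2.2 (g u).1 := by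
  have hex : ∀ x y : α, ∃ g : α × Bool → α × α, Canon N x y →
      Set.InjOn g {u | IsToken N x y u.1 u.2} ∧ ∀ u, IsToken N x y u.1 u.2 →
        g u ∈ sepDarts N T (N x ∩ N y) ∧ Allowed N x y u.1 u.2 (g u).1 := by
    intro x y
    by_cases h : Canon N x y
    · obtain ⟨g, hg⟩ := exists_tokenDarts h (hT _)
      exact ⟨g, fun _ => hg⟩
    · exact ⟨fun _ => (x, y), fun h' => absurd h' h⟩
  choose g hg using hex
  refine ⟨fun u => g u.1 u.2.1 u.2.2, ?_, ?_⟩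
  · rintro ⟨x, y, z⟩ hu ⟨x', y', z'⟩ hu' he
    simp only [tokens, Finset.coe_filter, Finset.mem_univ, true_and, Set.mem_ofPred_eq] at hu hu' he
    have h1 := ((hg x y hu.1).2 z hu).1
    have h2 := ((hg x' y' hu'.1).2 z' hu').1
    rw [← he] at h2
    simp only [sepDarts, Finset.mem_filter, Finset.mem_univ, true_and] at h1 h2
    obtain ⟨rfl, rfl⟩ := hu.1.ext hu'.1 (h1.2.symm.trans h2.2)
    rw [(hg x y hu.1).1 hu hu' he]
  · rintro ⟨x, y, z⟩ hu
    simp only [tokens, Finset.mem_filter, Finset.mem_univ, true_and] at hu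
    obtain ⟨h1, h2⟩ := (hg x y hu.1).2 z hu
    simp only [sepDarts, Finset.mem_filter, Finset.mem_univ, true_and] at h1
    exact ⟨h1.1, h2⟩

theorem card_tokens_le {T : SimpleGraph α} (hT : T.IsTree)
    (hS : ∀ S, (T.induce {a | S ⊆ N a}).Preconnected) :
    (tokens N).card + 2 ≤ 2 * Fintype.card α := by
  obtain ⟨g, hinj, hg⟩ := exists_darts hS
  have h1 : (tokens N).card ≤ (Finset.univ.filter fun p : α × α => T.Adj p.1 p.2).card :=
    Finset.card_le_card_of_injOn g (fun u hu => by simpa using (hg u hu).1) hinj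
  have h2 : (Finset.univ.filter fun p : α × α => T.Adj p.1 p.2).card ≤
      Fintype.card T.Dart := by
    rw [← Finset.card_univ]
    refine (Finset.card_le_card (t := Finset.univ.image fun d : T.Dart => d.toProd) ?_).trans
      Finset.card_image_le
    intro p hp
    simp only [Finset.mem_filter, Finset.mem_univ, true_and] at hp
    exact Finset.mem_image.2 ⟨⟨p, hp⟩, Finset.mem_univ _, rfl⟩
  have h3 := T.dart_card_eq_twice_card_edges
  have h4 := hT.card_edgeFinset
  omega

/-- Put each token at the start of its dart. Distinct tokens at `a` then use distinct neighbours of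
`a`. -/
theorem exists_placement {T : SimpleGraph α}
    (hT : ∀ S, (T.induce {a | S ⊆ N a}).Preconnected) :
    ∃ g : α × α × α × Bool → α,
      (∀ u ∈ tokens N, Allowed N u.1 u.2.1 u.2.2.1 u.2.2.2 (g u)) ∧
      ∀ a, ((tokens N).filter fun u => g u = a).card ≤ T.degree a := by
  obtain ⟨g, hinj, hg⟩ := exists_darts hT
  refine ⟨fun u => (g u).1, fun u hu => (hg u hu).2, fun a => ?_⟩
  rw [← T.card_neighborFinset_eq_degree]
  refine Finset.card_le_card_of_injOn (fun u => (g u).2) (fun u hu => ?_) fun u hu v hv he => ?_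
  · simp only [Finset.coe_filter, Set.mem_ofPred_eq] at hu
    simpa [← hu.2] using (hg u hu.1).1
  · simp only [Finset.coe_filter, Set.mem_ofPred_eq] at hu hv
    exact hinj hu.1 hv.1 (Prod.ext (hu.2.trans hv.2.symm) he)

/-! ### A tree from a placement of the tokens -/

variable (N) (pos : α → α → α → Bool → α)

/-- A token of the second kind is placed on the class of `z`. -/
def HasFree (x y z : α) : Prop :=
  ∃ w, IsToken N x y w true ∧ Same N (N x ∩ N y) z (pos x y w true)

/-- The classes in order, those with tokens of the second kind first. -/
noncomputable def classRank (x y z : α) : ℕ :=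
  rankIn (reps N (N x ∩ N y)) (fun z => toLex (if HasFree N pos x y z then 0 else 1, z)) z

/-- The tokens of the second kind, in the order of the classes they are placed on. -/
noncomputable def freeRank (x y z : α) : ℕ :=
  rankIn (frees N x y)
    (fun w => toLex (classRank N pos x y (repOf N (N x ∩ N y) (pos x y w true)), w)) z

/-- The number of the edge a token belongs to. -/
noncomputable def edgeNo (x y z : α) (k : Bool) : ℕ :=
  if k = true then freeRank N pos x y z + 2 else max 1 (classRank N pos x y z)

/-- The end of its edge a token belongs to. -/
def IsUpper (x y z : α) (k : Bool) : Prop := k = true ∨ classRank N pos x y z = 0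

/-- Join the vertices with the two tokens of an edge. -/
def joinGraph : SimpleGraph α where
  Adj p q := p ≠ q ∧ ∃ x y z k w l, IsToken N x y z k ∧ IsToken N x y w l ∧
    pos x y z k = p ∧ pos x y w l = q ∧ edgeNo N pos x y z k = edgeNo N pos x y w l ∧
    (IsUpper N pos x y z k ↔ ¬ IsUpper N pos x y w l)
  symm := ⟨by
    rintro p q ⟨hne, x, y, z, k, w, l, h1, h2, h3, h4, h5, h6⟩
    exact ⟨hne.symm, x, y, w, l, z, k, h2, h1, h4, h3, h5.symm, iff_not_comm.1 h6⟩⟩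
  loopless := ⟨fun _ h => h.1 rfl⟩

variable {N pos}

theorem classRank_injOn {x y z w : α} (hz : IsRep N (N x ∩ N y) z) (hw : IsRep N (N x ∩ N y) w)
    (h : classRank N pos x y z = classRank N pos x y w) : z = w := by
  refine rankIn_injOn (f := fun z => toLex ((if HasFree N pos x y z then 0 else 1 : ℕ), z))
    (fun a _ b _ h => (Prod.mk.inj h).2) ?_ ?_ h
  · simpa [reps] using hz
  · simpa [reps] using hw

theorem freeRank_injOn {x y z w : α} (hz : IsToken N x y z true) (hw : IsToken N x y w true)
    (h : freeRank N pos x y z = freeRank N pos x y w) : z = w := by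
  refine rankIn_injOn
    (f := fun w => toLex (classRank N pos x y (repOf N (N x ∩ N y) (pos x y w true)), w))
    (fun a _ b _ h => (Prod.mk.inj h).2) ?_ ?_ h
  · simpa [frees] using hz
  · simpa [frees] using hw

/-- Edge 1 joins the classes of rank 0 and 1 by their own tokens, and only rank 0 is upper. Edge `i
≥ 2` has the token of the class of rank `i` as lower end and the free token of rank `i - 2` as upper
end. So number and end determine the token. -/
theorem token_ext {x y z w : α} {k l : Bool} (hz : IsToken N x y z k) (hw : IsToken N x y w l)
    (he : edgeNo N pos x y z k = edgeNo N pos x y w l)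
    (hu : IsUpper N pos x y z k ↔ IsUpper N pos x y w l) : z = w ∧ k = l := by
  cases k <;> cases l <;> simp only [edgeNo, IsUpper, if_true, Bool.false_eq_true, if_false,
    false_or, true_or, true_iff, iff_true] at he hu
  · refine ⟨classRank_injOn hz.2.1 hw.2.1 (pos := pos) ?_, rfl⟩
    omega
  · omega
  · omega
  · exact ⟨freeRank_injOn hz hw (pos := pos) (by omega), rfl⟩

/-- The other token of the edge. -/
noncomputable def mate (N : α → Set β) (pos : α → α → α → Bool → α) (u : α × α × α × Bool) :
    α × α × α × Bool :=
  if h : ∃ v : α × Bool, IsToken N u.1 u.2.1 v.1 v.2 ∧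
      edgeNo N pos u.1 u.2.1 u.2.2.1 u.2.2.2 = edgeNo N pos u.1 u.2.1 v.1 v.2 ∧
      (IsUpper N pos u.1 u.2.1 u.2.2.1 u.2.2.2 ↔ ¬ IsUpper N pos u.1 u.2.1 v.1 v.2) then
    (u.1, u.2.1, h.choose) else u

theorem exists_token_of_adj {p q : α} (h : (joinGraph N pos).Adj p q) :
    ∃ u ∈ tokens N, pos u.1 u.2.1 u.2.2.1 u.2.2.2 = p ∧
      pos (mate N pos u).1 (mate N pos u).2.1 (mate N pos u).2.2.1 (mate N pos u).2.2.2 = q := by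
  obtain ⟨-, x, y, z, k, w, l, h1, h2, h3, h4, h5, h6⟩ := h
  refine ⟨(x, y, z, k), by simpa [tokens] using h1, h3, ?_⟩
  have hex : ∃ v : α × Bool, IsToken N x y v.1 v.2 ∧
      edgeNo N pos x y z k = edgeNo N pos x y v.1 v.2 ∧
      (IsUpper N pos x y z k ↔ ¬ IsUpper N pos x y v.1 v.2) := ⟨(w, l), h2, h5, h6⟩
  have hm : mate N pos (x, y, z, k) = (x, y, hex.choose) := dif_pos hex
  obtain ⟨g1, g2, g3⟩ := hex.choose_spec
  have := token_ext g1 h2 (g2.symm.trans h5) (not_iff_not.1 (g3.symm.trans h6))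
  rw [hm]
  simp only [this]
  exact h4

/-- Every neighbour of `a` carries the mate of a token on `a`. Edges may coincide, whence only an
inequality. -/
theorem degree_joinGraph_le (a : α) : (joinGraph N pos).degree a ≤
    ((tokens N).filter fun u => pos u.1 u.2.1 u.2.2.1 u.2.2.2 = a).card := by
  rw [← SimpleGraph.card_neighborFinset_eq_degree]
  refine (Finset.card_le_card (t := Finset.image (fun u => pos (mate N pos u).1
    (mate N pos u).2.1 (mate N pos u).2.2.1 (mate N pos u).2.2.2) _) ?_).trans Finset.card_image_le
  intro q hq
  obtain ⟨u, hu, h1, h2⟩ := exists_token_of_adj (by simpa using hq)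
  exact Finset.mem_image.2 ⟨u, Finset.mem_filter.2 ⟨hu, h1⟩, h2⟩

theorem card_edgeFinset_joinGraph_le :
    2 * (joinGraph N pos).edgeFinset.card ≤ (tokens N).card := by
  rw [← SimpleGraph.sum_degrees_eq_twice_card_edges]
  refine (Finset.sum_le_sum fun a _ => degree_joinGraph_le a).trans ?_
  rw [← Finset.card_eq_sum_card_fiberwise (t := Finset.univ)]
  exact fun _ _ => Finset.mem_coe.2 (Finset.mem_univ _)

/-- The class carrying the `i`-th free token has rank at most `i`. -/
theorem classRank_le_freeRank {x y w : α} (hw : IsToken N x y w true) :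
    classRank N pos x y (repOf N (N x ∩ N y) (pos x y w true)) ≤ freeRank N pos x y w := by
  set S := N x ∩ N y with hS
  set c := repOf N S (pos x y w true) with hc
  have hcfree : HasFree N pos x y c := ⟨w, hw, (same_repOf S _).symm⟩
  -- Classes carrying free tokens come first, so each class before `c` carries one too. Choosing one
  -- for each gives distinct free tokens, all before `w`.
  have hlt : ∀ z ∈ (reps N S).filter fun z =>
      toLex ((if HasFree N pos x y z then 0 else 1 : ℕ), z) <
        toLex ((if HasFree N pos x y c then 0 else 1 : ℕ), c),
      ∃ v, IsToken N x y v true ∧ repOf N S (pos x y v true) = z ∧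
        classRank N pos x y z < classRank N pos x y c := by
    intro z hz
    rw [Finset.mem_filter] at hz
    have hr : classRank N pos x y z < classRank N pos x y c :=
      rankIn_lt_rankIn (s := reps N (N x ∩ N y))
        (f := fun z => toLex ((if HasFree N pos x y z then 0 else 1 : ℕ), z)) hz.1 hz.2
    have hz2 := hz.2
    rw [Prod.Lex.toLex_lt_toLex] at hz2
    simp only [hcfree, if_true] at hz2
    have hf : HasFree N pos x y z := by
      by_contra hf
      simp [hf] at hz2
    obtain ⟨v, hv, hs⟩ := hf
    exact ⟨v, hv, repOf_eq (by simpa [reps] using hz.1) hs, hr⟩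
  choose! f hf using hlt
  refine Finset.card_le_card_of_injOn f (fun z hz => ?_) fun z hz z' hz' he => ?_
  · obtain ⟨h1, h2, h3⟩ := hf z hz
    refine Finset.mem_coe.2 (Finset.mem_filter.2 ⟨by simpa [frees] using h1, ?_⟩)
    rw [Prod.Lex.toLex_lt_toLex]
    left
    simpa only [← hS, h2] using h3
  · rw [← (hf z hz).2.1, ← (hf z' hz').2.1, he]

/-- Induction from large `S` to small. Within a class, consecutive vertices share a strictly larger
set and are joined by induction; the classes themselves are linked by the numbered edges, each of
which leads to a class of smaller rank. -/
theorem joinGraph_preconnected [Finite β]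
    (hpos : ∀ x y z k, IsToken N x y z k → Allowed N x y z k (pos x y z k)) (S : Set β) :
    ((joinGraph N pos).induce {a | S ⊆ N a}).Preconnected := by
  induction S using WellFoundedGT.induction with
  | ind S ih =>
    have hsame : ∀ {a b : α} (ha : S ⊆ N a) (hb : S ⊆ N b), Same N S a b →
        ((joinGraph N pos).induce {a | S ⊆ N a}).Reachable ⟨a, ha⟩ ⟨b, hb⟩ := by
      rintro a b ha hb ⟨p⟩
      induction p with
      | nil => rfl
      | @cons a b c h p ihp =>
        have hb' : S ⊆ N b := h.2.subset.trans Set.inter_subset_right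
        refine SimpleGraph.Reachable.trans ?_ (ihp hb' hb)
        have hsub : {c | N a ∩ N b ⊆ N c} ⊆ {c | S ⊆ N c} := fun c hc => h.2.subset.trans hc
        exact (ih (N a ∩ N b) h.2 ⟨a, Set.inter_subset_left⟩ ⟨b, Set.inter_subset_right⟩).map
          (SimpleGraph.induceHomOfLE _ hsub).toHom
    rintro ⟨a, ha⟩ ⟨b, hb⟩
    by_cases hab : Same N S a b
    · exact hsame ha hb hab
    have hS := inter_eq_of_not_same hab ha hb
    obtain ⟨x, y, hxy, hxyS⟩ := exists_canon (N := N) (x := a) (y := b) (by rwa [hS])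
    rw [hS] at hxyS
    subst hxyS
    set S := N x ∩ N y with hSxy
    set J := (joinGraph N pos).induce {a | S ⊆ N a} with hJ
    have hcard := card_frees hxy
    rw [← hSxy] at hcard
    have hinj : Set.InjOn (fun z => toLex ((if HasFree N pos x y z then 0 else 1 : ℕ), z))
        (reps N S) := fun a _ b _ h => (Prod.mk.inj h).2
    obtain ⟨o, ho, ho0⟩ := exists_rankIn_eq hinj (i := 0) (by omega)
    have ho0' : classRank N pos x y o = 0 := ho0
    have hmem : ∀ {z}, z ∈ reps N S → IsRep N S z := fun h => by simpa [reps] using h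
    have htok : ∀ {z}, z ∈ reps N S → IsToken N x y z false := fun h => ⟨hxy, hmem h, by simp⟩
    have hcls : ∀ {z}, z ∈ reps N S → Same N S z (pos x y z false) := fun h => by
      simpa [Allowed] using hpos x y _ false (htok h)
    have hfreepos : ∀ w, IsToken N x y w true → S ⊆ N (pos x y w true) := fun w h => by
      simpa [Allowed] using hpos x y w true h
    have hadj : ∀ {p q : α} (hp : S ⊆ N p) (hq : S ⊆ N q), (joinGraph N pos).Adj p q →
        J.Reachable ⟨p, hp⟩ ⟨q, hq⟩ := fun hp hq h =>
      SimpleGraph.Adj.reachable (by simpa [hJ] using h)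
    have key : ∀ i, ∀ z (hz : z ∈ reps N S), classRank N pos x y z = i →
        J.Reachable ⟨z, (hmem hz).1⟩ ⟨o, (hmem ho).1⟩ := by
      intro i
      induction i using Nat.strong_induction_on with
      | _ i ihi =>
        intro z hz hi
        have hzp := (hcls hz).subset (hmem hz).1
        rcases Nat.lt_or_ge i 2 with h2 | h2
        · by_cases hzo : z = o
          · subst hzo
            rfl
          · have hi1 : i = 1 := by
              by_contra hne
              exact hzo (classRank_injOn (hmem hz) (hmem ho) (pos := pos)
                (hi.trans ((by omega : i = 0).trans ho0.symm)))
            have hop := (hcls ho).subset (hmem ho).1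
            refine (hsame (hmem hz).1 hzp (hcls hz)).trans (SimpleGraph.Reachable.trans ?_
              (hsame (hmem ho).1 hop (hcls ho)).symm)
            refine hadj hzp hop ⟨fun he => hzo ?_, x, y, z, false, o, false, htok hz, htok ho, rfl,
              rfl, ?_, ?_⟩
            · rw [← repOf_eq (hmem hz) (hcls hz), he, repOf_eq (hmem ho) (hcls ho)]
            · simp [edgeNo, hi, hi1, ho0']
            · simp [IsUpper, hi, hi1, ho0']
        · have hilt : i < (reps N S).card := hi ▸ rankIn_lt_card hz
          -- The upper end of edge `i` is the free token of rank `i - 2`, which exists as there are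
          -- two fewer free tokens than classes. It lies on a class of rank at most `i - 2`, to
          -- which the induction applies.
          obtain ⟨w, hw, hwi⟩ := exists_rankIn_eq (s := frees N x y) (i := i - 2)
            (f := fun w => toLex (classRank N pos x y (repOf N (N x ∩ N y) (pos x y w true)), w))
            (fun a _ b _ h => (Prod.mk.inj h).2) (by omega)
          have hwt : IsToken N x y w true := by simpa [frees] using hw
          have hwp := hfreepos w hwt
          have hle := classRank_le_freeRank (pos := pos) hwt
          have hwi' : freeRank N pos x y w = i - 2 := hwi
          rw [hwi', ← hSxy] at hle
          refine (hsame (hmem hz).1 hzp (hcls hz)).trans (SimpleGraph.Reachable.trans ?_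
            ((hsame (hmem (repOf_mem hwp)).1 hwp (same_repOf S _).symm).symm.trans
              (ihi _ (by omega) _ (repOf_mem hwp) rfl)))
          refine hadj hzp hwp ⟨fun he => ?_, x, y, z, false, w, true, htok hz, hwt, rfl,
            rfl, ?_, ?_⟩
          · have := repOf_eq (hmem hz) (hcls hz)
            rw [he] at this
            rw [this] at hle
            omega
          · simp only [edgeNo, hi, hwi', if_true, Bool.false_eq_true, if_false]
            omega
          · simp only [IsUpper, hi]
            simp
            omega
    have hrep : ∀ {a} (ha : S ⊆ N a), J.Reachable ⟨a, ha⟩ ⟨o, (hmem ho).1⟩ := fun {a} ha =>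
      (hsame ha (hmem (repOf_mem ha)).1 (same_repOf S a)).trans (key _ _ (repOf_mem ha) rfl)
    exact (hrep ha).trans (hrep hb).symm

/-- Connectedness is the case `S = ∅`; every edge uses two tokens, so there are at most `|A| - 1`
edges. -/
theorem joinGraph_isTree [Finite β] [Nonempty α]
    (hpos : ∀ x y z k, IsToken N x y z k → Allowed N x y z k (pos x y z k))
    (hcard : (tokens N).card + 2 ≤ 2 * Fintype.card α) : (joinGraph N pos).IsTree := by
  have hc : (joinGraph N pos).Connected := by
    refine ⟨fun a b => ?_⟩
    have := joinGraph_preconnected hpos ∅ ⟨a, Set.empty_subset _⟩ ⟨b, Set.empty_subset _⟩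
    exact this.map (SimpleGraph.Embedding.induce _).toHom
  refine SimpleGraph.isTree_iff_connected_and_card.2 ⟨hc, ?_⟩
  have h1 := card_edgeFinset_joinGraph_le (N := N) (pos := pos)
  have h2 := hc.card_vert_le_card_edgeSet_add_one
  rw [Nat.card_eq_fintype_card, Nat.card_eq_fintype_card, ← SimpleGraph.edgeFinset_card] at h2 ⊢
  omega

end Separators

/-! ### Placing tokens by an auction

Every vertex offers several places. An unplaced token takes an allowed place of least price, which
evicts its previous owner and raises the price by one. -/

section Auction

open scoped Classical

variable {ι U α : Type*} (m : ℕ) (vert : ι → α) (tk : Finset U)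
  (ok : U → α → Prop)

/-- The invariant: the owner `o s` of a place is content with its price `d s`, up to one unit. -/
structure Auction (o : ι → Option U) (d : ι → ℕ) : Prop where
  mem : ∀ s u, o s = some u → u ∈ tk ∧ ok u (vert s)
  inj : ∀ s s' u, o s = some u → o s' = some u → s = s'
  price : ∀ s, d s ≠ 0 → o s ≠ none
  content : ∀ s u, o s = some u → ∀ s', ok u (vert s') → d s ≤ d s' + 1
  le : ∀ s, d s ≤ m + 1

/-- `u` may bid for `s`. -/
def Bid (o : ι → Option U) (d : ι → ℕ) (u : U) (s : ι) : Prop :=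
  u ∈ tk ∧ (∀ s', o s' ≠ some u) ∧ ok u (vert s) ∧ d s ≤ m ∧
    ∀ s', ok u (vert s') → d s ≤ d s'

variable {m : ℕ} {vert : ι → α} {tk : Finset U} {ok : U → α → Prop}

/-- The bidder takes a cheapest allowed place, so after the rise it overpays by at most one unit.
For the other owners a rise elsewhere only helps. -/
theorem Auction.update {o : ι → Option U} {d : ι → ℕ} (h : Auction m vert tk ok o d) {u : U} {s : ι}
    (hb : Bid m vert tk ok o d u s) :
    Auction m vert tk ok (Function.update o s (some u)) (Function.update d s (d s + 1)) := by
  obtain ⟨hu, hun, hok, hle, hmin⟩ := hb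
  have hmono : ∀ s', d s' ≤ Function.update d s (d s + 1) s' := by
    intro s'
    by_cases hs : s' = s
    · subst hs; simp
    · simp [hs]
  refine ⟨fun s' v hv => ?_, fun s' s'' v hv hv' => ?_, fun s' hs' => ?_,
    fun s' v hv s'' hs'' => ?_,
    fun s' => ?_⟩
  · by_cases hs : s' = s
    · subst hs
      simp only [Function.update_self, Option.some.injEq] at hv
      exact hv ▸ ⟨hu, hok⟩
    · rw [Function.update_of_ne hs] at hv
      exact h.mem s' v hv
  · by_cases hs : s' = s <;> by_cases hs2 : s'' = s
    · rw [hs, hs2]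
    · subst hs
      rw [Function.update_of_ne hs2] at hv'
      simp only [Function.update_self, Option.some.injEq] at hv
      exact absurd (hv ▸ hv') (hun s'')
    · subst hs2
      rw [Function.update_of_ne hs] at hv
      simp only [Function.update_self, Option.some.injEq] at hv'
      exact absurd (hv' ▸ hv) (hun s')
    · rw [Function.update_of_ne hs] at hv
      rw [Function.update_of_ne hs2] at hv'
      exact h.inj s' s'' v hv hv'
  · by_cases hs : s' = s
    · subst hs
      simp
    · rw [Function.update_of_ne hs] at hs' ⊢
      exact h.price s' hs'
  · refine le_trans ?_ (Nat.add_le_add_right (hmono s'') 1)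
    by_cases hs : s' = s
    · subst hs
      simp only [Function.update_self, Option.some.injEq] at hv ⊢
      exact Nat.add_le_add_right (hmin s'' (hv ▸ hs'')) 1
    · rw [Function.update_of_ne hs] at hv ⊢
      exact h.content s' v hv s'' hs''
  · by_cases hs : s' = s
    · subst hs
      simpa using hle
    · rw [Function.update_of_ne hs]
      exact h.le s'

theorem Auction.sum_le [Fintype ι] {o : ι → Option U} {d : ι → ℕ} (h : Auction m vert tk ok o d) :
    ∑ s, d s ≤ Fintype.card ι * (m + 1) := by
  refine (Finset.sum_le_card_nsmul Finset.univ d _ fun s _ => h.le s).trans ?_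
  simp

/-- At the end of the auction no placement misses fewer tokens. -/
theorem Auction.card_unplaced_le [Fintype ι] [Fintype α] (hm : Fintype.card ι ≤ m)
    {o : ι → Option U} {d : ι → ℕ}
    (h : Auction m vert tk ok o d) (hend : ∀ u s, ¬ Bid m vert tk ok o d u s) {c : ℕ}
    (hvert : ∀ a, (Finset.univ.filter fun s => vert s = a).card = c)
    {g : U → α} (hg : ∀ u ∈ tk, ok u (g u)) {D : α → ℕ}
    (hD : ∀ a, (tk.filter fun u => g u = a).card ≤ D a) :
    (tk.filter fun u => ∀ s, o s ≠ some u).card ≤ ∑ a, (D a - c) := by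
  have hhigh : ∀ u ∈ tk, (∀ s, o s ≠ some u) → ∀ s, ok u (vert s) → m < d s := by
    intro u hu hun s hs
    by_contra! hle
    obtain ⟨s', hs', hmin⟩ := Finset.exists_min_image (Finset.univ.filter fun s => ok u (vert s)) d
      ⟨s, by simpa using hs⟩
    simp only [Finset.mem_filter, Finset.mem_univ, true_and] at hs' hmin
    exact hend u s' ⟨hu, hun, hs', (hmin s hs).trans hle, hmin⟩
  -- There are `m + 1` positive price levels but at most `m` places, so some level is unused.
  -- Cutting at this gap gives the tight set of places.
  obtain ⟨k, hk, hkm, hkd⟩ : ∃ k, 1 ≤ k ∧ k ≤ m + 1 ∧ ∀ s, d s ≠ k := by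
    by_contra! hc
    have : (Finset.Icc 1 (m + 1)).card ≤ (Finset.univ.image d).card :=
      Finset.card_le_card fun k hk => by
        obtain ⟨h1, h2⟩ := Finset.mem_Icc.1 hk
        obtain ⟨s, hs⟩ := hc k h1 h2
        exact Finset.mem_image.2 ⟨s, Finset.mem_univ _, hs⟩
    have h2 := (Finset.card_image_le (s := Finset.univ) (f := d))
    rw [Finset.card_univ] at h2
    simp at this
    omega
  set X := Finset.univ.filter fun s => k ≤ d s with hX
  set un := tk.filter fun u => ∀ s, o s ≠ some u with hun
  set P := tk.filter fun u => ∃ s ∈ X, o s = some u with hP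
  have hocc : ∀ s ∈ X, ∃ u, o s = some u := by
    intro s hs
    have : k ≤ d s := by simpa [hX] using hs
    exact Option.ne_none_iff_exists'.1 (h.price s (by omega))
  have hXP : X.card ≤ P.card := by
    have : X = ∅ ∨ Nonempty U := X.eq_empty_or_nonempty.imp_right fun ⟨s, hs⟩ =>
      ⟨(hocc s hs).choose⟩
    rcases this with h0 | _
    · simp [h0]
    choose! f hf using hocc
    refine Finset.card_le_card_of_injOn f (fun s hs => ?_) fun s hs s' hs' he => ?_
    · exact Finset.mem_coe.2 (Finset.mem_filter.2 ⟨(h.mem s _ (hf s hs)).1, s, hs, hf s hs⟩)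
    · exact h.inj s s' _ (hf s hs) (he ▸ hf s' hs')
  have hdis : Disjoint un P := by
    rw [Finset.disjoint_left]
    rintro u hu hu'
    obtain ⟨s, -, hs⟩ := (Finset.mem_filter.1 hu').2
    exact (Finset.mem_filter.1 hu).2 s hs
  -- An owner above the gap pays at least `k + 1` and overpays by at most one, so all its allowed
  -- places cost at least `k`. For an unplaced token all allowed places cost more than `m`.
  have hcl : ∀ u ∈ un ∪ P, ∀ s, ok u (vert s) → s ∈ X := by
    intro u hu s hs
    rw [hX, Finset.mem_filter]
    refine ⟨Finset.mem_univ _, ?_⟩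
    rcases Finset.mem_union.1 hu with hu | hu
    · obtain ⟨h1, h2⟩ := Finset.mem_filter.1 hu
      have := hhigh u h1 h2 s hs
      omega
    · obtain ⟨-, s', hs', ho⟩ := Finset.mem_filter.1 hu
      have h1 := h.content s' u ho s hs
      have h2 : k ≤ d s' := by simpa [hX] using hs'
      have h3 := hkd s'
      omega
  set Y := (un ∪ P).image g with hY
  have htk : un ∪ P ⊆ tk :=
    Finset.union_subset (Finset.filter_subset _ _) (Finset.filter_subset _ _)
  -- All places of the vertices in `Y` lie in `X`. Hence `un ∪ P` is a Hall obstruction: the rival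
  -- placement `g` puts it on `Y`, which has at most `|X| ≤ |P|` places, so its excess over `Y` is
  -- at least the size of `un`.
  have hYX : c * Y.card ≤ X.card := by
    have : X.filter (fun s => vert s ∈ Y) ⊆ X := Finset.filter_subset _ _
    refine le_trans ?_ (Finset.card_le_card this)
    rw [Finset.card_eq_sum_card_fiberwise (t := Y) (f := vert)
      (fun s hs => Finset.mem_coe.2 (Finset.mem_filter.1 (Finset.mem_coe.1 hs)).2)]
    rw [mul_comm, ← smul_eq_mul]
    refine Finset.card_nsmul_le_sum _ _ _ fun a ha => ?_
    rw [← hvert a]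
    refine Finset.card_le_card fun s hs => ?_
    have hsa : vert s = a := (Finset.mem_filter.1 hs).2
    obtain ⟨u, hu, rfl⟩ := Finset.mem_image.1 ha
    have : s ∈ X := hcl u hu s (hsa ▸ hg u (htk hu))
    simp [this, hsa, ha]
  have hcount : (un ∪ P).card ≤ ∑ a ∈ Y, D a := by
    rw [Finset.card_eq_sum_card_fiberwise (t := Y) (f := g)
      (fun u hu => Finset.mem_coe.2 (Finset.mem_image_of_mem g (Finset.mem_coe.1 hu)))]
    refine Finset.sum_le_sum fun a _ => (Finset.card_le_card ?_).trans (hD a)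
    exact Finset.filter_subset_filter _ htk
  rw [Finset.card_union_of_disjoint hdis] at hcount
  have h1 : ∑ a ∈ Y, D a ≤ ∑ a ∈ Y, (c + (D a - c)) := Finset.sum_le_sum fun a _ => by omega
  have h2 : ∑ a ∈ Y, (D a - c) ≤ ∑ a, (D a - c) :=
    Finset.sum_le_sum_of_subset (Finset.subset_univ _)
  rw [Finset.sum_add_distrib, Finset.sum_const, smul_eq_mul, mul_comm] at h1
  omega

end Auction

/-! ### Formulas and loops -/

namespace RAM

/-- Call `f` with the given arguments. -/
def Exp.app (f : Exp) (l : List Exp) : Exp := .call l.length l.get f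

/-- `e = 0`. -/
def Exp.not (e : Exp) : Exp := .ite e (.const 0) (.const 1)

/-- Conjunction. -/
def Exp.and (e f : Exp) : Exp := .ite e f (.const 0)

/-- Disjunction. -/
def Exp.or (e f : Exp) : Exp := .ite e (.const 1) f

/-- `e < f`. -/
def Exp.lt (e f : Exp) : Exp := .sub f e

/-- `e = f`. -/
def Exp.eq (e f : Exp) : Exp := .not (.add (.sub e f) (.sub f e))

/-- `e * n + f`. -/
def Exp.pair (e f : Exp) : Exp := .add (.app (.sum 1 0 (.var 0)) [e]) f

/-- The index of a quadruple. -/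
def Exp.idx4 (e f g h : Exp) : Exp := .pair (.pair (.pair e f) g) h

/-- The number of `i < n` with the property `e`. -/
def Exp.count (e : Exp) : Exp := .sum 1 0 (.ite e (.const 1) (.const 0))

/-- `e` holds. -/
def Tr (n : ℕ) (M : Mem) (e : Exp) (env : List ℕ) : Prop := e.eval n M env ≠ 0

/-! ### Values and truth of formulas -/

section

variable {n : ℕ} {M : Mem} {env : List ℕ} {e f g : Exp}

@[simp] theorem eval_const (c : ℕ) : (Exp.const c).eval n M env = c := rfl
@[simp] theorem eval_var (i : ℕ) : (Exp.var i).eval n M env = env.getD i 0 := rfl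
@[simp] theorem eval_size : Exp.size.eval n M env = n := rfl
@[simp] theorem eval_add : (Exp.add e f).eval n M env = e.eval n M env + f.eval n M env := rfl
@[simp] theorem eval_sub : (Exp.sub e f).eval n M env = e.eval n M env - f.eval n M env := rfl
@[simp] theorem eval_read (a : ℕ) : (Exp.read a e).eval n M env = M a (e.eval n M env) := rfl

open scoped Classical in
@[simp] theorem eval_ite :
    (Exp.ite e f g).eval n M env = if Tr n M e env then f.eval n M env else g.eval n M env := by
  simp only [Exp.eval, Tr]
  congr

@[simp] theorem eval_app (l : List Exp) :
    (Exp.app f l).eval n M env = f.eval n M (l.map fun e => e.eval n M env) := by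
  rw [Exp.app, Exp.eval]
  congr 1
  rw [← List.ofFn_get (l := l), List.map_ofFn]
  simp [Function.comp_def]

@[simp] theorem eval_pair : (Exp.pair e f).eval n M env = e.eval n M env * n + f.eval n M env := by
  simp [Exp.pair, Exp.eval, mul_comm]

theorem eval_sum (k c : ℕ) : (Exp.sum k c e).eval n M env =
    ∑ i ∈ Finset.range (k * n + c), e.eval n M (env ++ [i]) := rfl

@[simp] theorem tr_var (i : ℕ) : Tr n M (.var i) env ↔ env.getD i 0 ≠ 0 := Iff.rfl
@[simp] theorem tr_read (a : ℕ) : Tr n M (.read a e) env ↔ M a (e.eval n M env) ≠ 0 := Iff.rfl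
@[simp] theorem tr_app (l : List Exp) :
    Tr n M (.app f l) env ↔ Tr n M f (l.map fun e => e.eval n M env) := by simp [Tr]
@[simp] theorem tr_not : Tr n M (.not e) env ↔ ¬ Tr n M e env := by
  by_cases h : e.eval n M env = 0 <;> simp [Tr, Exp.not, Exp.eval, h]
@[simp] theorem tr_and : Tr n M (.and e f) env ↔ Tr n M e env ∧ Tr n M f env := by
  by_cases h : e.eval n M env = 0 <;> simp [Tr, Exp.and, Exp.eval, h]
@[simp] theorem tr_or : Tr n M (.or e f) env ↔ Tr n M e env ∨ Tr n M f env := by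
  by_cases h : e.eval n M env = 0 <;> simp [Tr, Exp.or, Exp.eval, h]
@[simp] theorem tr_lt : Tr n M (.lt e f) env ↔ e.eval n M env < f.eval n M env := by
  simp [Tr, Exp.lt, Nat.sub_eq_zero_iff_le]
@[simp] theorem tr_eq : Tr n M (.eq e f) env ↔ e.eval n M env = f.eval n M env := by
  rw [Exp.eq, tr_not, Tr, eval_add, eval_sub, eval_sub]
  omega

/-- A sum of natural numbers is nonzero when some term is, so bounded sums double as bounded
existential quantifiers. -/
theorem tr_sum (k c : ℕ) : Tr n M (.sum k c e) env ↔
    ∃ i < k * n + c, Tr n M e (env ++ [i]) := by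
  simp [Tr, eval_sum]

@[simp] theorem tr_ex : Tr n M (.sum 1 0 e) env ↔ ∃ i : Fin n, Tr n M e (env ++ [(i : ℕ)]) := by
  rw [tr_sum]
  constructor
  · rintro ⟨i, hi, h⟩
    exact ⟨⟨i, by omega⟩, h⟩
  · rintro ⟨i, h⟩
    exact ⟨i, by omega, h⟩

@[simp] theorem tr_exBool : Tr n M (.sum 0 2 e) env ↔ ∃ b : Bool, Tr n M e (env ++ [b.toNat]) := by
  rw [tr_sum]
  constructor
  · rintro ⟨i, hi, h⟩
    obtain rfl | rfl : i = 0 ∨ i = 1 := by omega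
    · exact ⟨false, h⟩
    · exact ⟨true, h⟩
  · rintro ⟨b, h⟩
    exact ⟨b.toNat, by have := b.toNat_lt; omega, h⟩

open scoped Classical in
@[simp] theorem eval_count : (Exp.count e).eval n M env =
    (Finset.univ.filter fun i : Fin n => Tr n M e (env ++ [(i : ℕ)])).card := by
  rw [Exp.count, eval_sum, Finset.card_filter]
  simp only [one_mul, add_zero, eval_ite, eval_const]
  rw [← Fin.sum_univ_eq_sum_range (fun i => if Tr n M e (env ++ [i]) then 1 else 0)]

end

theorem pair_inj {n p q p' q' : ℕ} (hq : q < n) (hq' : q' < n) (h : p * n + q = p' * n + q') :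
    p = p' ∧ q = q' := by
  have hn : 0 < n := by omega
  have h1 := congrArg (· / n) h
  have h2 := congrArg (· % n) h
  simp only [mul_comm _ n, Nat.mul_add_div hn, Nat.mul_add_mod, Nat.div_eq_of_lt hq,
    Nat.div_eq_of_lt hq', Nat.mod_eq_of_lt hq, Nat.mod_eq_of_lt hq'] at h1 h2
  exact ⟨by simpa using h1, h2⟩

theorem exec_loop_induction {n k c : ℕ} {C : Cmd} {M : Mem} {env : List ℕ} (Inv : ℕ → Mem → Prop)
    (h0 : Inv 0 M) (step : ∀ i < k * n + c, ∀ M, Inv i M → Inv (i + 1) (C.exec n M (env ++ [i]))) :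
    Inv (k * n + c) ((Cmd.loop k c C).exec n M env) := by
  rw [Cmd.exec]
  suffices ∀ j ≤ k * n + c,
      Inv j ((List.range j).foldl (fun M i => C.exec n M (env ++ [i])) M) from this _ le_rfl
  intro j
  induction j with
  | zero => exact fun _ => h0
  | succ j ih =>
    intro hj
    rw [List.range_succ, List.foldl_append]
    exact step j (by omega) _ (ih (by omega))

/-- What round `i` achieves persists, because later rounds only move up in `Le`. Applied once per
nested loop. -/
theorem exec_loop_mono {n k c : ℕ} {C : Cmd} {M : Mem} {env : List ℕ} {Le : Mem → Mem → Prop}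
    (hrefl : ∀ M, Le M M) (htrans : ∀ M M' M'', Le M M' → Le M' M'' → Le M M'')
    {Q : ℕ → Mem → Prop}
    (hQ : ∀ i M' M'', Le M M' → Le M' M'' → Q i M' → Q i M'')
    (step : ∀ i < k * n + c, ∀ M', Le M M' →
      Le M' (C.exec n M' (env ++ [i])) ∧ Q i (C.exec n M' (env ++ [i]))) :
    Le M ((Cmd.loop k c C).exec n M env) ∧
      ∀ i < k * n + c, Q i ((Cmd.loop k c C).exec n M env) := by
  refine exec_loop_induction (fun j M' => Le M M' ∧ ∀ i < j, Q i M') ⟨hrefl M, by simp⟩ ?_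
  rintro j hj M' ⟨hle, hq⟩
  obtain ⟨h1, h2⟩ := step j hj M' hle
  refine ⟨htrans _ _ _ hle h1, fun i hi => ?_⟩
  rcases Nat.lt_succ_iff_lt_or_eq.1 hi with h | rfl
  · exact hQ i _ _ hle h1 (hq i h)
  · exact h2

/-! ### Reachability -/

/-- Mark the vertices adjacent to those marked. -/
def closureStep (arr : ℕ) (e : Exp) : Cmd :=
  .loop 1 0 <| .loop 1 0 <| .loop 1 0 <| .loop 1 0 <|
    .ite (.sum 1 0 (.and (.read arr (.idx4 (.var 1) (.var 2) (.var 3) (.var 5)))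
        (.app e [.var 1, .var 2, .var 5, .var 4])))
      (.store arr (.idx4 (.var 1) (.var 2) (.var 3) (.var 4)) (.const 1)) .skip

/-- Tabulate reachability in the graphs with adjacency `e`, two of whose four parameters name the
graph. -/
def closureCmd (arr : ℕ) (e : Exp) : Cmd :=
  .seq (.loop 1 0 <| .loop 1 0 <| .loop 1 0 <|
    .store arr (.idx4 (.var 0) (.var 1) (.var 2) (.var 2)) (.const 1)) <|
  .loop 1 0 (closureStep arr e)

/-! ### Correctness of the reachability table -/

section Closure

variable {n : ℕ} {A : Set (Fin n)}

/-- The index of a vertex. -/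
def ix (a : A) : ℕ := (a : Fin n)

theorem ix_lt_size (a : A) : ix a < n := (a : Fin n).2

@[simp] theorem ix_inj {a b : A} : ix a = ix b ↔ a = b := by
  simp [ix, Fin.val_inj, Subtype.val_inj]

@[simp] theorem ix_lt {a b : A} : ix a < ix b ↔ a < b := Iff.rfl

/-- The index of a quadruple. -/
def quad (n p q s t : ℕ) : ℕ := ((p * n + q) * n + s) * n + t

theorem quad_inj {p q s t p' q' s' t' : ℕ} (hq : q < n) (hs : s < n) (ht : t < n)
    (hq' : q' < n) (hs' : s' < n) (ht' : t' < n) (h : quad n p q s t = quad n p' q' s' t') :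
    p = p' ∧ q = q' ∧ s = s' ∧ t = t' := by
  simp only [quad] at h
  obtain ⟨h1, h2⟩ := pair_inj ht ht' h
  obtain ⟨h3, h4⟩ := pair_inj hs hs' h1
  obtain ⟨h5, h6⟩ := pair_inj hq hq' h3
  exact ⟨h5, h6, h4, h2⟩

@[simp] theorem eval_idx4 {M : Mem} {env : List ℕ} {e f g h : Exp} :
    (Exp.idx4 e f g h).eval n M env =
      quad n (e.eval n M env) (f.eval n M env) (g.eval n M env) (h.eval n M env) := by
  simp [Exp.idx4, quad]

/-- The marks in the table are correct. -/
def Sound (H : A → A → SimpleGraph A) (arr : ℕ) (M : Mem) : Prop :=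
  ∀ (x y : A) (s t : ℕ), s < n → t < n → M arr (quad n (ix x) (ix y) s t) ≠ 0 →
    s = t ∨ ∃ a b : A, ix a = s ∧ ix b = t ∧ (H x y).Reachable a b

/-- `M'` has more marks. -/
def Grows (H : A → A → SimpleGraph A) (arr : ℕ) (M M' : Mem) : Prop :=
  (∀ a ≠ arr, M' a = M a) ∧ (∀ k, M arr k ≠ 0 → M' arr k ≠ 0) ∧ (Sound H arr M → Sound H arr M')

theorem Grows.refl {H : A → A → SimpleGraph A} {arr : ℕ} (M : Mem) : Grows H arr M M :=
  ⟨fun _ _ => rfl, fun _ h => h, id⟩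

theorem Grows.trans {H : A → A → SimpleGraph A} {arr : ℕ} (M M' M'' : Mem)
    (h : Grows H arr M M') (h' : Grows H arr M' M'') : Grows H arr M M'' :=
  ⟨fun a ha => (h'.1 a ha).trans (h.1 a ha), fun k hk => h'.2.1 k (h.2.1 k hk),
    fun hs => h'.2.2 (h.2.2 hs)⟩

/-- The new mark has to be justified only under the assumption that the present table is sound, so
marks may be derived from marks. -/
theorem grows_mark {H : A → A → SimpleGraph A} {arr : ℕ} {M : Mem} {p q s t : ℕ} (hq : q < n)
    (hs : s < n) (ht : t < n)
    (hok : Sound H arr M → ∀ x y : A, ix x = p → ix y = q →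
      s = t ∨ ∃ a b : A, ix a = s ∧ ix b = t ∧ (H x y).Reachable a b) :
    Grows H arr M (Function.update M arr (Function.update (M arr) (quad n p q s t) 1)) := by
  refine ⟨fun a ha => by simp [ha], fun k hk => ?_, fun hM x y s' t' hs' ht' h => ?_⟩
  · by_cases h : k = quad n p q s t <;> simp [h, hk]
  · by_cases he : quad n (ix x) (ix y) s' t' = quad n p q s t
    · obtain ⟨h1, h2, rfl, rfl⟩ := quad_inj (ix_lt_size y) hs' ht' hq hs ht he
      exact hok hM x y h1 h2
    · refine hM x y s' t' hs' ht' ?_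
      simpa [he] using h

/-- After `j` rounds all walks of length at most `j` are found. The table is updated in place; marks
used early in the same round do no harm, since soundness is kept throughout. The formula `e` must be
correct whatever the table itself contains. -/
theorem exec_closureCmd {arr : ℕ} {e : Exp} {M₀ : Mem} (H : A → A → SimpleGraph A)
    (h0 : ∀ k, M₀ arr k = 0)
    (he : ∀ M, (∀ a ≠ arr, M a = M₀ a) → ∀ (x y : A) (c t : ℕ), c < n → t < n →
      (Tr n M e [ix x, ix y, c, t] ↔ ∃ a b : A, ix a = c ∧ ix b = t ∧ (H x y).Adj a b)) :
    (∀ a ≠ arr, (closureCmd arr e).exec n M₀ [] a = M₀ a) ∧ ∀ x y a b : A,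
      (closureCmd arr e).exec n M₀ [] arr (quad n (ix x) (ix y) (ix a) (ix b)) ≠ 0 ↔
        (H x y).Reachable a b := by
  classical
  have hsound0 : Sound H arr M₀ := fun x y s t _ _ h => absurd (h0 _) h
  set M₁ : Mem := (Cmd.loop 1 0 <| .loop 1 0 <| .loop 1 0 <|
    .store arr (.idx4 (.var 0) (.var 1) (.var 2) (.var 2)) (.const 1)).exec n M₀ [] with hM₁
  have h1 : Grows H arr M₀ M₁ ∧ ∀ p < 1 * n + 0, ∀ q < 1 * n + 0, ∀ s < 1 * n + 0,
      M₁ arr (quad n p q s s) ≠ 0 := by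
    refine exec_loop_mono (Q := fun p M => ∀ q < 1 * n + 0, ∀ s < 1 * n + 0,
      M arr (quad n p q s s) ≠ 0) Grows.refl Grows.trans
      (fun p M M' _ h hp q hq s hs => h.2.1 _ (hp q hq s hs)) fun p hp M _ => ?_
    refine exec_loop_mono (Q := fun q M => ∀ s < 1 * n + 0,
      M arr (quad n p q s s) ≠ 0) Grows.refl Grows.trans
      (fun q M M' _ h hp s hs => h.2.1 _ (hp s hs)) fun q hq M _ => ?_
    refine exec_loop_mono (Q := fun s M =>
      M arr (quad n p q s s) ≠ 0) Grows.refl Grows.trans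
      (fun s M M' _ h hp => h.2.1 _ hp) fun s hs M _ => ?_
    simp only [Cmd.exec, eval_idx4, eval_var, eval_const, List.nil_append, List.cons_append,
      List.getD_cons_zero, List.getD_cons_succ]
    -- The diagonal is marked for indices outside `A` as well, which is why `Sound` allows `s = t`.
    exact ⟨grows_mark (by omega) (by omega) (by omega) fun _ _ _ _ _ => Or.inl rfl, by simp⟩
  let Done : ℕ → Mem → Prop := fun j M => ∀ (x y a b : A),
    (∃ w : (H x y).Walk a b, w.length ≤ j) → M arr (quad n (ix x) (ix y) (ix a) (ix b)) ≠ 0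
  have h2 : Grows H arr M₁ ((closureCmd arr e).exec n M₀ []) ∧
      Done (1 * n + 0) ((closureCmd arr e).exec n M₀ []) := by
    rw [closureCmd, Cmd.exec, ← hM₁]
    refine exec_loop_induction (fun j M => Grows H arr M₁ M ∧ Done j M) ⟨Grows.refl _, ?_⟩ ?_
    · rintro x y a b ⟨w, hw⟩
      obtain rfl := SimpleGraph.Walk.eq_of_length_eq_zero (Nat.le_zero.1 hw)
      have := ix_lt_size x
      have := ix_lt_size y
      have := ix_lt_size a
      exact h1.2 _ (by omega) _ (by omega) _ (by omega)
    rintro j - M ⟨hM, hD⟩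
    let cond : Mem → ℕ → ℕ → ℕ → ℕ → Prop := fun M p q s t =>
      ∃ c : Fin n, M arr (quad n p q s c) ≠ 0 ∧ Tr n M e [p, q, c, t]
    have hcond : ∀ M', Grows H arr M M' → ∀ x y : A, ∀ s t, t < n →
        (cond M' (ix x) (ix y) s t ↔ ∃ a b : A, M' arr (quad n (ix x) (ix y) s (ix a)) ≠ 0 ∧
          ix b = t ∧ (H x y).Adj a b) := by
      intro M' hM' x y s t ht
      have hag : ∀ a ≠ arr, M' a = M₀ a := fun a ha =>
        (hM'.1 a ha).trans ((hM.1 a ha).trans (h1.1.1 a ha))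
      constructor
      · rintro ⟨c, hc, hct⟩
        obtain ⟨a, b, ha, hb, hab⟩ := (he M' hag x y c t c.2 ht).1 hct
        exact ⟨a, b, by rwa [ha], hb, hab⟩
      · rintro ⟨a, b, ha, hb, hab⟩
        exact ⟨⟨ix a, ix_lt_size a⟩, ha, (he M' hag x y _ t (ix_lt_size a) ht).2
          ⟨a, b, rfl, hb, hab⟩⟩
    have hstep : Grows H arr M ((closureStep arr e).exec n M ([] ++ [j])) ∧
        ∀ p < 1 * n + 0, ∀ q < 1 * n + 0, ∀ s < 1 * n + 0,
        ∀ t < 1 * n + 0, ∀ x y : A, ix x = p → ix y = q → cond M p q s t →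
          (closureStep arr e).exec n M ([] ++ [j]) arr (quad n p q s t) ≠ 0 := by
      refine exec_loop_mono (Q := fun p M' => ∀ q < 1 * n + 0, ∀ s < 1 * n + 0, ∀ t < 1 * n + 0,
        ∀ x y : A, ix x = p → ix y = q → cond M p q s t → M' arr (quad n p q s t) ≠ 0)
        Grows.refl Grows.trans
        (fun p M' M'' _ h hp q hq s hs t ht x y hx hy hc =>
          h.2.1 _ (hp q hq s hs t ht x y hx hy hc))
        fun p hp M' hM' => ?_
      refine exec_loop_mono (Q := fun q M' => ∀ s < 1 * n + 0, ∀ t < 1 * n + 0,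
        ∀ x y : A, ix x = p → ix y = q → cond M p q s t → M' arr (quad n p q s t) ≠ 0)
        Grows.refl Grows.trans
        (fun q M' M'' _ h hp s hs t ht x y hx hy hc => h.2.1 _ (hp s hs t ht x y hx hy hc))
        fun q hq M'' hM'' => ?_
      replace hM' := Grows.trans _ _ _ hM' hM''
      refine exec_loop_mono (Q := fun s M' => ∀ t < 1 * n + 0,
        ∀ x y : A, ix x = p → ix y = q → cond M p q s t → M' arr (quad n p q s t) ≠ 0)
        Grows.refl Grows.trans
        (fun s M' M'' _ h hp t ht x y hx hy hc => h.2.1 _ (hp t ht x y hx hy hc))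
        fun s hs M''' hM'' => ?_
      replace hM' := Grows.trans _ _ _ hM' hM''
      refine exec_loop_mono (Q := fun t M' =>
        ∀ x y : A, ix x = p → ix y = q → cond M p q s t → M' arr (quad n p q s t) ≠ 0)
        Grows.refl Grows.trans
        (fun t M' M'' _ h hp x y hx hy hc => h.2.1 _ (hp x y hx hy hc))
        fun t ht M'''' hM'' => ?_
      replace hM' := Grows.trans _ _ _ hM' hM''
      clear hM''
      generalize M'''' = M' at *
      have hbody : Tr n M' (.sum 1 0 (.and (.read arr (.idx4 (.var 1) (.var 2) (.var 3) (.var 5)))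
        (.app e [.var 1, .var 2, .var 5, .var 4]))) ([] ++ [j] ++ [p] ++ [q] ++ [s] ++ [t]) ↔
          cond M' p q s t := by simp [cond]
      rw [Cmd.exec]
      simp only [← Tr.eq_def, hbody]
      by_cases hc : cond M' p q s t
      · rw [if_pos hc]
        simp only [Cmd.exec, eval_idx4, eval_var, eval_const, List.nil_append, List.cons_append,
          List.getD_cons_zero, List.getD_cons_succ]
        refine ⟨grows_mark (by omega) (by omega) (by omega) ?_, by simp⟩
        rintro hs' x y rfl rfl
        obtain ⟨a, b, ha, hb, hab⟩ := (hcond M' hM' x y s t (by omega)).1 hc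
        right
        rcases hs' x y s (ix a) (by omega) (ix_lt_size a) ha with rfl | ⟨a', b', h1, h2, h3⟩
        · exact ⟨a, b, rfl, hb, hab.reachable⟩
        · obtain rfl := ix_inj.1 h2
          exact ⟨a', b, h1, hb, h3.trans hab.reachable⟩
      · rw [if_neg hc]
        refine ⟨Grows.refl _, ?_⟩
        rintro x y rfl rfl hc'
        obtain ⟨a, b, ha, hb, hab⟩ := (hcond M (Grows.refl _) x y s t (by omega)).1 hc'
        exact absurd ((hcond M' hM' x y s t (by omega)).2 ⟨a, b, hM'.2.1 _ ha, hb, hab⟩) hc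
    refine ⟨Grows.trans _ _ _ hM hstep.1, ?_⟩
    rintro x y a b ⟨w, hw⟩
    have hx := ix_lt_size x
    have hy := ix_lt_size y
    have ha := ix_lt_size a
    have hb := ix_lt_size b
    rcases Nat.lt_or_ge w.length (j + 1) with hl | hl
    · exact hstep.1.2.1 _ (hD x y a b ⟨w, by omega⟩)
    · have hnn : ¬ w.Nil := fun h => by
        have := SimpleGraph.Walk.length_eq_zero_iff.2 h
        omega
      refine hstep.2 _ (by omega) _ (by omega) _ (by omega) _ (by omega) x y rfl rfl ?_
      refine (hcond M (Grows.refl _) x y _ _ hb).2 ⟨w.penultimate, b, ?_, rfl,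
        w.adj_penultimate hnn⟩
      refine hD x y a _ ⟨w.dropLast, ?_⟩
      simp
      omega
  obtain ⟨h2, h3⟩ := h2
  have h := Grows.trans _ _ _ h1.1 h2
  refine ⟨h.1, fun x y a b => ⟨fun hm => ?_, fun hr => ?_⟩⟩
  · rcases h.2.2 hsound0 x y _ _ (ix_lt_size a) (ix_lt_size b) hm with he | ⟨a', b', h1, h2, h3⟩
    · rw [ix_inj.1 he]
    · rwa [ix_inj.1 h1, ix_inj.1 h2] at h3
  -- A path has fewer edges than `A` has vertices, so `n` rounds suffice.
  · obtain ⟨w, hw⟩ := hr.exists_isPath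
    refine h3 x y a b ⟨w, ?_⟩
    have h1 := hw.length_lt
    have h2 : Fintype.card A ≤ n := by simpa using set_fintype_card_le_univ A
    omega

end Closure

end RAM

/-! ### The auction as a command -/

namespace RAM

open Exp (var)

section

/-- Both ends of a pair are adjacent. -/
def Exp.adj (e f : Exp) : Exp := .read 0 (.pair e f)

/-- There is a vertex of `A`, held in variable `i`, with the property `e`. -/
def Exp.exA (i : ℕ) (e : Exp) : Exp := .sum 1 0 (.and (.read 1 (.var i)) e)

/-- The number of vertices of `A`, held in variable `i`, with the property `e`. -/
def Exp.countA (i : ℕ) (e : Exp) : Exp := .count (.and (.read 1 (.var i)) e)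

/-- The vertex of `A`, held in variable `i`, with the property `e`. -/
def Exp.theA (i : ℕ) (e : Exp) : Exp :=
  .sum 1 0 (.ite (.and (.read 1 (.var i)) e) (.var i) (.const 0))

/-- `N x ∩ N y ⊆ N a`. -/
def subE : Exp := .not <| .sum 1 0 <|
  .and (.and (.adj (var 0) (var 3)) (.adj (var 1) (var 3))) (.not (.adj (var 2) (var 3)))

/-- Adjacency in the class graph of `N x ∩ N y`. -/
def clsE : Exp :=
  .and (.read 1 (var 2)) <| .and (.read 1 (var 3)) <| .and (.not (.eq (var 2) (var 3))) <|
  .and (.app subE [var 0, var 1, var 2]) <| .and (.app subE [var 0, var 1, var 3]) <|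
  .sum 1 0 (.and (.and (.adj (var 2) (var 4)) (.adj (var 3) (var 4)))
    (.not (.and (.adj (var 0) (var 4)) (.adj (var 1) (var 4)))))

/-- The table of the classes. -/
def sameE (x y a b : Exp) : Exp := .read 4 (.idx4 x y a b)

def canonE : Exp :=
  .and (.not (sameE (var 0) (var 1) (var 0) (var 1))) <| .not <| .exA 2 <| .exA 3 <|
  .and (.or (.lt (var 2) (var 0)) (.and (.eq (var 2) (var 0)) (.lt (var 3) (var 1)))) <|
  .and (.not (sameE (var 2) (var 3) (var 2) (var 3))) <|
  .and (.and (.app subE [var 2, var 3, var 0]) (.app subE [var 2, var 3, var 1]))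
    (.and (.app subE [var 0, var 1, var 2]) (.app subE [var 0, var 1, var 3]))

def repE : Exp :=
  .and (.app subE [var 0, var 1, var 2]) <| .not <| .exA 3 <|
  .and (sameE (var 0) (var 1) (var 2) (var 3)) (.lt (var 3) (var 2))

def tokenE : Exp :=
  .and (.app canonE [var 0, var 1]) <| .and (.app repE [var 0, var 1, var 2]) <|
  .or (.not (var 3)) (.and (.not (sameE (var 0) (var 1) (var 0) (var 2)))
    (.not (sameE (var 0) (var 1) (var 1) (var 2))))

def allowedE : Exp :=
  .or (.and (var 3) (.app subE [var 0, var 1, var 4]))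
    (.and (.not (var 3)) (sameE (var 0) (var 1) (var 2) (var 4)))

/-- A code for a token. -/
def codeE : Exp :=
  .add (.add (.add (.pair (.pair (var 0) (var 1)) (var 2)) (.pair (.pair (var 0) (var 1)) (var 2)))
    (var 3)) (.const 1)

/-- The index of a place. -/
def placeE (a j : Exp) : Exp := .add (.add a a) j

def bidE : Exp :=
  .and (.app tokenE [var 0, var 1, var 2, var 3]) <|
  .and (.not <| .exA 6 <| .sum 0 2 <| .eq (.read 5 (placeE (var 6) (var 7)))
    (.app codeE [var 0, var 1, var 2, var 3])) <|
  .and (.app allowedE [var 0, var 1, var 2, var 3, var 4]) <|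
  .and (.not (.lt (.add .size .size) (.read 6 (placeE (var 4) (var 5))))) <|
  .not <| .exA 6 <| .sum 0 2 <| .and (.app allowedE [var 0, var 1, var 2, var 3, var 6]) <|
  .lt (.read 6 (placeE (var 6) (var 7))) (.read 6 (placeE (var 4) (var 5)))

end

/-! ### Meaning of the formulas of the auction -/

section

variable {n : ℕ} (G : SimpleGraph (Fin n)) (A : Set (Fin n))

/-- The neighbours of a vertex of `A`. -/
def nbrs (a : A) : Set (Fin n) := {b | G.Adj a b}

/-- The memory holds the input. -/
structure Input (M : Mem) : Prop where
  adj : ∀ i j : Fin n, M 0 (i * n + j) ≠ 0 ↔ G.Adj i j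
  mem : ∀ i : Fin n, M 1 i ≠ 0 ↔ i ∈ A

/-- The memory holds the classes. -/
def HasSame (M : Mem) : Prop :=
  ∀ x y a b : A, M 4 (quad n (ix x) (ix y) (ix a) (ix b)) ≠ 0 ↔
    Same (nbrs G A) (nbrs G A x ∩ nbrs G A y) a b

variable {G A} {M : Mem}

theorem Input.exA (h : Input G A M) {env : List ℕ} {i : ℕ} {e : Exp} (hi : env.length = i) :
    Tr n M (.exA i e) env ↔ ∃ a : A, Tr n M e (env ++ [ix a]) := by
  subst hi
  simp [Exp.exA, ix, h.mem]

open scoped Classical in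
theorem Input.countA (h : Input G A M) {env : List ℕ} {i : ℕ} {e : Exp} (hi : env.length = i) :
    (Exp.countA i e).eval n M env =
      (Finset.univ.filter fun a : A => Tr n M e (env ++ [ix a])).card := by
  subst hi
  rw [Exp.countA, eval_count]
  symm
  refine Finset.card_bij (fun a _ => (a : Fin n)) ?_ ?_ ?_
  · intro a ha
    have h' := (Finset.mem_filter.1 ha).2
    refine Finset.mem_filter.2 ⟨by simp, ?_⟩
    simp only [tr_and, tr_read, eval_var]
    exact ⟨by simp [h.mem], h'⟩
  · intro a _ b _ hab
    exact Subtype.ext hab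
  · intro b hb
    simp only [Finset.mem_filter, Finset.mem_univ, true_and, tr_and, tr_read, eval_var] at hb
    have hb1 : b ∈ A := by
      rw [← h.mem]
      simpa using hb.1
    exact ⟨⟨b, hb1⟩, Finset.mem_filter.2 ⟨Finset.mem_univ _, hb.2⟩, rfl⟩

/-- Definite description as a sum with a single nonvanishing term; uniqueness of `a` is essential.
-/
theorem Input.theA (h : Input G A M) {env : List ℕ} {i : ℕ} {e : Exp} (hi : env.length = i)
    (a : A) (ha : ∀ b : A, Tr n M e (env ++ [ix b]) ↔ b = a) :
    (Exp.theA i e).eval n M env = ix a := by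
  subst hi
  rw [Exp.theA, eval_sum, Finset.sum_eq_single_of_mem (ix a)]
  · rw [eval_ite, if_pos]
    · simp
    · simp only [tr_and, tr_read, eval_var, (ha a).2 rfl, and_true]
      simp [ix, h.mem]
  · simpa using ix_lt_size a
  · intro b hb hne
    rw [eval_ite, if_neg]
    · rfl
    · simp only [tr_and, tr_read, eval_var]
      rintro ⟨h1, h2⟩
      have hbn : b < n := by simpa using hb
      have hbA : (⟨b, hbn⟩ : Fin n) ∈ A := by
        rw [← h.mem]
        simpa using h1
      exact hne (congrArg ix ((ha ⟨⟨b, hbn⟩, hbA⟩).1 h2))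

theorem Input.adj_ix (h : Input G A M) {env : List ℕ} {e f : Exp} {a : A} {b : Fin n}
    (he : e.eval n M env = ix a) (hf : f.eval n M env = b) :
    Tr n M (.adj e f) env ↔ b ∈ nbrs G A a := by
  simp only [Exp.adj, tr_read, eval_pair, he, hf]
  exact h.adj a b

theorem Input.sub (h : Input G A M) (x y a : A) :
    Tr n M subE [ix x, ix y, ix a] ↔ nbrs G A x ∩ nbrs G A y ⊆ nbrs G A a := by
  have h0 : ∀ b : Fin n, Tr n M (.adj (var 0) (var 3)) [ix x, ix y, ix a, b] ↔ b ∈ nbrs G A x :=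
    fun b => h.adj_ix rfl rfl
  have h1 : ∀ b : Fin n, Tr n M (.adj (var 1) (var 3)) [ix x, ix y, ix a, b] ↔ b ∈ nbrs G A y :=
    fun b => h.adj_ix rfl rfl
  have h2 : ∀ b : Fin n, Tr n M (.adj (var 2) (var 3)) [ix x, ix y, ix a, b] ↔ b ∈ nbrs G A a :=
    fun b => h.adj_ix rfl rfl
  simp only [subE, tr_not, tr_ex, tr_and, List.cons_append, List.nil_append, h0, h1, h2]
  simp only [Set.subset_def, Set.mem_inter_iff]
  push Not
  rfl

theorem Input.cls (h : Input G A M) (x y : A) (c t : ℕ) (hc : c < n) (ht : t < n) :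
    Tr n M clsE [ix x, ix y, c, t] ↔ ∃ a b : A, ix a = c ∧ ix b = t ∧
      (clsGraph (nbrs G A) (nbrs G A x ∩ nbrs G A y)).Adj a b := by
  have key : ∀ a b : A, Tr n M clsE [ix x, ix y, ix a, ix b] ↔
      (clsGraph (nbrs G A) (nbrs G A x ∩ nbrs G A y)).Adj a b := by
    intro a b
    have h0 : ∀ d : Fin n,
        Tr n M (.adj (var 0) (var 4)) [ix x, ix y, ix a, ix b, d] ↔ d ∈ nbrs G A x :=
      fun b => h.adj_ix rfl rfl
    have h1 : ∀ d : Fin n,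
        Tr n M (.adj (var 1) (var 4)) [ix x, ix y, ix a, ix b, d] ↔ d ∈ nbrs G A y :=
      fun b => h.adj_ix rfl rfl
    have h2 : ∀ d : Fin n,
        Tr n M (.adj (var 2) (var 4)) [ix x, ix y, ix a, ix b, d] ↔ d ∈ nbrs G A a :=
      fun b => h.adj_ix rfl rfl
    have h3 : ∀ d : Fin n,
        Tr n M (.adj (var 3) (var 4)) [ix x, ix y, ix a, ix b, d] ↔ d ∈ nbrs G A b :=
      fun b => h.adj_ix rfl rfl
    have ha : M 1 (ix a) ≠ 0 := (h.mem a).2 a.2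
    have hb : M 1 (ix b) ≠ 0 := (h.mem b).2 b.2
    simp only [clsE, tr_and, tr_read, eval_var, List.getD_cons_zero, List.getD_cons_succ, ha, hb,
      true_and, tr_not, tr_eq, ix_inj, tr_app, List.map_cons, List.map_nil, h.sub, tr_ex,
      List.cons_append, List.nil_append, h0, h1, h2, h3, ne_eq, not_false_eq_true]
    simp only [clsGraph, Set.ssubset_iff_exists, Set.subset_inter_iff, Set.mem_inter_iff,
      and_assoc, ne_eq]
  constructor
  · intro hT
    have h1 : M 1 c ≠ 0 ∧ M 1 t ≠ 0 := by
      simp only [clsE, tr_and, tr_read, eval_var, List.getD_cons_zero, List.getD_cons_succ] at hT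
      exact ⟨hT.1, hT.2.1⟩
    have hcA := (h.mem ⟨c, hc⟩).1 h1.1
    have htA := (h.mem ⟨t, ht⟩).1 h1.2
    exact ⟨⟨_, hcA⟩, ⟨_, htA⟩, rfl, rfl, (key ⟨_, hcA⟩ ⟨_, htA⟩).1 hT⟩
  · rintro ⟨a, b, rfl, rfl, hab⟩
    exact (key a b).2 hab

theorem HasSame.tr_map (hs : HasSame G A M) (x y a b : A) :
    M 4 (quad n (ix x) (ix y) (ix a) (ix b)) ≠ 0 ↔
      Same (nbrs G A) (nbrs G A x ∩ nbrs G A y) a b := hs x y a b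

theorem tr_canon (h : Input G A M) (hs : HasSame G A M) (x y : A) :
    Tr n M canonE [ix x, ix y] ↔ Canon (nbrs G A) x y := by
  simp only [canonE, tr_and, tr_not, sameE, tr_read, eval_idx4, eval_var, List.getD_cons_zero,
    List.getD_cons_succ, hs.tr_map, h.exA (env := [ix x, ix y]) (i := 2) rfl, List.cons_append,
    List.nil_append]
  simp only [h.exA (env := [ix x, ix y, _]) (i := 3) rfl, List.cons_append, List.nil_append,
    tr_and, tr_or, tr_lt, tr_eq, eval_var, List.getD_cons_zero, List.getD_cons_succ, tr_not,
    tr_read, eval_idx4, hs.tr_map, tr_app, List.map_cons, List.map_nil, h.sub, ix_inj, ix_lt]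
  rw [Canon]
  refine and_congr_right fun _ => ?_
  simp only [Prod.Lex.toLex_lt_toLex, not_exists, not_and]
  refine forall_congr' fun x' => forall_congr' fun y' => forall_congr' fun _ =>
    forall_congr' fun _ => ?_
  rw [Ne, Set.Subset.antisymm_iff, Set.subset_inter_iff, Set.subset_inter_iff]
  tauto

theorem tr_rep (h : Input G A M) (hs : HasSame G A M) (x y z : A) :
    Tr n M repE [ix x, ix y, ix z] ↔ IsRep (nbrs G A) (nbrs G A x ∩ nbrs G A y) z := by
  simp only [repE, tr_and, tr_not, sameE, tr_read, eval_idx4, eval_var, List.getD_cons_zero,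
    List.getD_cons_succ, hs.tr_map, h.exA (env := [ix x, ix y, ix z]) (i := 3) rfl,
    List.cons_append, List.nil_append, tr_app, List.map_cons, List.map_nil, h.sub, tr_lt, ix_lt,
    not_exists, not_and, not_lt, IsRep]

theorem tr_token (h : Input G A M) (hs : HasSame G A M) (x y z : A) (k : Bool) :
    Tr n M tokenE [ix x, ix y, ix z, k.toNat] ↔ IsToken (nbrs G A) x y z k := by
  simp only [tokenE, tr_and, tr_not, tr_or, sameE, tr_read, eval_idx4, eval_var, tr_var,
    List.getD_cons_zero, List.getD_cons_succ, hs.tr_map, tr_app, List.map_cons, List.map_nil,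
    tr_canon h hs, tr_rep h hs, IsToken]
  cases k <;> simp

theorem tr_allowed (h : Input G A M) (hs : HasSame G A M) (x y z : A) (k : Bool) (a : A) :
    Tr n M allowedE [ix x, ix y, ix z, k.toNat, ix a] ↔ Allowed (nbrs G A) x y z k a := by
  simp only [allowedE, tr_and, tr_not, tr_or, sameE, tr_read, eval_idx4, eval_var, tr_var,
    List.getD_cons_zero, List.getD_cons_succ, hs.tr_map, tr_app, List.map_cons, List.map_nil,
    h.sub, Allowed]
  cases k <;> simp

/-- The code of a token. -/
def code (u : A × A × A × Bool) : ℕ :=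
  ((ix u.1 * n + ix u.2.1) * n + ix u.2.2.1) + ((ix u.1 * n + ix u.2.1) * n + ix u.2.2.1) +
    u.2.2.2.toNat + 1

theorem code_injective : Function.Injective (code (n := n) (A := A)) := by
  rintro ⟨x, y, z, k⟩ ⟨x', y', z', k'⟩ h
  simp only [code] at h
  have h1 := k.toNat_lt
  have h2 := k'.toNat_lt
  obtain ⟨h3, h4⟩ := pair_inj (ix_lt_size z) (ix_lt_size z') (by omega :
    (ix x * n + ix y) * n + ix z = (ix x' * n + ix y') * n + ix z')
  obtain ⟨h5, h6⟩ := pair_inj (ix_lt_size y) (ix_lt_size y') h3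
  have h7 : k = k' := by
    cases k <;> cases k' <;> simp at h ⊢ <;> omega
  rw [ix_inj.1 h4, ix_inj.1 h5, ix_inj.1 h6, h7]

/-- The index of a place. -/
def place (s : A × Bool) : ℕ := ix s.1 + ix s.1 + s.2.toNat

theorem place_injective : Function.Injective (place (n := n) (A := A)) := by
  rintro ⟨a, j⟩ ⟨a', j'⟩ h
  simp only [place] at h
  have h1 := j.toNat_lt
  have h2 := j'.toNat_lt
  have h3 : ix a = ix a' := by omega
  have h7 : j = j' := by
    cases j <;> cases j' <;> simp at h ⊢ <;> omega
  rw [ix_inj.1 h3, h7]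

/-- The memory holds the state of the auction. -/
structure Holds (M : Mem) (o : A × Bool → Option (A × A × A × Bool)) (d : A × Bool → ℕ) : Prop where
  owner : ∀ s, M 5 (place s) = (o s).elim 0 code
  price : ∀ s, M 6 (place s) = d s

/-- May the token be placed there? -/
def okay (G : SimpleGraph (Fin n)) (A : Set (Fin n)) (u : A × A × A × Bool) (a : A) : Prop :=
  Allowed (nbrs G A) u.1 u.2.1 u.2.2.1 u.2.2.2 a

@[simp] theorem eval_placeE {env : List ℕ} {e f : Exp} : (placeE e f).eval n M env =
    e.eval n M env + e.eval n M env + f.eval n M env := rfl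

theorem eval_codeE (x y z : A) (k : Bool) :
    codeE.eval n M [ix x, ix y, ix z, k.toNat] = code (x, y, z, k) := by
  simp [codeE, code]

/-- Codes are positive by the final `+ 1`, which leaves `0` for a place without owner. -/
theorem elim_code_eq {o : Option (A × A × A × Bool)} {u : A × A × A × Bool} :
    o.elim 0 code = code u ↔ o = some u := by
  cases o with
  | none => simp [code]
  | some v => simp [code_injective.eq_iff]

open scoped Classical in
theorem tr_bid (h : Input G A M) (hs : HasSame G A M) {o : A × Bool → Option (A × A × A × Bool)}
    {d : A × Bool → ℕ} (hM : Holds M o d) (x y z : A) (k : Bool) (a : A) (j : Bool) :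
    Tr n M bidE [ix x, ix y, ix z, k.toNat, ix a, j.toNat] ↔
      Bid (n + n) Prod.fst (tokens (nbrs G A)) (okay G A) o d (x, y, z, k) (a, j) := by
  have h5 : ∀ (a : A) (j : Bool), M 5 (ix a + ix a + j.toNat) = (o (a, j)).elim 0 code :=
    fun a j => hM.owner (a, j)
  have h6 : ∀ (a : A) (j : Bool), M 6 (ix a + ix a + j.toNat) = d (a, j) :=
    fun a j => hM.price (a, j)
  simp only [bidE, tr_and, tr_not, eval_var,
    List.getD_cons_zero, List.getD_cons_succ, tr_app, List.map_cons, List.map_nil,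
    tr_token h hs, tr_allowed h hs, tr_exBool,
    h.exA (env := [ix x, ix y, ix z, k.toNat, ix a, j.toNat]) (i := 6) rfl,
    List.cons_append, List.nil_append, tr_eq, tr_lt, eval_read, eval_placeE, eval_app,
    eval_codeE, eval_add, eval_size, h5, h6, elim_code_eq]
  simp only [Bid, tokens, okay, Finset.mem_filter, Finset.mem_univ, true_and, not_exists,
    Prod.forall, not_and, not_lt, ne_eq]

end

end RAM

/-! ### Running the auction -/

namespace RAM

open Exp (var)

/-- Let every token make a bid. -/
def sweepCmd : Cmd :=
  .loop 1 0 <| .loop 1 0 <| .loop 1 0 <| .loop 0 2 <| .loop 1 0 <| .loop 0 2 <|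
  .ite (.and (.and (.and (.read 1 (var 2)) (.read 1 (var 3)))
      (.and (.read 1 (var 4)) (.read 1 (var 6))))
      (.app bidE [var 2, var 3, var 4, var 5, var 6, var 7]))
    (.seq (.store 5 (placeE (var 6) (var 7)) (.app codeE [var 2, var 3, var 4, var 5]))
      (.store 6 (placeE (var 6) (var 7)) (.add (.read 6 (placeE (var 6) (var 7))) (.const 1))))
    .skip

/-- The auction. -/
def auctionCmd : Cmd := .loop 2 1 (.loop 2 1 sweepCmd)

/-! ### Progress and termination of the auction -/

section

open scoped Classical

variable {n : ℕ} {G : SimpleGraph (Fin n)} {A : Set (Fin n)} {M M₀ : Mem}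

/-- The sum of the prices. -/
noncomputable def total (A : Set (Fin n)) (M : Mem) : ℕ := ∑ s : A × Bool, M 6 (place s)

/-- The invariant of the auction. -/
def AuctionInv (G : SimpleGraph (Fin n)) (A : Set (Fin n)) (M₀ M : Mem) : Prop :=
  (∀ a, a ≠ 5 → a ≠ 6 → M a = M₀ a) ∧ ∃ o d, Holds M o d ∧
    Auction (n + n) Prod.fst (tokens (nbrs G A)) (okay G A) o d

/-- Some token makes a bid. -/
def Bids (n : ℕ) (A : Set (Fin n)) (M : Mem) (x y z k a j : ℕ) : Prop :=
  ∃ x' y' z' a' : A, ix x' = x ∧ ix y' = y ∧ ix z' = z ∧ ix a' = a ∧ Tr n M bidE [x, y, z, k, a, j]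

/-- No token makes a bid. -/
def Final (n : ℕ) (A : Set (Fin n)) (M : Mem) : Prop :=
  ∀ x y z k a j, k < 2 → j < 2 → ¬ Bids n A M x y z k a j

/-- `M'` comes after `M` in the auction. -/
def After (G : SimpleGraph (Fin n)) (A : Set (Fin n)) (M₀ M M' : Mem) : Prop :=
  AuctionInv G A M₀ M →
    AuctionInv G A M₀ M' ∧ (M' = M ∨ total A M < total A M' ∧ ¬ Final n A M)

theorem After.refl (M : Mem) : After G A M₀ M M := fun h => ⟨h, Or.inl rfl⟩

theorem After.trans (M M' M'' : Mem) (h : After G A M₀ M M') (h' : After G A M₀ M' M'') :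
    After G A M₀ M M'' := by
  intro hM
  obtain ⟨h1, h2⟩ := h hM
  obtain ⟨h3, h4⟩ := h' h1
  refine ⟨h3, ?_⟩
  rcases h2 with rfl | h2
  · exact h4
  · rcases h4 with rfl | h4
    · exact Or.inr h2
    · exact Or.inr ⟨h2.1.trans h4.1, h2.2⟩

theorem Input.congr (h : Input G A M₀) (h0 : M 0 = M₀ 0) (h1 : M 1 = M₀ 1) : Input G A M :=
  ⟨by rw [h0]; exact h.adj, by rw [h1]; exact h.mem⟩

theorem HasSame.congr (h : HasSame G A M₀) (h4 : M 4 = M₀ 4) : HasSame G A M := by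
  rw [HasSame, h4]
  exact h

/-- The effect of a bid. -/
theorem after_bid (hI : Input G A M₀) (hs : HasSame G A M₀) (x y z : A) (k : Bool) (a : A)
    (j : Bool) (hb : Tr n M bidE [ix x, ix y, ix z, k.toNat, ix a, j.toNat]) :
    After G A M₀ M (Function.update (Function.update M 5
      (Function.update (M 5) (place (a, j)) (code (x, y, z, k)))) 6
      (Function.update (M 6) (place (a, j)) (M 6 (place (a, j)) + 1))) := by
  rintro ⟨hag, o, d, hM, hauc⟩
  have hbid := (tr_bid (hI.congr (hag 0 (by simp) (by simp)) (hag 1 (by simp) (by simp)))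
    (hs.congr (hag 4 (by simp) (by simp))) hM x y z k a j).1 hb
  have hd : ∀ s, Function.update d (a, j) (d (a, j) + 1) s =
      Function.update (M 6) (place (a, j)) (M 6 (place (a, j)) + 1) (place s) := by
    intro s
    by_cases hsj : s = (a, j)
    · subst hsj
      simp [hM.price]
    · simp [hsj, place_injective.eq_iff, hM.price]
  refine ⟨⟨fun b h5 h6 => by simp [h5, h6, hag b h5 h6],
    Function.update o (a, j) (some (x, y, z, k)),
    Function.update d (a, j) (d (a, j) + 1), ⟨fun s => ?_, fun s => ?_⟩,
    by convert hauc.update hbid⟩, Or.inr ⟨?_, ?_⟩⟩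
  · by_cases hsj : s = (a, j)
    · subst hsj
      simp
    · simp [hsj, place_injective.eq_iff, hM.owner]
  · simp [hd]
  · refine Finset.sum_lt_sum (fun s _ => ?_) ⟨(a, j), Finset.mem_univ _, ?_⟩
    · simp only [Function.update_self]
      rw [← hd, hM.price]
      by_cases hsj : s = (a, j)
      · subst hsj
        simp
      · simp [hsj]
    · simp
  · exact fun hF => hF _ _ _ _ _ _ k.toNat_lt j.toNat_lt ⟨x, y, z, a, rfl, rfl, rfl, rfl, hb⟩

/-- A sweep that changes nothing has tested every bid against the same memory, so none is possible;
any change raises the sum of the prices. The last clause keeps a finished auction finished during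
the remaining sweeps. -/
theorem exec_sweepCmd (hI : Input G A M₀) (hs : HasSame G A M₀) {i j : ℕ}
    (hinv : AuctionInv G A M₀ M) :
    AuctionInv G A M₀ (sweepCmd.exec n M [i, j]) ∧
      (Final n A (sweepCmd.exec n M [i, j]) ∨
        total A M < total A (sweepCmd.exec n M [i, j])) ∧
      (Final n A M → sweepCmd.exec n M [i, j] = M) := by
  -- The sum of the prices never falls and rises with each change, so if the memory is `M` again
  -- later, it was `M` in between.
  have hpers : ∀ {P : Prop} (M' M'' : Mem), After G A M₀ M M' → After G A M₀ M' M'' →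
      (M' = M → P) → (M'' = M → P) := by
    intro P M' M'' h h' hP he
    obtain ⟨h1, h2⟩ := h hinv
    obtain ⟨h3, h4⟩ := h' h1
    rcases h2 with h2 | h2
    · exact hP h2
    · subst he
      rcases h4 with h4 | h4
      · exact absurd h2.1 (h4 ▸ lt_irrefl _)
      · exact absurd (h2.1.trans h4.1) (lt_irrefl _)
  have key : After G A M₀ M (sweepCmd.exec n M [i, j]) ∧ ∀ x < 1 * n + 0, ∀ y < 1 * n + 0,
      ∀ z < 1 * n + 0, ∀ k < 0 * n + 2, ∀ a < 1 * n + 0, ∀ j' < 0 * n + 2,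
        sweepCmd.exec n M [i, j] = M → ¬ Bids n A M x y z k a j' := by
    refine exec_loop_mono (Q := fun x M' => ∀ y < 1 * n + 0,
      ∀ z < 1 * n + 0, ∀ k < 0 * n + 2, ∀ a < 1 * n + 0, ∀ j' < 0 * n + 2,
        M' = M → ¬ Bids n A M x y z k a j') After.refl After.trans
      (fun x M' M'' h h' hQ y hy z hz k hk a ha j hj =>
        hpers M' M'' h h' (hQ y hy z hz k hk a ha j hj)) fun x hx M1 hM1 => ?_
    refine exec_loop_mono (Q := fun y M' => 
      ∀ z < 1 * n + 0, ∀ k < 0 * n + 2, ∀ a < 1 * n + 0, ∀ j' < 0 * n + 2,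
        M' = M → ¬ Bids n A M x y z k a j') After.refl After.trans
      (fun y M' M'' h h' hQ z hz k hk a ha j hj =>
        hpers M' M'' (After.trans _ _ _ hM1 h) h' (hQ z hz k hk a ha j hj)) fun y hy M2 hM2 => ?_
    replace hM1 := After.trans _ _ _ hM1 hM2
    refine exec_loop_mono (Q := fun z M' => 
      ∀ k < 0 * n + 2, ∀ a < 1 * n + 0, ∀ j' < 0 * n + 2,
        M' = M → ¬ Bids n A M x y z k a j') After.refl After.trans
      (fun z M' M'' h h' hQ k hk a ha j hj =>
        hpers M' M'' (After.trans _ _ _ hM1 h) h' (hQ k hk a ha j hj)) fun z hz M3 hM3 => ?_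
    replace hM1 := After.trans _ _ _ hM1 hM3
    refine exec_loop_mono (Q := fun k M' => ∀ a < 1 * n + 0, ∀ j' < 0 * n + 2,
        M' = M → ¬ Bids n A M x y z k a j') After.refl After.trans
      (fun k M' M'' h h' hQ a ha j hj =>
        hpers M' M'' (After.trans _ _ _ hM1 h) h' (hQ a ha j hj)) fun k hk M4 hM4 => ?_
    replace hM1 := After.trans _ _ _ hM1 hM4
    refine exec_loop_mono (Q := fun a M' => ∀ j' < 0 * n + 2,
        M' = M → ¬ Bids n A M x y z k a j') After.refl After.trans
      (fun a M' M'' h h' hQ j hj =>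
        hpers M' M'' (After.trans _ _ _ hM1 h) h' (hQ j hj)) fun a ha M5 hM5 => ?_
    replace hM1 := After.trans _ _ _ hM1 hM5
    refine exec_loop_mono (Q := fun j' M' => M' = M → ¬ Bids n A M x y z k a j')
      After.refl After.trans
      (fun j M' M'' h h' hQ =>
        hpers M' M'' (After.trans _ _ _ hM1 h) h' hQ) fun j' hj' M6 hM6 => ?_
    replace hM1 := After.trans _ _ _ hM1 hM6
    clear hM2 hM3 hM4 hM5 hM6 M2 M3 M4 M5
    have hI6 : Input G A M6 := by
      have := (hM1 hinv).1.1
      exact hI.congr (this 0 (by simp) (by simp)) (this 1 (by simp) (by simp))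
    have hb : Tr n M6 (.and (.and (.and (.read 1 (var 2)) (.read 1 (var 3)))
        (.and (.read 1 (var 4)) (.read 1 (var 6))))
        (.app bidE [var 2, var 3, var 4, var 5, var 6, var 7]))
        ([i, j] ++ [x] ++ [y] ++ [z] ++ [k] ++ [a] ++ [j']) ↔ Bids n A M6 x y z k a j' := by
      have hm : ∀ x < n, M6 1 x ≠ 0 ↔ ∃ a : A, ix a = x := by
        intro x hx
        rw [hI6.mem ⟨x, hx⟩]
        exact ⟨fun h => ⟨⟨_, h⟩, rfl⟩, fun ⟨a, ha⟩ => by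
          have : (⟨x, hx⟩ : Fin n) = a := Fin.ext ha.symm
          exact this ▸ a.2⟩
      simp only [tr_and, tr_read, eval_var, tr_app, List.map_cons, List.map_nil,
        List.getD_cons_zero, List.getD_cons_succ, List.cons_append, List.nil_append,
        hm x (by omega), hm y (by omega), hm z (by omega), hm a (by omega), Bids]
      tauto
    rw [Cmd.exec]
    simp only [← Tr.eq_def, hb]
    by_cases hc : Bids n A M6 x y z k a j'
    · rw [if_pos hc]
      obtain ⟨x, y, z, a, rfl, rfl, rfl, rfl, hc⟩ := hc
      obtain ⟨k, rfl⟩ : ∃ b : Bool, b.toNat = k := by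
        obtain rfl | rfl : k = 0 ∨ k = 1 := by omega
        · exact ⟨false, rfl⟩
        · exact ⟨true, rfl⟩
      obtain ⟨j', rfl⟩ : ∃ b : Bool, b.toNat = j' := by
        obtain rfl | rfl : j' = 0 ∨ j' = 1 := by omega
        · exact ⟨false, rfl⟩
        · exact ⟨true, rfl⟩
      have haft := after_bid hI hs x y z k a j' hc
      have he : (Cmd.seq
          (.store 5 (placeE (var 6) (var 7)) (.app codeE [var 2, var 3, var 4, var 5]))
          (.store 6 (placeE (var 6) (var 7))
            (.add (.read 6 (placeE (var 6) (var 7))) (.const 1)))).exec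
          n M6 ([i, j] ++ [ix x] ++ [ix y] ++ [ix z] ++ [k.toNat] ++ [ix a] ++ [j'.toNat]) =
          Function.update (Function.update M6 5
          (Function.update (M6 5) (place (a, j')) (code (x, y, z, k)))) 6
          (Function.update (M6 6) (place (a, j')) (M6 6 (place (a, j')) + 1)) := by
        simp [Cmd.exec, eval_codeE, place]
      rw [he]
      refine ⟨haft, fun heM => ?_⟩
      exfalso
      obtain ⟨hinv6, h6⟩ := hM1 hinv
      obtain ⟨-, h7⟩ := haft hinv6
      rw [heM] at h7
      have hlt : total A M6 < total A M := by
        rcases h7 with h7 | h7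
        · have h8 := congrFun (congrFun (heM.trans h7) 6) (place (a, j'))
          simp at h8
        · exact h7.1
      rcases h6 with h6 | h6
      · exact absurd hlt (h6 ▸ lt_irrefl _)
      · exact lt_asymm hlt h6.1
    · rw [if_neg hc]
      refine ⟨After.refl _, ?_⟩
      rintro rfl
      exact hc
  obtain ⟨haft, hno⟩ := key
  obtain ⟨h1, h2⟩ := haft hinv
  refine ⟨h1, ?_, fun hF => h2.resolve_right fun h => h.2 hF⟩
  rcases h2 with h2 | h2
  · left
    rw [h2] at hno ⊢
    intro x y z k a j' hk hj hB
    obtain ⟨x, y, z, a, rfl, rfl, rfl, rfl, hb⟩ := id hB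
    have hx := ix_lt_size x
    have hy := ix_lt_size y
    have hz := ix_lt_size z
    have ha := ix_lt_size a
    exact hno _ (by omega) _ (by omega) _ (by omega) _ (by omega) _ (by omega) _ (by omega) rfl hB
  · exact Or.inr h2.1

theorem total_le (h : AuctionInv G A M₀ M) : total A M ≤ 2 * n * (n + n + 1) := by
  obtain ⟨-, o, d, hM, ha⟩ := h
  have h1 := ha.sum_le
  have h2 : Fintype.card A ≤ n := by simpa using set_fintype_card_le_univ A
  rw [Fintype.card_prod, Fintype.card_bool] at h1
  simp only [total, hM.price]
  exact h1.trans (Nat.mul_le_mul_right _ (by omega))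

/-- The sum of the prices is at most `2n (2n + 1)`, so among `(2n + 1)²` sweeps one must be idle.
Two nested loops are needed because each has only linearly many rounds. -/
theorem exec_auctionCmd (hI : Input G A M₀) (hs : HasSame G A M₀) (h5 : ∀ k, M₀ 5 k = 0)
    (h6 : ∀ k, M₀ 6 k = 0) :
    (∀ a, a ≠ 5 → a ≠ 6 → auctionCmd.exec n M₀ [] a = M₀ a) ∧ ∃ o d,
      (∀ s, auctionCmd.exec n M₀ [] 5 (place s) = (o s).elim 0 code) ∧
      Auction (n + n) Prod.fst (tokens (nbrs G A)) (okay G A) o d ∧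
      ∀ u s, ¬ Bid (n + n) Prod.fst (tokens (nbrs G A)) (okay G A) o d u s := by
  have h0 : AuctionInv G A M₀ M₀ := ⟨fun _ _ _ => rfl, fun _ => none, fun _ => 0,
    ⟨fun s => by simp [h5], fun s => by simp [h6]⟩,
    ⟨by simp, by simp, by simp, by simp, by simp⟩⟩
  have key : AuctionInv G A M₀ (auctionCmd.exec n M₀ []) ∧ (Final n A (auctionCmd.exec n M₀ []) ∨
      (2 * n + 1) * (2 * n + 1) ≤ total A (auctionCmd.exec n M₀ [])) := by
    refine exec_loop_induction (fun i M => AuctionInv G A M₀ M ∧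
      (Final n A M ∨ i * (2 * n + 1) ≤ total A M)) ⟨h0, Or.inr (by simp)⟩ ?_
    intro i _ M hM
    have := exec_loop_induction (n := n) (k := 2) (c := 1) (C := sweepCmd) (M := M)
      (env := [] ++ [i]) (fun j M => AuctionInv G A M₀ M ∧
      (Final n A M ∨ i * (2 * n + 1) + j ≤ total A M)) hM ?_
    · refine this.imp_right (Or.imp_right fun h => ?_)
      rw [add_mul, one_mul]
      exact h
    · rintro j - M ⟨h1, h2⟩
      obtain ⟨h3, h4, h5⟩ := exec_sweepCmd (i := i) (j := j) hI hs h1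
      refine ⟨h3, ?_⟩
      rcases h2 with h2 | h2
      · left
        change Final n A (sweepCmd.exec n M [i, j])
        rwa [h5 h2]
      · refine h4.imp_right fun h => ?_
        change _ ≤ total A (sweepCmd.exec n M [i, j])
        omega
  obtain ⟨h1, h2⟩ := key
  have hF : Final n A (auctionCmd.exec n M₀ []) := by
    refine h2.resolve_right fun h => ?_
    have := total_le h1
    nlinarith
  obtain ⟨hag, o, d, hM, ha⟩ := h1
  refine ⟨hag, o, d, hM.owner, ha, ?_⟩
  rintro ⟨x, y, z, k⟩ ⟨a, j⟩ hb
  refine hF _ _ _ _ _ _ k.toNat_lt j.toNat_lt ⟨x, y, z, a, rfl, rfl, rfl, rfl, ?_⟩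
  exact (tr_bid (hI.congr (hag 0 (by simp) (by simp)) (hag 1 (by simp) (by simp)))
    (hs.congr (hag 4 (by simp) (by simp))) hM x y z k a j).2 hb

end

end RAM

/-! ### Evaluating the output -/

namespace RAM

open Exp (var)

section

/-- The token has a place at a given vertex. -/
def ownE : Exp := .sum 0 2 (.eq (.read 5 (placeE (var 4) (var 5)))
  (.app codeE [var 0, var 1, var 2, var 3]))

/-- The position of a token. -/
def posE : Exp := .ite (.exA 4 ownE) (.theA 4 ownE) (var 2)

def hasFreeE : Exp :=
  .exA 3 <| .and (.app tokenE [var 0, var 1, var 3, .const 1])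
    (sameE (var 0) (var 1) (var 2) (.app posE [var 0, var 1, var 3, .const 1]))

def classRankE : Exp :=
  .countA 3 <| .and (.app repE [var 0, var 1, var 3]) <|
  .or (.and (.app hasFreeE [var 0, var 1, var 3]) (.not (.app hasFreeE [var 0, var 1, var 2])))
    (.and (.or (.and (.app hasFreeE [var 0, var 1, var 3]) (.app hasFreeE [var 0, var 1, var 2]))
      (.and (.not (.app hasFreeE [var 0, var 1, var 3]))
        (.not (.app hasFreeE [var 0, var 1, var 2])))) (.lt (var 3) (var 2)))

def repOfE : Exp :=
  .theA 3 <| .and (sameE (var 0) (var 1) (var 3) (var 2)) <| .not <| .exA 4 <|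
  .and (sameE (var 0) (var 1) (var 3) (var 4)) (.lt (var 4) (var 3))

/-- The rank of the class of a token of the second kind. -/
def posRankE : Exp :=
  .app classRankE [var 0, var 1,
    .app repOfE [var 0, var 1, .app posE [var 0, var 1, var 2, .const 1]]]

def freeRankE : Exp :=
  .countA 3 <| .and (.app tokenE [var 0, var 1, var 3, .const 1]) <|
  .or (.lt (.app posRankE [var 0, var 1, var 3]) (.app posRankE [var 0, var 1, var 2]))
    (.and (.eq (.app posRankE [var 0, var 1, var 3]) (.app posRankE [var 0, var 1, var 2]))
      (.lt (var 3) (var 2)))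

def edgeNoE : Exp :=
  .ite (var 3) (.add (.app freeRankE [var 0, var 1, var 2]) (.const 2)) <|
  .ite (.app classRankE [var 0, var 1, var 2]) (.app classRankE [var 0, var 1, var 2]) (.const 1)

def isUpperE : Exp := .or (var 3) (.not (.app classRankE [var 0, var 1, var 2]))

/-- Adjacency in the tree. -/
def joinE : Exp :=
  .and (.not (.eq (var 0) (var 1))) <| .exA 2 <| .exA 3 <| .exA 4 <| .sum 0 2 <| .exA 6 <|
  .sum 0 2 <|
  .and (.app tokenE [var 2, var 3, var 4, var 5]) <|
  .and (.app tokenE [var 2, var 3, var 6, var 7]) <|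
  .and (.eq (.app posE [var 2, var 3, var 4, var 5]) (var 0)) <|
  .and (.eq (.app posE [var 2, var 3, var 6, var 7]) (var 1)) <|
  .and (.eq (.app edgeNoE [var 2, var 3, var 4, var 5])
    (.app edgeNoE [var 2, var 3, var 6, var 7])) <|
  .or (.and (.app isUpperE [var 2, var 3, var 4, var 5])
      (.not (.app isUpperE [var 2, var 3, var 6, var 7])))
    (.and (.not (.app isUpperE [var 2, var 3, var 4, var 5]))
      (.app isUpperE [var 2, var 3, var 6, var 7]))

/-- Adjacency in the tree without a vertex. -/
def avoidE : Exp :=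
  .and (.read 1 (var 2)) <| .and (.read 1 (var 3)) <| .and (.app joinE [var 2, var 3]) <|
  .and (.not (.eq (var 2) (var 0))) (.not (.eq (var 3) (var 0)))

/-- A vertex of degree at most `1`. -/
def leafE : Exp := .lt (.countA 1 (.app joinE [var 0, var 1])) (.const 2)

def rootE : Exp :=
  .theA 0 <| .and leafE <| .not <| .exA 1 <| .and (.app leafE [var 1]) (.lt (var 1) (var 0))

def domE : Exp :=
  .or (.eq (var 0) (var 1)) (.not (.read 8 (.idx4 (var 0) (var 0) (.app rootE []) (var 1))))

def domSizeE : Exp := .countA 1 domE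

def heightLeE : Exp :=
  .or (.lt (.app domSizeE [var 0]) (.app domSizeE [var 1])) <|
  .and (.eq (.app domSizeE [var 0]) (.app domSizeE [var 1])) (.not (.lt (var 1) (var 0)))

def belowE : Exp :=
  .countA 1 <| .exA 2 <| .and
    (.or (.eq (var 0) (var 2)) (.and (.not (.read 1 (var 0))) (.adj (var 2) (var 0))))
    (.app heightLeE [var 1, var 2])

def keyE : Exp := .add (.add belowE belowE) (.ite (.read 1 (var 0)) (.const 0) (.const 1))

def positionE : Exp :=
  .count <| .or (.lt (.app keyE [var 1]) (.app keyE [var 0])) <|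
  .and (.eq (.app keyE [var 1]) (.app keyE [var 0])) (.lt (var 1) (var 0))

def bottomE : Exp := .not <| .exA 1 <| .and domE (.not (.eq (var 1) (var 0)))

def classE : Exp :=
  .ite (.read 1 (var 0)) (.add (.const 1) <| .countA 1 <| .and (.app bottomE [var 1]) <|
    .not <| .exA 2 <| .and (.and (.app bottomE [var 2]) (.app domE [var 0, var 2]))
      (.not (.lt (var 1) (var 2)))) (.const 0)

end

/-! ### Meaning of the formulas of the output -/

section

open scoped Classical

variable {n : ℕ} {G : SimpleGraph (Fin n)} {A : Set (Fin n)} {M : Mem}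
  {o : A × Bool → Option (A × A × A × Bool)}

/-- The position of a token, by default the vertex that it names. -/
noncomputable def posOf (o : A × Bool → Option (A × A × A × Bool)) (x y z : A) (k : Bool) : A :=
  if h : ∃ s, o s = some (x, y, z, k) then h.choose.1 else z

/-- The memory holds the placement of the tokens. -/
structure Placed (G : SimpleGraph (Fin n)) (A : Set (Fin n)) (M : Mem)
    (o : A × Bool → Option (A × A × A × Bool)) : Prop where
  input : Input G A M
  same : HasSame G A M
  owner : ∀ a j, M 5 (ix a + ix a + Bool.toNat j) = (o (a, j)).elim 0 code
  inj : ∀ s s' u, o s = some u → o s' = some u → s = s'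

theorem tr_own (h : Placed G A M o) (x y z : A) (k : Bool) (a : A) :
    Tr n M ownE [ix x, ix y, ix z, k.toNat, ix a] ↔ ∃ j, o (a, j) = some (x, y, z, k) := by
  simp only [ownE, tr_exBool, tr_eq, eval_read, eval_placeE, eval_app, List.map_cons, List.map_nil,
    List.cons_append, List.nil_append, eval_var, List.getD_cons_zero, List.getD_cons_succ,
    eval_codeE, h.owner, elim_code_eq]

/-- A token owns at most one place, so its vertex is unique and can be picked out by `theA`. -/
theorem eval_pos (h : Placed G A M o) (x y z : A) (k : Bool) :
    posE.eval n M [ix x, ix y, ix z, k.toNat] = ix (posOf o x y z k) := by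
  have h1 : Tr n M (.exA 4 ownE) [ix x, ix y, ix z, k.toNat] ↔
      ∃ s, o s = some (x, y, z, k) := by
    rw [h.input.exA (env := [ix x, ix y, ix z, k.toNat]) (i := 4) rfl]
    simp only [List.cons_append, List.nil_append, tr_own h, Prod.exists]
  rw [posE, eval_ite, posOf]
  by_cases hs : ∃ s, o s = some (x, y, z, k)
  · rw [if_pos (h1.2 hs), dif_pos hs,
      h.input.theA (env := [ix x, ix y, ix z, k.toNat]) (i := 4) rfl hs.choose.1]
    intro b
    simp only [List.cons_append, List.nil_append, tr_own h]
    refine ⟨fun ⟨j, hj⟩ => ?_, fun hb => ⟨hs.choose.2, ?_⟩⟩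
    · rw [h.inj _ _ _ hs.choose_spec hj]
    · rw [hb]
      exact hs.choose_spec
  · rw [if_neg (mt h1.1 hs), dif_neg hs]
    rfl

theorem tr_token_one (h : Placed G A M o) (x y z : A) :
    Tr n M tokenE [ix x, ix y, ix z, 1] ↔ IsToken (nbrs G A) x y z true :=
  tr_token h.input h.same x y z true

theorem eval_pos_one (h : Placed G A M o) (x y z : A) :
    posE.eval n M [ix x, ix y, ix z, 1] = ix (posOf o x y z true) := eval_pos h x y z true

theorem tr_hasFree (h : Placed G A M o) (x y z : A) :
    Tr n M hasFreeE [ix x, ix y, ix z] ↔ HasFree (nbrs G A) (posOf o) x y z := by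
  rw [hasFreeE, h.input.exA (env := [ix x, ix y, ix z]) (i := 3) rfl]
  simp only [tr_and, tr_app, sameE, tr_read, eval_idx4, eval_app, List.map_cons, List.map_nil,
    List.cons_append, List.nil_append, eval_var, List.getD_cons_zero, List.getD_cons_succ,
    eval_const, tr_token_one h, eval_pos_one h, h.same.tr_map, HasFree]

theorem eval_classRank (h : Placed G A M o) (x y z : A) :
    classRankE.eval n M [ix x, ix y, ix z] = classRank (nbrs G A) (posOf o) x y z := by
  rw [classRankE, h.input.countA (env := [ix x, ix y, ix z]) (i := 3) rfl, classRank,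
    rankIn, reps, Finset.filter_filter]
  congr 1
  ext w
  simp only [tr_and, tr_or, tr_not, tr_lt, tr_app, List.map_cons, List.map_nil,
    List.cons_append, List.nil_append, eval_var, List.getD_cons_zero, List.getD_cons_succ,
    tr_rep h.input h.same, tr_hasFree h, ix_lt, Finset.mem_filter, Finset.mem_univ, true_and,
    Prod.Lex.toLex_lt_toLex]
  refine and_congr_right fun _ => ?_
  by_cases h1 : HasFree (nbrs G A) (posOf o) x y w <;>
    by_cases h2 : HasFree (nbrs G A) (posOf o) x y z <;> simp [h1, h2]

theorem tr_classRank (h : Placed G A M o) (x y z : A) :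
    Tr n M classRankE [ix x, ix y, ix z] ↔ classRank (nbrs G A) (posOf o) x y z ≠ 0 := by
  rw [Tr, eval_classRank h]

theorem eval_repOf (h : Placed G A M o) (x y a : A) :
    repOfE.eval n M [ix x, ix y, ix a] = ix (repOf (nbrs G A) (nbrs G A x ∩ nbrs G A y) a) := by
  refine h.input.theA rfl _ fun b => ?_
  simp only [tr_and, tr_not, sameE, tr_read, eval_idx4, List.cons_append, List.nil_append,
    eval_var, List.getD_cons_zero, List.getD_cons_succ, h.same.tr_map,
    h.input.exA (env := [ix x, ix y, ix a, ix b]) (i := 4) rfl, tr_lt, ix_lt, not_exists, not_and,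
    not_lt]
  constructor
  · rintro ⟨h1, h2⟩
    exact le_antisymm (h2 _ (h1.trans (same_repOf _ a)))
      (Finset.min'_le _ _ (by simpa using h1.symm))
  · rintro rfl
    exact ⟨(same_repOf _ a).symm, fun w hw =>
      Finset.min'_le _ _ (by simpa using (same_repOf _ a).trans hw)⟩

theorem eval_posRank (h : Placed G A M o) (x y w : A) :
    posRankE.eval n M [ix x, ix y, ix w] = classRank (nbrs G A) (posOf o) x y
      (repOf (nbrs G A) (nbrs G A x ∩ nbrs G A y) (posOf o x y w true)) := by
  simp only [posRankE, eval_app, List.map_cons, List.map_nil, eval_var, List.getD_cons_zero,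
    List.getD_cons_succ, eval_const, eval_pos_one h, eval_repOf h, eval_classRank h]

theorem eval_freeRank (h : Placed G A M o) (x y z : A) :
    freeRankE.eval n M [ix x, ix y, ix z] = freeRank (nbrs G A) (posOf o) x y z := by
  rw [freeRankE, h.input.countA (env := [ix x, ix y, ix z]) (i := 3) rfl, freeRank,
    rankIn, frees, Finset.filter_filter]
  congr 1
  ext w
  simp only [tr_and, tr_or, tr_eq, tr_lt, tr_app, eval_app, List.map_cons, List.map_nil,
    List.cons_append, List.nil_append, eval_var, List.getD_cons_zero, List.getD_cons_succ,
    eval_const, tr_token_one h, eval_posRank h, ix_lt, Finset.mem_filter, Finset.mem_univ,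
    true_and, Prod.Lex.toLex_lt_toLex]

theorem eval_edgeNo (h : Placed G A M o) (x y z : A) (k : Bool) :
    edgeNoE.eval n M [ix x, ix y, ix z, k.toNat] = edgeNo (nbrs G A) (posOf o) x y z k := by
  simp only [edgeNoE, eval_ite, tr_var, tr_app, tr_classRank h, eval_app, eval_add,
    List.map_cons, List.map_nil, eval_var, List.getD_cons_zero, List.getD_cons_succ, eval_const,
    eval_classRank h,
    eval_freeRank h, edgeNo]
  cases k
  · simp only [Bool.toNat_false, ne_eq, not_true_eq_false, if_false, Bool.false_eq_true]
    split_ifs <;> omega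
  · simp

theorem tr_isUpper (h : Placed G A M o) (x y z : A) (k : Bool) :
    Tr n M isUpperE [ix x, ix y, ix z, k.toNat] ↔ IsUpper (nbrs G A) (posOf o) x y z k := by
  simp only [isUpperE, tr_or, tr_not, tr_var, tr_app, List.map_cons, List.map_nil,
    eval_var, List.getD_cons_zero, List.getD_cons_succ, tr_classRank h, IsUpper]
  cases k <;> simp

theorem tr_join (h : Placed G A M o) (p q : A) :
    Tr n M joinE [ix p, ix q] ↔ (joinGraph (nbrs G A) (posOf o)).Adj p q := by
  simp only [joinE, tr_and, tr_not, tr_eq, eval_var, List.getD_cons_zero, List.getD_cons_succ,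
    ix_inj, h.input.exA (env := [ix p, ix q]) (i := 2) rfl, List.cons_append, List.nil_append]
  simp only [h.input.exA (env := [ix p, ix q, _]) (i := 3) rfl, List.cons_append, List.nil_append]
  simp only [h.input.exA (env := [ix p, ix q, _, _]) (i := 4) rfl, List.cons_append,
    List.nil_append, tr_exBool]
  simp only [h.input.exA (env := [ix p, ix q, _, _, _, _]) (i := 6) rfl, List.cons_append,
    List.nil_append, tr_exBool, tr_and, tr_or, tr_not, tr_app, tr_eq, eval_app, List.map_cons,
    List.map_nil, eval_var, List.getD_cons_zero, List.getD_cons_succ, eval_pos h, eval_edgeNo h,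
    tr_isUpper h, tr_token h.input h.same, ix_inj]
  have hx : ∀ P Q : Prop, (P ∧ ¬ Q ∨ ¬ P ∧ Q) ↔ (P ↔ ¬ Q) := fun P Q => by tauto
  simp only [hx]
  rfl

/-- The first parameter names the deleted vertex. The second is idle; it is there because the
reachability table is indexed by two. -/
theorem tr_avoid (h : Placed G A M o) (x y : A) (c t : ℕ) (hc : c < n) (ht : t < n) :
    Tr n M avoidE [ix x, ix y, c, t] ↔ ∃ a b : A, ix a = c ∧ ix b = t ∧
      (avoid (joinGraph (nbrs G A) (posOf o)) x).Adj a b := by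
  have key : ∀ a b : A, Tr n M avoidE [ix x, ix y, ix a, ix b] ↔
      (avoid (joinGraph (nbrs G A) (posOf o)) x).Adj a b := by
    intro a b
    have ha : M 1 (ix a) ≠ 0 := (h.input.mem a).2 a.2
    have hb : M 1 (ix b) ≠ 0 := (h.input.mem b).2 b.2
    simp only [avoidE, tr_and, tr_read, eval_var, List.getD_cons_zero, List.getD_cons_succ, ha, hb,
      true_and, tr_not, tr_eq, ix_inj, tr_app, List.map_cons, List.map_nil, tr_join h, avoid,
      ne_eq, not_false_eq_true]
  constructor
  · intro hT
    have h1 : M 1 c ≠ 0 ∧ M 1 t ≠ 0 := by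
      simp only [avoidE, tr_and, tr_read, eval_var, List.getD_cons_zero, List.getD_cons_succ] at hT
      exact ⟨hT.1, hT.2.1⟩
    have hcA := (h.input.mem ⟨c, hc⟩).1 h1.1
    have htA := (h.input.mem ⟨t, ht⟩).1 h1.2
    exact ⟨⟨_, hcA⟩, ⟨_, htA⟩, rfl, rfl, (key ⟨_, hcA⟩ ⟨_, htA⟩).1 hT⟩
  · rintro ⟨a, b, rfl, rfl, hab⟩
    exact (key a b).2 hab

/-- The memory holds the tree, with root `r`. -/
structure Rooted (G : SimpleGraph (Fin n)) (A : Set (Fin n)) (M : Mem)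
    (o : A × Bool → Option (A × A × A × Bool)) (r : A) : Prop extends Placed G A M o where
  reach : ∀ x y a b : A, M 8 (quad n (ix x) (ix y) (ix a) (ix b)) ≠ 0 ↔
    (avoid (joinGraph (nbrs G A) (posOf o)) x).Reachable a b
  leaf : (joinGraph (nbrs G A) (posOf o)).degree r ≤ 1
  first : ∀ b, (joinGraph (nbrs G A) (posOf o)).degree b ≤ 1 → r ≤ b

variable {r : A}

theorem tr_leaf (h : Placed G A M o) (a : A) :
    Tr n M leafE [ix a] ↔ (joinGraph (nbrs G A) (posOf o)).degree a ≤ 1 := by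
  rw [leafE, tr_lt, h.input.countA (env := [ix a]) (i := 1) rfl, eval_const, Nat.lt_succ_iff,
    ← SimpleGraph.card_neighborFinset_eq_degree]
  simp only [tr_app, List.cons_append, List.nil_append, List.map_cons, List.map_nil, eval_var,
    List.getD_cons_zero, List.getD_cons_succ, tr_join h]
  rw [SimpleGraph.neighborFinset_eq_filter]

theorem eval_root (h : Rooted G A M o r) : rootE.eval n M [] = ix r := by
  refine h.input.theA rfl _ fun b => ?_
  simp only [tr_and, tr_not, tr_app, List.cons_append, List.nil_append, List.map_cons,
    List.map_nil, eval_var, List.getD_cons_zero, List.getD_cons_succ, tr_leaf h.toPlaced,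
    h.input.exA (env := [ix b]) (i := 1) rfl, tr_lt, ix_lt, not_exists, not_and, not_lt]
  constructor
  · rintro ⟨h1, h2⟩
    exact le_antisymm (h2 _ h.leaf) (h.first _ h1)
  · rintro rfl
    exact ⟨h.leaf, h.first⟩

theorem tr_dom (h : Rooted G A M o r) (a x : A) :
    Tr n M domE [ix a, ix x] ↔ Dom (joinGraph (nbrs G A) (posOf o)) r a x := by
  rw [dom_iff_avoid]
  simp only [domE, tr_or, tr_eq, tr_not, tr_read, eval_idx4, eval_app, List.map_nil, eval_root h,
    eval_var, List.getD_cons_zero, List.getD_cons_succ, ix_inj]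
  rw [h.reach]

theorem eval_domSize (h : Rooted G A M o r) (a : A) :
    domSizeE.eval n M [ix a] = domSize (joinGraph (nbrs G A) (posOf o)) r a := by
  rw [domSizeE, h.input.countA (env := [ix a]) (i := 1) rfl, domSize]
  simp only [List.cons_append, List.nil_append, tr_dom h]

theorem tr_heightLe (h : Rooted G A M o r) (a b : A) :
    Tr n M heightLeE [ix a, ix b] ↔ height A (joinGraph (nbrs G A) (posOf o)) r a ≤
      height A (joinGraph (nbrs G A) (posOf o)) r b := by
  simp only [heightLeE, tr_or, tr_and, tr_not, tr_lt, tr_eq, eval_app, List.map_cons, List.map_nil,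
    eval_var, List.getD_cons_zero, List.getD_cons_succ, eval_domSize h, ix_lt, not_lt, height,
    Prod.Lex.toLex_le_toLex]

theorem eval_key (h : Rooted G A M o r) (v : Fin n) :
    keyE.eval n M [(v : ℕ)] = orderKey G A (joinGraph (nbrs G A) (posOf o)) r v := by
  have h1 : belowE.eval n M [(v : ℕ)] = (Finset.univ.filter fun a : A => ∃ b ∈ anchors G A v,
      height A (joinGraph (nbrs G A) (posOf o)) r a ≤
        height A (joinGraph (nbrs G A) (posOf o)) r b).card := by
    rw [belowE, h.input.countA (env := [(v : ℕ)]) (i := 1) rfl]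
    congr 1
    ext a
    have h2 : ∀ b : A, Tr n M (.adj (var 2) (var 0)) [(v : ℕ), ix a, ix b] ↔ G.Adj v b :=
      fun b => (h.input.adj_ix rfl rfl).trans (G.adj_comm _ _)
    have h3 : ∀ b : A, (v : ℕ) = ix b ↔ v = b := fun b => Fin.val_inj
    have h4 : ∀ b : A, (v = b ∨ v ∉ A ∧ G.Adj v b) ↔ b ∈ anchors G A v := fun b => Iff.rfl
    simp only [List.cons_append, List.nil_append, h.input.exA (env := [(v : ℕ), ix a]) (i := 2) rfl,
      tr_and, tr_or, tr_not, tr_eq, tr_read, tr_app, List.map_cons, List.map_nil, eval_var,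
      List.getD_cons_zero, List.getD_cons_succ, tr_heightLe h, h2, h3, h.input.mem, h4,
      Finset.mem_filter, Finset.mem_univ, true_and]
  simp only [keyE, eval_add, h1, eval_ite, tr_read, eval_var, List.getD_cons_zero, h.input.mem,
    eval_const, orderKey, two_mul]

theorem eval_position (h : Rooted G A M o r) (v : Fin n) :
    positionE.eval n M [(v : ℕ)] = position G A (joinGraph (nbrs G A) (posOf o)) r v := by
  rw [positionE, eval_count, position, rankIn]
  simp only [List.cons_append, List.nil_append, tr_or, tr_and, tr_lt, tr_eq, eval_app,
    List.map_cons, List.map_nil, eval_var, List.getD_cons_zero, List.getD_cons_succ, eval_key h,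
    Fin.val_fin_lt, Prod.Lex.toLex_lt_toLex]

theorem tr_bottom (h : Rooted G A M o r) (a : A) :
    Tr n M bottomE [ix a] ↔ IsBottom (joinGraph (nbrs G A) (posOf o)) r a := by
  simp only [bottomE, tr_not, h.input.exA (env := [ix a]) (i := 1) rfl, List.cons_append,
    List.nil_append, tr_and, tr_dom h, tr_eq, eval_var, List.getD_cons_zero, List.getD_cons_succ,
    ix_inj, not_exists, not_and, not_not, IsBottom]

theorem eval_class (h : Rooted G A M o r) (v : Fin n) :
    classE.eval n M [(v : ℕ)] = classOf A (joinGraph (nbrs G A) (posOf o)) r v := by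
  simp only [classE, eval_ite, tr_read, eval_var, List.getD_cons_zero, h.input.mem, classOf,
    eval_const, eval_add, h.input.countA (env := [(v : ℕ)]) (i := 1) rfl]
  by_cases hv : v ∈ A
  · have h2 : (v : ℕ) = ix (⟨v, hv⟩ : A) := rfl
    rw [if_pos hv, dif_pos hv, h2]
    congr 2
    ext l
    simp only [List.cons_append, List.nil_append, tr_and, tr_not, tr_lt, tr_app, List.map_cons,
      List.map_nil, eval_var, List.getD_cons_zero, List.getD_cons_succ, tr_bottom h, tr_dom h,
      h.input.exA (env := [ix (⟨v, hv⟩ : A), ix l]) (i := 2) rfl, ix_lt, not_exists, not_and,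
      not_not, and_imp, Finset.mem_filter, Finset.mem_univ, true_and]
  · rw [if_neg hv, dif_neg hv]

end

end RAM

/-! ### Degrees -/

section Degrees

open scoped Classical

variable {α : Type*} [Fintype α] {T : SimpleGraph α}

theorem SimpleGraph.IsTree.exists_degree_le_one (hT : T.IsTree) : ∃ a, T.degree a ≤ 1 := by
  by_contra! h
  have h1 := T.sum_degrees_eq_twice_card_edges
  have h2 := hT.card_edgeFinset
  have h3 : ∑ _a : α, 2 ≤ ∑ a, T.degree a := Finset.sum_le_sum fun a _ => h a
  rw [Finset.sum_const, smul_eq_mul, Finset.card_univ] at h3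
  omega

/-- Truncated subtraction leaves only the vertices of degree at least 3: at most `t` of them, each
contributing at most `Δ - 2`. -/
theorem IsTDeltaTree.sum_degree_le {t Δ : ℕ} (h : IsTDeltaTree t Δ T) :
    ∑ a, (T.degree a - 2) ≤ t * (Δ - 2) := by
  have henc : ∀ a, (T.neighborSet a).encard = T.degree a := fun a => by
    rw [← T.card_neighborFinset_eq_degree, ← Set.encard_coe_eq_coe_finsetCard,
      SimpleGraph.coe_neighborFinset]
  have h1 : ∀ a, T.degree a ≤ Δ := fun a => by
    have := h.degree_le a
    rw [henc] at this
    exact_mod_cast this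
  have h2 : (Finset.univ.filter fun a => 3 ≤ T.degree a).card ≤ t := by
    have := h.branching_le
    simp only [henc] at this
    rw [← Nat.cast_le (α := ℕ∞), ← Set.encard_coe_eq_coe_finsetCard]
    refine (Set.encard_le_encard fun a ha => ?_).trans this
    simp only [Finset.coe_filter, Finset.mem_univ, true_and, Set.mem_ofPred_eq] at ha ⊢
    exact_mod_cast ha
  rw [← Finset.sum_subset (Finset.subset_univ (Finset.univ.filter fun a => 3 ≤ T.degree a))]
  · refine (Finset.sum_le_card_nsmul _ _ (Δ - 2) fun a _ => by have := h1 a; omega).trans ?_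
    exact Nat.mul_le_mul_right _ h2
  · intro a _ ha
    simp only [Finset.mem_filter, Finset.mem_univ, true_and] at ha
    omega

/-- At most `1 + m` leaves below the root, and the class of the vertices outside `A`. -/
theorem classOf_lt {V : Type*} [Fintype V] [LinearOrder V] {A : Set V} {T : SimpleGraph A} {r : A}
    (hT : T.IsTree) (hr : T.degree r ≤ 1) {m : ℕ} (hm : ∑ a, (T.degree a - 2) ≤ m) (v : V) :
    classOf A T r v < 2 + m := by
  have h1 := classOf_le hT.connected (r := r) v
  have h2 := card_isBottom_le hT hr
  omega

theorem thinness_le {V : Type*} [Finite V] {t Δ : ℕ} {G : SimpleGraph V} {A B : Set V}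
    (h : IsTDeltaTreeConvex t Δ G A B) : thinness G ≤ 2 + t * (Δ - 2) := by
  have := Fintype.ofFinite V
  let e := Fintype.equivFin V
  -- Any linear order will do; it only breaks ties in the ordering and selects the first leaf.
  let : LinearOrder V := LinearOrder.lift' e e.injective
  obtain ⟨T, hT, hsupp⟩ := h.support
  obtain ⟨r, hr⟩ := hT.isTree.exists_degree_le_one
  obtain ⟨v, c, hvc, -⟩ := exists_isConsistent h.bipartite h.cover hT.isTree hsupp
    (Nat.card_eq_fintype_card (α := V)).symm (classOf_lt hT.isTree hr hT.sum_degree_le)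
  exact Nat.sInf_le ⟨v, c, hvc⟩

end Degrees

namespace RAM

open Exp (var)

/-! ### The whole algorithm -/

/-- Compute an ordering and a partition. -/
def mainCmd : Cmd :=
  .seq (closureCmd 4 clsE) <| .seq auctionCmd <| .seq (closureCmd 8 avoidE) <|
  .seq (.loop 1 0 (.store 2 positionE (var 0))) (.loop 1 0 (.store 3 (var 0) classE))

/-- Since the indices are distinct, no store is overwritten, and since neither formula depends on
the array being written, all are evaluated as at the start. -/
theorem exec_loop_store {n arr : ℕ} {e f : Exp} {M₀ : Mem} {i v : Fin n → ℕ}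
    (hi : Function.Injective i)
    (h : ∀ M, (∀ a ≠ arr, M a = M₀ a) → ∀ x : Fin n,
      e.eval n M [(x : ℕ)] = i x ∧ f.eval n M [(x : ℕ)] = v x) :
    (∀ a ≠ arr, (Cmd.loop 1 0 (.store arr e f)).exec n M₀ [] a = M₀ a) ∧
      ∀ x, (Cmd.loop 1 0 (.store arr e f)).exec n M₀ [] arr (i x) = v x := by
  have := exec_loop_induction (n := n) (k := 1) (c := 0) (C := .store arr e f) (M := M₀)
    (env := []) (fun j M => (∀ a ≠ arr, M a = M₀ a) ∧ ∀ x : Fin n, (x : ℕ) < j → M arr (i x) = v x)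
    ⟨fun _ _ => rfl, by simp⟩ ?_
  · exact ⟨this.1, fun x => this.2 x (by omega)⟩
  · rintro j hj M ⟨h1, h2⟩
    obtain ⟨he, hf⟩ := h M h1 ⟨j, by omega⟩
    simp only [Cmd.exec, List.nil_append, he, hf]
    refine ⟨fun a ha => by simp [ha, h1 a ha], fun x hx => ?_⟩
    by_cases hxj : x = ⟨j, by omega⟩
    · simp [hxj]
    · have : (x : ℕ) ≠ j := fun h' => hxj (Fin.ext h')
      simp [hi.eq_iff, hxj, h2 x (by omega)]

/-! ### Correctness of the algorithm -/

section

open scoped Classical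

variable {n : ℕ} {G : SimpleGraph (Fin n)} {A B : Set (Fin n)}

theorem input_inputState : Input G A (inputState G A).arr where
  adj i j := by
    have : (∃ i' j' : Fin n, G.Adj i' j' ∧ (i : ℕ) * n + j = i' * n + j') ↔ G.Adj i j := by
      constructor
      · rintro ⟨i', j', h, he⟩
        obtain ⟨h1, h2⟩ := pair_inj j.2 j'.2 he
        rwa [Fin.ext h1, Fin.ext h2]
      · exact fun h => ⟨i, j, h, rfl⟩
    simp [inputState, this]
  mem i := by simp [inputState, Fin.val_inj]

theorem inputState_arr (a : ℕ) (ha : 2 ≤ a) (k : ℕ) : (inputState G A).arr a k = 0 := by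
  have h0 : a ≠ 0 := by omega
  have h1 : a ≠ 1 := by omega
  simp [inputState, h0, h1]

variable {o : A × Bool → Option (A × A × A × Bool)} {d : A × Bool → ℕ}

theorem allowed_posOf (h : Auction (n + n) Prod.fst (tokens (nbrs G A)) (okay G A) o d)
    (x y z : A) (k : Bool) (hz : IsToken (nbrs G A) x y z k) :
    Allowed (nbrs G A) x y z k (posOf o x y z k) := by
  rw [posOf]
  split_ifs with hs
  · exact (h.mem _ _ hs.choose_spec).2
  · rw [Allowed]
    split_ifs
    · exact hz.2.1.1
    · exact Same.refl z

/-- At most two of the tokens on `a` own a place there, so any further ones are unplaced tokens that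
lie on `a` by default. -/
theorem sum_degree_joinGraph_le :
    ∑ a, ((joinGraph (nbrs G A) (posOf o)).degree a - 2) ≤
      ((tokens (nbrs G A)).filter fun u => ∀ s, o s ≠ some u).card := by
  rw [Finset.card_eq_sum_card_fiberwise (t := Finset.univ)
    (f := fun u : A × A × A × Bool => posOf o u.1 u.2.1 u.2.2.1 u.2.2.2) (by simp)]
  refine Finset.sum_le_sum fun a _ => ?_
  have h1 : (joinGraph (nbrs G A) (posOf o)).degree a ≤
      ((tokens (nbrs G A)).filter fun u => posOf o u.1 u.2.1 u.2.2.1 u.2.2.2 = a).card := by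
    convert degree_joinGraph_le (N := nbrs G A) (pos := posOf o) a
  have h2 : ((tokens (nbrs G A)).filter fun u => posOf o u.1 u.2.1 u.2.2.1 u.2.2.2 = a) ⊆
      (((tokens (nbrs G A)).filter fun u => ∀ s, o s ≠ some u).filter
        fun u => posOf o u.1 u.2.1 u.2.2.1 u.2.2.2 = a) ∪
      Finset.univ.biUnion fun j : Bool => (o (a, j)).toFinset := by
    intro u hu
    simp only [Finset.mem_filter, Finset.mem_union, Finset.mem_biUnion, Finset.mem_univ,
      true_and, Option.mem_toFinset, Option.mem_def] at hu ⊢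
    by_cases hs : ∃ s, o s = some u
    · right
      have hc : o hs.choose = some u := hs.choose_spec
      have ha : hs.choose.1 = a := by
        rw [← hu.2, posOf, dif_pos hs]
      exact ⟨hs.choose.2, by rw [← ha]; exact hc⟩
    · left
      push Not at hs
      exact ⟨⟨hu.1, hs⟩, hu.2⟩
  have h3 : (Finset.univ.biUnion fun j : Bool => (o (a, j)).toFinset).card ≤ 2 := by
    refine Finset.card_biUnion_le.trans ?_
    refine (Finset.sum_le_card_nsmul _ _ 1 fun j _ => ?_).trans (by simp)
    cases o (a, j) <;> simp
  have h4 := (Finset.card_le_card h2).trans (Finset.card_union_le _ _)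
  omega

/-- The unknown tree `T` enters only here, as the rival placement against which the auction is
compared; the algorithm never sees it. -/
theorem card_unplaced_le
    (h : Auction (n + n) Prod.fst (tokens (nbrs G A)) (okay G A) o d)
    (hend : ∀ u s, ¬ Bid (n + n) Prod.fst (tokens (nbrs G A)) (okay G A) o d u s)
    {T : SimpleGraph A} (hT : ∀ S, (T.induce {a | S ⊆ nbrs G A a}).Preconnected) :
    ((tokens (nbrs G A)).filter fun u => ∀ s, o s ≠ some u).card ≤ ∑ a, (T.degree a - 2) := by
  obtain ⟨g, hg, hgT⟩ := exists_placement hT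
  have hcard : Fintype.card (A × Bool) ≤ n + n := by
    have h2 : Fintype.card A ≤ n := by simpa using set_fintype_card_le_univ A
    rw [Fintype.card_prod, Fintype.card_bool]
    omega
  have hvert : ∀ a, (Finset.univ.filter fun s : A × Bool => s.1 = a).card = 2 := by
    intro a
    have : (Finset.univ.filter fun s : A × Bool => s.1 = a) = {a} ×ˢ Finset.univ := by
      ext s
      simp only [Finset.mem_filter, Finset.mem_univ, true_and, Finset.mem_product,
        Finset.mem_singleton, and_true]
    rw [this, Finset.card_product]
    simp
  have := h.card_unplaced_le hcard hend (c := 2) (g := g) (D := fun a => T.degree a)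
    (by convert hvert) hg (by convert hgT)
  convert this

/-- The result of the algorithm on a tree convex graph. -/
theorem exec_mainCmd {t Δ : ℕ} (h : IsTDeltaTreeConvex t Δ G A B) :
    ∃ (v : Fin n ≃ Fin n) (c : Fin n → Fin (2 + t * (Δ - 2))), IsConsistent G v c ∧
      (∀ i : Fin n, mainCmd.exec n (inputState G A).arr [] 2 i = v i) ∧
      ∀ x : Fin n, mainCmd.exec n (inputState G A).arr [] 3 x = c x := by
  obtain ⟨T, hT, hsupp⟩ := h.support
  have hne : Nonempty A := hT.isTree.connected.nonempty
  have hsupp' : ∀ b, (T.induce {a : A | b ∈ nbrs G A a}).Preconnected := by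
    intro b
    by_cases hb : b ∈ B
    · have : {a : A | b ∈ nbrs G A a} = {a : A | G.Adj b a} := by
        ext a
        exact G.adj_comm _ _
      rw [this]
      exact hsupp b hb
    -- A vertex outside `B` has no neighbour in `A`, so its hyperedge is empty.
    · rintro ⟨a, ha⟩
      rcases h.bipartite.mem_of_adj ha with h' | h'
      · exact absurd h'.2 hb
      · exact absurd a.2 (Set.disjoint_right.1 h.bipartite.disjoint h'.1)
  have hpre := induce_iInter_preconnected hT.isTree (nbrs G A) hsupp'
  set M₀ := (inputState G A).arr with hM₀
  have hI₀ : Input G A M₀ := input_inputState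
  obtain ⟨hag1, hs1⟩ := exec_closureCmd (arr := 4) (e := clsE) (M₀ := M₀)
    (fun x y => clsGraph (nbrs G A) (nbrs G A x ∩ nbrs G A y)) (inputState_arr 4 (by omega))
    fun M hM => (hI₀.congr (hM 0 (by simp)) (hM 1 (by simp))).cls
  set M₁ := (closureCmd 4 clsE).exec n M₀ [] with hM₁
  have hI₁ : Input G A M₁ := hI₀.congr (hag1 0 (by simp)) (hag1 1 (by simp))
  obtain ⟨hag2, o, d, ho, hauc, hbid⟩ := exec_auctionCmd hI₁ hs1
    (fun k => by rw [hag1 5 (by simp)]; exact inputState_arr 5 (by omega) k)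
    (fun k => by rw [hag1 6 (by simp)]; exact inputState_arr 6 (by omega) k)
  set M₂ := auctionCmd.exec n M₁ [] with hM₂
  have hP₂ : ∀ M : Mem, M 0 = M₂ 0 → M 1 = M₂ 1 → M 4 = M₂ 4 → M 5 = M₂ 5 → Placed G A M o := by
    intro M h0 h1 h4 h5
    refine ⟨hI₁.congr (h0.trans (hag2 0 (by simp) (by simp)))
      (h1.trans (hag2 1 (by simp) (by simp))),
      HasSame.congr (M₀ := M₁) hs1 (h4.trans (hag2 4 (by simp) (by simp))), fun a j => ?_, hauc.inj⟩
    rw [h5]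
    exact ho (a, j)
  obtain ⟨hag3, hr3⟩ := exec_closureCmd (arr := 8) (e := avoidE) (M₀ := M₂)
    (fun x _ => avoid (joinGraph (nbrs G A) (posOf o)) x)
    (fun k => by
      rw [hag2 8 (by simp) (by simp), hag1 8 (by simp)]
      exact inputState_arr 8 (by omega) k)
    fun M hM => tr_avoid
      (hP₂ M (hM 0 (by simp)) (hM 1 (by simp)) (hM 4 (by simp)) (hM 5 (by simp)))
  set M₃ := (closureCmd 8 avoidE).exec n M₂ [] with hM₃
  have hpos := allowed_posOf hauc
  have hJ : (joinGraph (nbrs G A) (posOf o)).IsTree :=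
    joinGraph_isTree hpos (card_tokens_le hT.isTree hpre)
  obtain ⟨r, hr, hfirst⟩ : ∃ r, (joinGraph (nbrs G A) (posOf o)).degree r ≤ 1 ∧
      ∀ b, (joinGraph (nbrs G A) (posOf o)).degree b ≤ 1 → r ≤ b := by
    obtain ⟨r, hr, hmin⟩ := Finset.exists_min_image (Finset.univ.filter fun a =>
      (joinGraph (nbrs G A) (posOf o)).degree a ≤ 1) id
      (hJ.exists_degree_le_one.imp fun a ha => by simpa using ha)
    exact ⟨r, by simpa using hr, fun b hb => hmin b (by simpa using hb)⟩
  -- The output loops write only the arrays `2` and `3`, so the formulas keep their meaning while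
  -- the loops run.
  have hR : ∀ M : Mem, (∀ a, a ≠ 2 → a ≠ 3 → M a = M₃ a) → Rooted G A M o r := by
    intro M hM
    refine ⟨hP₂ M ((hM 0 (by simp) (by simp)).trans (hag3 0 (by simp)))
      ((hM 1 (by simp) (by simp)).trans (hag3 1 (by simp)))
      ((hM 4 (by simp) (by simp)).trans (hag3 4 (by simp)))
      ((hM 5 (by simp) (by simp)).trans (hag3 5 (by simp))), ?_, hr, hfirst⟩
    rw [hM 8 (by simp) (by simp)]
    exact hr3
  -- The computed tree need not be a (t, Δ)-tree; its excess is bounded by that of `T`, and this is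
  -- all that the number of classes depends on.
  have hdeg : ∑ a, ((joinGraph (nbrs G A) (posOf o)).degree a - 2) ≤ t * (Δ - 2) := by
    exact sum_degree_joinGraph_le.trans
      ((card_unplaced_le hauc hbid hpre).trans hT.sum_degree_le)
  obtain ⟨v, c, hvc, hv, hc⟩ := exists_isConsistent h.bipartite h.cover hJ
    (fun b _ => by
      have := joinGraph_preconnected hpos {b}
      have hset : {a : A | {b} ⊆ nbrs G A a} = {a : A | G.Adj b a} := by
        ext a
        simp [nbrs, G.adj_comm]
      rwa [hset] at this)
    (Fintype.card_fin n) (classOf_lt hJ hr hdeg)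
  -- The loop stores the vertex `x` at the index given by its position, which inverts the map from
  -- vertices to positions.
  obtain ⟨hag4, h4⟩ := exec_loop_store (arr := 2) (e := positionE) (f := var 0) (M₀ := M₃)
    (v := fun x => x) (position_injective (G := G) (T := joinGraph (nbrs G A) (posOf o)) (r := r))
    fun M hM x => ⟨eval_position (hR M fun a h2 _ => hM a h2) x, rfl⟩
  set M₄ := (Cmd.loop 1 0 (.store 2 positionE (var 0))).exec n M₃ [] with hM₄
  obtain ⟨hag5, h5⟩ := exec_loop_store (arr := 3) (e := var 0) (f := classE) (M₀ := M₄)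
    (i := fun x => x) (v := classOf A (joinGraph (nbrs G A) (posOf o)) r)
    Fin.val_injective
    fun M hM x => ⟨rfl, eval_class (hR M fun a h2 h3 => (hM a h3).trans (hag4 a h2)) x⟩
  refine ⟨v, c, hvc, fun i => ?_, fun x => ?_⟩
  · change (Cmd.loop 1 0 (.store 3 (var 0) classE)).exec n M₄ [] 2 i = v i
    rw [hag5 2 (by simp), ← h4 (v i), ← hv, Equiv.symm_apply_apply]
  · change (Cmd.loop 1 0 (.store 3 (var 0) classE)).exec n M₄ [] 3 x = c x
    rw [h5, hc]

end

end RAM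

theorem mainTheorem6 (t Δ : ℕ) (ht : 1 ≤ t) (hΔ : 3 ≤ Δ) :
    (∀ (V : Type*) [Finite V] (G : SimpleGraph V) (A B : Set V),
      IsTDeltaTreeConvex t Δ G A B → thinness G ≤ 2 + t * (Δ - 2)) ∧
    ∃ (P : RAM.Prog) (p : Polynomial ℕ),
      ∀ (n : ℕ) (G : SimpleGraph (Fin n)) (A B : Set (Fin n)), IsTDeltaTreeConvex t Δ G A B →
        ∃ (τ : RAM.State) (T : ℕ), RAM.Runs P (RAM.inputState G A) τ T ∧ T ≤ p.eval n ∧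
          ∃ (v : Fin n ≃ Fin n) (c : Fin n → Fin (2 + t * (Δ - 2))),
            IsConsistent G v c ∧ RAM.IsOutput τ v c := by
  refine ⟨fun V _ G A B h => thinness_le h, ?_⟩
  obtain ⟨P, p, hP⟩ := RAM.Cmd.exists_runs RAM.mainCmd
  refine ⟨P, p, fun n G A B h => ?_⟩
  obtain ⟨τ, T, hrun, hT, hτ⟩ := hP (RAM.inputState G A)
  obtain ⟨v, c, hvc, h2, h3⟩ := RAM.exec_mainCmd h
  refine ⟨τ, T, hrun, hT, v, c, hvc, fun i => ?_, fun x => ?_⟩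
  · rw [hτ]
    exact h2 i
  · rw [hτ]
    exact h3 x
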